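/- Identify $\mathbb{R}^8=\mathbb{H}\oplus\mathbb{H}$ with coordinates $(x^0,\dots,x^3,y^0,\dots,y^3)$ by means of $x=x^0-x^1\mathbf i-x^2\mathbf j-x^3\mathbf k$ and $y=y^0-y^1\mathbf i-y^2\mathbf j-y^3\mathbf k$, let $r$ be the radial vector field on $\mathbb{R}^8$, and let $\omega_1^x=dx^{01}+dx^{23}$, $\omega_2^x=dx^{02}-dx^{13}$, $\omega_3^x=dx^{03}+dx^{12}$, and likewise $\omega_i^y$. Put $$\Psi_0=dx^{0123}+dy^{0123}+\omega_1^x\wedge\omega_1^y+\omega_2^x\wedge\omega_2^y-\omega_3^x\wedge\omega_3^y,\qquad \zeta_i=r\lrcorner(\omega_i^x+\omega_i^y),\qquad \bar\omega_i=\omega_i^x+\omega_i^y-\tfrac12\epsilon_{ijk}\,\zeta_j\wedge\zeta_k .$$ The standard and the squashed nearly parallel $G_2$-structures on $S^7\subset\mathbb{R}^8$ are $$\phi_{std}=(r\lrcorner\Psi_0)|_{S^7},\qquad \phi_{sq}=\tfrac{27}{25}\Big(\tfrac15\,\zeta_1\wedge\zeta_2\wedge\zeta_3-\sum_{i=1}^3\zeta_i\wedge\bar\omega_i\Big)\Big|_{S^7}.$$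 The (right) quaternionic Hopf fibration is the quotient map of $S^7$ by right multiplication by unit quaternions, $\pi:S^7\to S^4\subset\mathbb{R}\oplus\mathbb{H}$, $\pi(x,y)=(|x|^2-|y|^2,\,2y\bar x)$. Here $\mathbb{R}\oplus\mathbb{H}$ has coordinates $(a,z^0,\dots,z^3)$ with $z=z^0-z^1\mathbf i-z^2\mathbf j-z^3\mathbf k$, and $S^4$ carries the round metric and the orientation as boundary of the unit ball (outward normal first). A 3-form $\phi$ defining a $G_2$-structure determines a metric $g_\phi$ and an orientation by $6\,g_\phi(v,v)\,\mathrm{Vol}_{g_\phi}=(v\lrcorner\phi)\wedge(v\lrcorner\phi)\wedge\phi$, and a connection $A$ on a principal bundle over $S^7$ is a $G_2$-instanton with respect to $\phi$ if its curvature satisfies $F_A+*_{g_\phi}(\phi\wedge F_A)=0$. A connection $B$ on a principal bundle over $S^4$ is an ASD instanton if $*F_B=-F_B$. Let $G$ be a Lie group and let $B$ be a smooth connection on a smooth principal $G$-bundle over $S^4$. Then $B$ is an ASD instanton if and only if the pullback $A=\pi^*B$ is a $G_2$-instanton with respect to $\phi_{std}$; and $B$ is an ASD instanton if and only if $\pi^*B$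 is a $G_2$-instanton with respect to $\phi_{sq}$. -/

import Mathlib

open Bundle Manifold Metric Module
open scoped ContDiff Manifold Topology Quaternion

noncomputable section

/-! ## Multilinear algebra: wedge product, interior product, Hodge star -/

/-- Wedge product of a real `k`-form with a `W`-valued `l`-form on a real vector space `V`,
normalised so that `(dx ∧ dy) (∂x, ∂y) = 1` (sum over shuffles). -/
def wedge {V W : Type*} [AddCommGroup V] [Module ℝ V] [AddCommGroup W] [Module ℝ W] {k l : ℕ}
    (α : V [⋀^Fin k]→ₗ[ℝ] ℝ) (β : V [⋀^Fin l]→ₗ[ℝ] W) : V [⋀^Fin (k + l)]→ₗ[ℝ] W :=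
  ((TensorProduct.lid ℝ W).toLinearMap.compAlternatingMap (α.domCoprod β)).domDomCongr
    finSumFinEquiv

/-- The Hodge star `⋆ : Λ^k V^* ⊗ W → Λ^m V^* ⊗ W` of the inner product and orientation of the
`(k + m)`-dimensional space `V` for which the basis `b` is orthonormal and positively oriented:
`(⋆α)(v₁, …, v_m) = (1 / k!) ∑ α(b_{i₁}, …, b_{i_k}) vol(b_{i₁}, …, b_{i_k}, v₁, …, v_m)`,
where `vol = b.det`. In particular `⋆ (b^I) = b^J` whenever `b^I ∧ b^J = vol`. -/
def hodgeStar {V W : Type*} [AddCommGroup V] [Module ℝ V] [AddCommGroup W] [Module ℝ W] {k m : ℕ}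
    (b : Basis (Fin (k + m)) ℝ V) (α : V [⋀^Fin k]→ₗ[ℝ] W) (v : Fin m → V) : W :=
  (k.factorial : ℝ)⁻¹ •
    ∑ i : Fin k → Fin (k + m), b.det (Fin.append (fun j => b (i j)) v) • α (fun j => b (i j))

/-- Let `φ` be a 3-form on a 7-dimensional space. The basis `b` is an oriented orthonormal frame
for the metric and orientation defined by `φ`, i.e. the metric `g` and volume form `vol` which it
determines satisfy `6 g(v, v) vol = (v ⌟ φ) ∧ (v ⌟ φ) ∧ φ` for all `v`. -/
def IsG2Frame {V : Type*} [AddCommGroup V] [Module ℝ V] (φ : V [⋀^Fin 3]→ₗ[ℝ] ℝ)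
    (b : Basis (Fin 7) ℝ V) : Prop :=
  ∀ v : V, wedge (wedge (φ.curryLeft v) (φ.curryLeft v)) φ =
    (6 * ∑ i, (b.repr v i) ^ 2) • (b.det : V [⋀^Fin 7]→ₗ[ℝ] ℝ)

/-- The algebraic equation `ξ + ⋆ (φ ∧ ξ) = 0` for a vector-valued 2-form `ξ`, where `⋆` is the
Hodge star of the metric and orientation defined by the 3-form `φ` on a 7-dimensional space. -/
def SatisfiesG2Equation {V W : Type*} [AddCommGroup V] [Module ℝ V] [AddCommGroup W] [Module ℝ W]
    (φ : V [⋀^Fin 3]→ₗ[ℝ] ℝ) (ξ : V [⋀^Fin 2]→ₗ[ℝ] W) : Prop :=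
  ∃ b : Basis (Fin 7) ℝ V, IsG2Frame φ b ∧
    ∀ v : Fin 2 → V, ξ v + hodgeStar (k := 5) (m := 2) b (wedge φ ξ) v = 0

/-! ## Principal bundles

A principal `G`-bundle `P → B` is given by its fibres `E x`, `x : B`, with total space
`P = TotalSpace G E`. The group `G` acts on the right: `p · g` is `MulOpposite.op g • p`. -/

section PrincipalBundle

variable {B : Type*} [TopologicalSpace B]
  {F : Type*} [NormedAddCommGroup F] [NormedSpace ℝ F]
  {G : Type*} [TopologicalSpace G] [ChartedSpace F G] [Group G]
  {E : B → Type*} [TopologicalSpace (TotalSpace G E)] [∀ x, TopologicalSpace (E x)]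
  [FiberBundle G E] [∀ x, MulAction Gᵐᵒᵖ (E x)]

/-- The right translation `p ↦ p · g` on the total space. -/
def rightMul {B : Type*} {G : Type*} [Group G] {E : B → Type*} [∀ x, MulAction Gᵐᵒᵖ (E x)]
    (g : G) (p : TotalSpace G E) : TotalSpace G E :=
  ⟨p.proj, MulOpposite.op g • p.2⟩

/-- A smooth principal `G`-bundle over a manifold `B` modelled on `ℝⁿ`: the local trivializations
`P|_U ≅ U × G` in the bundle atlas are equivariant for right translations and are related by
smooth transition functions `U ∩ U' → G` (acting by left multiplication). Here `F` is the model
vector space of the Lie group `G`. -/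
class SmoothPrincipalBundle (n : ℕ) (F : Type*) [NormedAddCommGroup F] [NormedSpace ℝ F]
    {B : Type*} [TopologicalSpace B] [ChartedSpace (EuclideanSpace ℝ (Fin n)) B]
    (G : Type*) [TopologicalSpace G] [ChartedSpace F G] [Group G]
    (E : B → Type*) [TopologicalSpace (TotalSpace G E)] [∀ x, TopologicalSpace (E x)]
    [FiberBundle G E] [∀ x, MulAction Gᵐᵒᵖ (E x)] : Prop where
  trivialization_rightMul : ∀ (e : Trivialization G (π G E)) [MemTrivializationAtlas e]
    (p : TotalSpace G E) (g : G), p.proj ∈ e.baseSet → (e (rightMul g p)).2 = (e p).2 * g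
  contMDiffOn_transition : ∀ (e e' : Trivialization G (π G E)) [MemTrivializationAtlas e]
    [MemTrivializationAtlas e'],
    ContMDiffOn (𝓡 n) 𝓘(ℝ, F) ∞ (fun x => e.coordChange e' x 1) (e.baseSet ∩ e'.baseSet)

/-- The total space of a bundle with fibre `G` over `B` as a manifold: charts are the local
trivializations followed by products of charts of `B` and of `G`. -/
instance totalSpaceChartedSpace {H : Type*} [TopologicalSpace H] [ChartedSpace H B] :
    ChartedSpace (ModelProd H F) (TotalSpace G E) :=
  ChartedSpace.comp _ (B × G) _

/-- The fibres of a pullback bundle inherit the action of the structure group. -/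
instance pullbackMulAction {M : Type*} [Monoid M] {B' : Type*} {E : B → Type*}
    [∀ x, MulAction M (E x)] (f : B' → B) (y : B') : MulAction M ((f *ᵖ E) y) :=
  inferInstanceAs (MulAction M (E (f y)))

/-- The adjoint action `Ad g` of a Lie group on its Lie algebra. -/
def adjointAction (g : G) :
    GroupLieAlgebra 𝓘(ℝ, F) G → GroupLieAlgebra 𝓘(ℝ, F) G :=
  fun X => (mfderiv 𝓘(ℝ, F) 𝓘(ℝ, F) (fun h : G => g * h * g⁻¹) 1 X : F)

/-! ## Connections and curvature -/

variable {n : ℕ} [ChartedSpace (EuclideanSpace ℝ (Fin n)) B]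

/-- A `𝔤`-valued 1-form on the total space of a bundle with fibre `G`, where `𝔤 = T₁G`. -/
abbrev LieValuedForm (n : ℕ) (F : Type*) [NormedAddCommGroup F] [NormedSpace ℝ F]
    {B : Type*} [TopologicalSpace B] [ChartedSpace (EuclideanSpace ℝ (Fin n)) B]
    (G : Type*) [TopologicalSpace G] [ChartedSpace F G] [Group G]
    (E : B → Type*) [TopologicalSpace (TotalSpace G E)] [∀ x, TopologicalSpace (E x)]
    [FiberBundle G E] :=
  ∀ p : TotalSpace G E,
    TangentSpace ((𝓡 n).prod 𝓘(ℝ, F)) p →L[ℝ] GroupLieAlgebra 𝓘(ℝ, F) G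

/-- The fundamental vector field `X ↦ (d/dt) p · exp (tX) |_{t = 0}` at `p`, as the differential
at `1` of the orbit map `g ↦ p · g`. -/
def fundamentalVector (n : ℕ) [ChartedSpace (EuclideanSpace ℝ (Fin n)) B] (p : TotalSpace G E)
    (X : GroupLieAlgebra 𝓘(ℝ, F) G) : TangentSpace ((𝓡 n).prod 𝓘(ℝ, F)) p :=
  (mfderiv 𝓘(ℝ, F) ((𝓡 n).prod 𝓘(ℝ, F)) (fun g : G => rightMul g p) 1 X :
    EuclideanSpace ℝ (Fin n) × F)

/-- The 1-form `A` in the preferred chart at `p`: its pullback to the model vector space by the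
inverse of the chart. -/
def formInChart (A : LieValuedForm n F G E) (p : TotalSpace G E)
    (z : EuclideanSpace ℝ (Fin n) × F) : (EuclideanSpace ℝ (Fin n) × F) [⋀^Fin 1]→L[ℝ] F :=
  ContinuousAlternatingMap.ofSubsingleton ℝ (EuclideanSpace ℝ (Fin n) × F) F 0
    ((A ((extChartAt ((𝓡 n).prod 𝓘(ℝ, F)) p).symm z)).comp
      (mfderiv 𝓘(ℝ, EuclideanSpace ℝ (Fin n) × F) ((𝓡 n).prod 𝓘(ℝ, F))
        (extChartAt ((𝓡 n).prod 𝓘(ℝ, F)) p).symm z))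

/-- The exterior derivative `dA` at `p`, computed in the preferred chart at `p`. -/
def extDerivForm (A : LieValuedForm n F G E) (p : TotalSpace G E)
    (u v : TangentSpace ((𝓡 n).prod 𝓘(ℝ, F)) p) : GroupLieAlgebra 𝓘(ℝ, F) G :=
  (extDeriv (formInChart A p) (extChartAt ((𝓡 n).prod 𝓘(ℝ, F)) p p)
    ![mfderiv ((𝓡 n).prod 𝓘(ℝ, F)) 𝓘(ℝ, EuclideanSpace ℝ (Fin n) × F)
        (extChartAt ((𝓡 n).prod 𝓘(ℝ, F)) p) p u,
      mfderiv ((𝓡 n).prod 𝓘(ℝ, F)) 𝓘(ℝ, EuclideanSpace ℝ (Fin n) × F)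
        (extChartAt ((𝓡 n).prod 𝓘(ℝ, F)) p) p v] : F)

/-- `A` is (the connection form of) a smooth connection on the principal bundle `E`: a smooth
`𝔤`-valued 1-form on the total space with `(R_g)^* A = Ad(g⁻¹) A` that reproduces the generators
of the fundamental vector fields. -/
structure IsConnection [SmoothPrincipalBundle n F G E] (A : LieValuedForm n F G E) : Prop where
  smooth : ∀ p : TotalSpace G E,
    ContDiffOn ℝ ∞ (formInChart A p) (extChartAt ((𝓡 n).prod 𝓘(ℝ, F)) p).target
  equivariant : ∀ (p : TotalSpace G E) (g : G) (u : TangentSpace ((𝓡 n).prod 𝓘(ℝ, F)) p),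
    A (rightMul g p) (mfderiv ((𝓡 n).prod 𝓘(ℝ, F)) ((𝓡 n).prod 𝓘(ℝ, F)) (rightMul g) p u) =
      adjointAction g⁻¹ (A p u)
  fundamental : ∀ (p : TotalSpace G E) (X : GroupLieAlgebra 𝓘(ℝ, F) G),
    A p (fundamentalVector n p X) = X

/-- The horizontal part of a tangent vector of the total space. -/
def horizontalPart (A : LieValuedForm n F G E) (p : TotalSpace G E)
    (u : TangentSpace ((𝓡 n).prod 𝓘(ℝ, F)) p) : TangentSpace ((𝓡 n).prod 𝓘(ℝ, F)) p :=
  u - fundamentalVector n p (A p u)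

/-- The curvature form of a connection: the exterior covariant derivative of `A`, that is
`F_A(u, v) = dA(hor u, hor v)`. -/
def curvature (A : LieValuedForm n F G E) (p : TotalSpace G E)
    (u v : TangentSpace ((𝓡 n).prod 𝓘(ℝ, F)) p) : GroupLieAlgebra 𝓘(ℝ, F) G :=
  extDerivForm A p (horizontalPart A p u) (horizontalPart A p v)

/-- The 2-form `β` on the tangent space of the base at the point under `p` is the curvature
`F_A` of the connection, with the fibre of the adjoint bundle identified with `𝔤` by means
of `p`: the curvature form at `p` is the pullback of `β` by the bundle projection. -/
def IsCurvatureAt (A : LieValuedForm n F G E) (p : TotalSpace G E)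
    (β : TangentSpace (𝓡 n) p.proj [⋀^Fin 2]→ₗ[ℝ] GroupLieAlgebra 𝓘(ℝ, F) G) : Prop :=
  ∀ u v : TangentSpace ((𝓡 n).prod 𝓘(ℝ, F)) p, curvature A p u v =
    β ![mfderiv ((𝓡 n).prod 𝓘(ℝ, F)) (𝓡 n) (π G E) p u,
        mfderiv ((𝓡 n).prod 𝓘(ℝ, F)) (𝓡 n) (π G E) p v]

/-- The pullback `f^* A` of a connection form to the pullback bundle `f^* P`, by means of the
bundle map `f^* P → P` covering `f`. -/
def pullbackForm {m : ℕ} {B' : Type*} [TopologicalSpace B']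
    [ChartedSpace (EuclideanSpace ℝ (Fin m)) B'] [∀ x, Nonempty (E x)]
    (f : C(B', B)) (A : LieValuedForm n F G E) : LieValuedForm m F G (f *ᵖ E) :=
  fun q => (A (Pullback.lift f q)).comp
    (mfderiv ((𝓡 m).prod 𝓘(ℝ, F)) ((𝓡 n).prod 𝓘(ℝ, F)) (Pullback.lift f) q)

/-- The pullback of a smooth principal bundle by a smooth map is a smooth principal bundle. -/
theorem SmoothPrincipalBundle.pullback {m : ℕ} {B' : Type*} [TopologicalSpace B']
    [ChartedSpace (EuclideanSpace ℝ (Fin m)) B'] [∀ x, Nonempty (E x)]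
    [SmoothPrincipalBundle n F G E] (f : C(B', B)) (hf : ContMDiff (𝓡 m) (𝓡 n) ∞ f) :
    SmoothPrincipalBundle m F G (f *ᵖ E) where
  trivialization_rightMul := by
    rintro e ⟨e₀, he₀, rfl⟩ p g hp
    exact SmoothPrincipalBundle.trivialization_rightMul n F e₀ (Pullback.lift f p) g hp
  contMDiffOn_transition := by
    rintro e e' ⟨e₀, he₀, rfl⟩ ⟨e₁, he₁, rfl⟩
    have h := (SmoothPrincipalBundle.contMDiffOn_transition (n := n) (F := F) e₀ e₁).comp
      (hf.contMDiffOn (s := f ⁻¹' (e₀.baseSet ∩ e₁.baseSet))) subset_rfl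
    refine h.congr ?_
    rintro y ⟨hy, -⟩
    simp only [Trivialization.coordChange, Function.comp_apply]
    have hy' : f y ∈ e₀.baseSet := hy
    change (e₁ (⟨f y, e₀.symm (f y) 1⟩ : TotalSpace G E)).2 = _
    rw [← e₀.mk_symm hy' 1]

end PrincipalBundle

/-! ## The spheres and the quaternionic Hopf fibration -/

/-- `ℝ⁸ = ℍ ⊕ ℍ` with coordinates `(x⁰, …, x³, y⁰, …, y³)`. -/
abbrev R8 := EuclideanSpace ℝ (Fin 8)

/-- `ℝ⁵ = ℝ ⊕ ℍ` with coordinates `(a, z⁰, …, z³)`. -/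
abbrev R5 := EuclideanSpace ℝ (Fin 5)

/-- The unit sphere in `ℝ⁸`. -/
abbrev S7 := sphere (0 : R8) 1

/-- The unit sphere in `ℝ⁵`. -/
abbrev S4 := sphere (0 : R5) 1

/-- The identification of `ℝ⁴` with `ℍ` by the basis `1, -i, -j, -k`. -/
def toQuaternion (t : Fin 4 → ℝ) : ℍ[ℝ] := ⟨t 0, -t 1, -t 2, -t 3⟩

/-- The quaternionic coordinate `x = x⁰ - x¹ i - x² j - x³ k` on `ℝ⁸`. -/
def quatX (r : R8) : ℍ[ℝ] := toQuaternion ![r 0, r 1, r 2, r 3]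

/-- The quaternionic coordinate `y = y⁰ - y¹ i - y² j - y³ k` on `ℝ⁸`. -/
def quatY (r : R8) : ℍ[ℝ] := toQuaternion ![r 4, r 5, r 6, r 7]

/-- The map `(x, y) ↦ (|x|² - |y|², 2 y x̄)` from `ℍ ⊕ ℍ` to `ℝ ⊕ ℍ`. A unit vector `(x, y)` is
sent to the traceless self-adjoint matrix `2 (x, y)ᵀ (x̄, ȳ) - 1 = [[a, z̄], [z, -a]]`. -/
def hopfAmbient (r : R8) : R5 :=
  let z : ℍ[ℝ] := (2 : ℝ) • (quatY r * star (quatX r))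
  !₂[Quaternion.normSq (quatX r) - Quaternion.normSq (quatY r), z.re, -z.imI, -z.imJ, -z.imK]

theorem hopfAmbient_eq (r : R8) : hopfAmbient r =
    !₂[r 0 ^ 2 + r 1 ^ 2 + r 2 ^ 2 + r 3 ^ 2 - (r 4 ^ 2 + r 5 ^ 2 + r 6 ^ 2 + r 7 ^ 2),
      2 * (r 4 * r 0 + r 5 * r 1 + r 6 * r 2 + r 7 * r 3),
      2 * (-r 4 * r 1 + r 5 * r 0 + r 6 * r 3 - r 7 * r 2),
      2 * (-r 4 * r 2 - r 5 * r 3 + r 6 * r 0 + r 7 * r 1),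
      2 * (-r 4 * r 3 + r 5 * r 2 - r 6 * r 1 + r 7 * r 0)] := by
  have hx : (quatX r).re = r 0 ∧ (quatX r).imI = -r 1 ∧ (quatX r).imJ = -r 2 ∧
      (quatX r).imK = -r 3 := ⟨rfl, rfl, rfl, rfl⟩
  have hy : (quatY r).re = r 4 ∧ (quatY r).imI = -r 5 ∧ (quatY r).imJ = -r 6 ∧
      (quatY r).imK = -r 7 := ⟨rfl, rfl, rfl, rfl⟩
  obtain ⟨hx0, hx1, hx2, hx3⟩ := hx
  obtain ⟨hy0, hy1, hy2, hy3⟩ := hy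
  ext i
  fin_cases i <;>
    simp [hopfAmbient, Quaternion.normSq_def', hx0, hx1, hx2, hx3, hy0, hy1, hy2, hy3] <;> ring

theorem hopfAmbient_norm (r : R8) (hr : ‖r‖ = 1) : ‖hopfAmbient r‖ = 1 := by
  have h : ‖r‖ ^ 2 = 1 := by rw [hr]; norm_num
  have h2 : ‖hopfAmbient r‖ ^ 2 = (‖r‖ ^ 2) ^ 2 := by
    rw [hopfAmbient_eq]
    simp only [EuclideanSpace.norm_sq_eq, Real.norm_eq_abs, sq_abs, Fin.sum_univ_five,
      Fin.sum_univ_eight]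
    simp
    ring
  rw [h] at h2
  nlinarith [norm_nonneg (hopfAmbient r)]

theorem contDiff_hopfAmbient : ContDiff ℝ ∞ hopfAmbient := by
  rw [contDiff_euclidean]
  intro i
  simp only [hopfAmbient_eq]
  fin_cases i <;> simp <;> fun_prop

/-- The (right) quaternionic Hopf fibration `S⁷ → S⁴`, the quotient map for the action of the unit
quaternions on `S⁷ ⊆ ℍ ⊕ ℍ` by right multiplication. -/
def hopf : C(S7, S4) where
  toFun r := ⟨hopfAmbient r, by simpa using hopfAmbient_norm r (by simp)⟩
  continuous_toFun := Continuous.subtype_mk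
    (contDiff_hopfAmbient.continuous.comp continuous_subtype_val)
    (fun r => by simpa using hopfAmbient_norm r (by simp))

theorem contMDiff_hopf : ContMDiff (𝓡 7) (𝓡 4) ∞ hopf := by
  have : Fact (finrank ℝ R8 = 7 + 1) := ⟨by simp⟩
  have : Fact (finrank ℝ R5 = 4 + 1) := ⟨by simp⟩
  exact ContMDiff.codRestrict_sphere (n := 4)
    (contDiff_hopfAmbient.contMDiff.comp (contMDiff_coe_sphere (n := 7)))
    (fun r => (hopf r).2 : ∀ r : S7, hopfAmbient r ∈ S4)

instance hopfPullbackPrincipal {F : Type*} [NormedAddCommGroup F] [NormedSpace ℝ F]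
    {G : Type*} [TopologicalSpace G] [ChartedSpace F G] [Group G]
    {E : S4 → Type*} [TopologicalSpace (TotalSpace G E)] [∀ x, TopologicalSpace (E x)]
    [FiberBundle G E] [∀ x, MulAction Gᵐᵒᵖ (E x)] [∀ x, Nonempty (E x)]
    [SmoothPrincipalBundle 4 F G E] : SmoothPrincipalBundle 7 F G (hopf *ᵖ E) :=
  SmoothPrincipalBundle.pullback hopf contMDiff_hopf

/-! ## The standard and the squashed `G₂`-structures on `S⁷` -/

/-- The coordinate 1-form `dr^i` on `ℝ⁸`. -/
def dCoord (i : Fin 8) : R8 [⋀^Fin 1]→ₗ[ℝ] ℝ :=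
  AlternatingMap.ofSubsingleton ℝ R8 ℝ 0 (EuclideanSpace.proj i : R8 →L[ℝ] ℝ).toLinearMap

/-- The self-dual 2-forms `ω₁ = d⁰¹ + d²³`, `ω₂ = d⁰² - d¹³`, `ω₃ = d⁰³ + d¹²` in the four
coordinates listed by `s` (indexed here by `0, 1, 2`). -/
def omegaForm (s : Fin 4 → Fin 8) : Fin 3 → R8 [⋀^Fin 2]→ₗ[ℝ] ℝ :=
  ![wedge (dCoord (s 0)) (dCoord (s 1)) + wedge (dCoord (s 2)) (dCoord (s 3)),
    wedge (dCoord (s 0)) (dCoord (s 2)) - wedge (dCoord (s 1)) (dCoord (s 3)),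
    wedge (dCoord (s 0)) (dCoord (s 3)) + wedge (dCoord (s 1)) (dCoord (s 2))]

/-- The 4-form `d⁰¹²³` in the four coordinates listed by `s`. -/
def volForm (s : Fin 4 → Fin 8) : R8 [⋀^Fin 4]→ₗ[ℝ] ℝ :=
  wedge (wedge (wedge (dCoord (s 0)) (dCoord (s 1))) (dCoord (s 2))) (dCoord (s 3))

/-- The indices of the `x`-coordinates. -/
def xIdx : Fin 4 → Fin 8 := ![0, 1, 2, 3]

/-- The indices of the `y`-coordinates. -/
def yIdx : Fin 4 → Fin 8 := ![4, 5, 6, 7]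

/-- The standard 4-form
`Ψ₀ = dx⁰¹²³ + dy⁰¹²³ + ω₁ˣ ∧ ω₁ʸ + ω₂ˣ ∧ ω₂ʸ - ω₃ˣ ∧ ω₃ʸ` on `ℝ⁸`. -/
def Psi0 : R8 [⋀^Fin 4]→ₗ[ℝ] ℝ :=
  volForm xIdx + volForm yIdx + wedge (omegaForm xIdx 0) (omegaForm yIdx 0) +
    wedge (omegaForm xIdx 1) (omegaForm yIdx 1) - wedge (omegaForm xIdx 2) (omegaForm yIdx 2)

/-- The restriction to the tangent space `T_x S⁷` of a 3-form on `ℝ⁸`. -/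
def restrictToS7 (x : S7) (Φ : R8 [⋀^Fin 3]→ₗ[ℝ] ℝ) :
    TangentSpace (𝓡 7) x [⋀^Fin 3]→ₗ[ℝ] ℝ :=
  Φ.compLinearMap (mfderiv (𝓡 7) 𝓘(ℝ, R8) ((↑) : S7 → R8) x).toLinearMap

/-- The standard `G₂`-structure `φ_std = (r ⌟ Ψ₀)|_{S⁷}`. -/
def phiStd (x : S7) : TangentSpace (𝓡 7) x [⋀^Fin 3]→ₗ[ℝ] ℝ :=
  restrictToS7 x (Psi0.curryLeft (x : R8))

/-- The 1-forms `ζ_i = r ⌟ (ω_iˣ + ω_iʸ)` at the point `r`. -/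
def zetaForm (r : R8) (i : Fin 3) : R8 [⋀^Fin 1]→ₗ[ℝ] ℝ :=
  (omegaForm xIdx i + omegaForm yIdx i : R8 [⋀^Fin 2]→ₗ[ℝ] ℝ).curryLeft r

/-- The 2-forms `ω̄_i = ω_iˣ + ω_iʸ - ½ ε_{ijk} ζ_j ∧ ζ_k` at the point `r` (cyclic indices). -/
def omegaBar (r : R8) (i : Fin 3) : R8 [⋀^Fin 2]→ₗ[ℝ] ℝ :=
  omegaForm xIdx i + omegaForm yIdx i - wedge (zetaForm r (i + 1)) (zetaForm r (i + 2))

/-- The squashed `G₂`-structure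
`φ_sq = (27 / 25) ((1 / 5) ζ₁ ∧ ζ₂ ∧ ζ₃ - ∑ ζ_i ∧ ω̄_i)` restricted to `S⁷`. -/
def phiSq (x : S7) : TangentSpace (𝓡 7) x [⋀^Fin 3]→ₗ[ℝ] ℝ :=
  restrictToS7 x ((27 / 25 : ℝ) •
    ((1 / 5 : ℝ) • (wedge (wedge (zetaForm (x : R8) 0) (zetaForm (x : R8) 1))
        (zetaForm (x : R8) 2) : R8 [⋀^Fin 3]→ₗ[ℝ] ℝ) -
      ∑ i, (wedge (zetaForm (x : R8) i) (omegaBar (x : R8) i) : R8 [⋀^Fin 3]→ₗ[ℝ] ℝ)))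

/-! ## Instantons -/

/-- The inclusion `T_x S⁴ ⊆ ℝ⁵`. -/
def tangentToR5 (x : S4) (v : TangentSpace (𝓡 4) x) : R5 :=
  mfderiv (𝓡 4) 𝓘(ℝ, R5) ((↑) : S4 → R5) x v

/-- `b` is an orthonormal basis of `T_x S⁴` for the round metric, positively oriented for the
orientation of `S⁴` as the boundary of the unit ball in `ℝ⁵` (outward normal first). -/
def IsOrientedFrameS4 (x : S4) (b : Basis (Fin 4) ℝ (TangentSpace (𝓡 4) x)) : Prop :=
  Orthonormal ℝ (fun i => tangentToR5 x (b i)) ∧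
    0 < (Matrix.of ![fun k => (x : R5) k, fun k => tangentToR5 x (b 0) k,
      fun k => tangentToR5 x (b 1) k, fun k => tangentToR5 x (b 2) k,
      fun k => tangentToR5 x (b 3) k] : Matrix (Fin 5) (Fin 5) ℝ).det

/-- `⋆β = -β` for a vector-valued 2-form `β` on `T_x S⁴`. -/
def IsAntiSelfDual {W : Type*} [AddCommGroup W] [Module ℝ W] (x : S4)
    (β : TangentSpace (𝓡 4) x [⋀^Fin 2]→ₗ[ℝ] W) : Prop :=
  ∃ b : Basis (Fin 4) ℝ (TangentSpace (𝓡 4) x), IsOrientedFrameS4 x b ∧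
    ∀ v : Fin 2 → TangentSpace (𝓡 4) x, hodgeStar (k := 2) (m := 2) b β v = -β v

section Instantons

variable {F : Type*} [NormedAddCommGroup F] [NormedSpace ℝ F]
  {G : Type*} [TopologicalSpace G] [ChartedSpace F G] [Group G]

/-- Anti-self-dual instantons: connections on a principal bundle over `S⁴` with anti-self-dual
curvature. -/
def IsASDInstanton {E : S4 → Type*} [TopologicalSpace (TotalSpace G E)]
    [∀ x, TopologicalSpace (E x)] [FiberBundle G E] [∀ x, MulAction Gᵐᵒᵖ (E x)]
    [SmoothPrincipalBundle 4 F G E] (A : LieValuedForm 4 F G E) : Prop :=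
  IsConnection A ∧ ∀ p : TotalSpace G E, ∃ β, IsCurvatureAt A p β ∧ IsAntiSelfDual p.proj β

/-- `G₂`-instantons for the `G₂`-structure `φ`: connections on a principal bundle over `S⁷` whose
curvature satisfies `F + ⋆ (φ ∧ F) = 0`. -/
def IsG2Instanton (φ : ∀ x : S7, TangentSpace (𝓡 7) x [⋀^Fin 3]→ₗ[ℝ] ℝ)
    {E : S7 → Type*} [TopologicalSpace (TotalSpace G E)]
    [∀ x, TopologicalSpace (E x)] [FiberBundle G E] [∀ x, MulAction Gᵐᵒᵖ (E x)]
    [SmoothPrincipalBundle 7 F G E] (A : LieValuedForm 7 F G E) : Prop :=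
  IsConnection A ∧
    ∀ p : TotalSpace G E, ∃ β, IsCurvatureAt A p β ∧ SatisfiesG2Equation (φ p.proj) β

end Instantons

end

noncomputable section

/-! ## Evaluation of wedge products -/

section WedgeEvaluation

variable {V W : Type*} [AddCommGroup V] [Module ℝ V] [AddCommGroup W] [Module ℝ W]

/-! Both equations constrain a 2-form at a single point, so the theorem splits into linear algebra
on one tangent space and the naturality of curvature.

Linear algebra. Write σ_a = ω_aˣ + ω_aʸ. Since Ψ₀ = ½(σ₁² + σ₂² - σ₃²) (`Psi0_apply`), both G₂-forms
are built from the σ_a and the position vector alone. Left multiplication of x and of y by unit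
quaternions, and real rotations mixing x with y, preserve the σ_a and the metric and cover rotations
of ℝ⁵; their composites carry (1, 0) to any point of S⁷ (`exists_hopfSymmetry`). So everything can
be computed at (1, 0) in the standard frame. There three vectors are tangent to the Hopf fibre, and
dπ sends the other four to twice an oriented orthonormal frame of S⁴ (`HopfSymmetry.exists_frame`).
In this frame φ_std has the constant coefficients `g2Coeff`, and φ_sq acquires the same ones once
the vertical and horizontal blocks are rescaled and two vertical vectors are reversed
(`phiStd_frame`, `squash_coeff`).

Let ξ be a 2-form that vanishes on the vertical vectors. In ⋆(φ ∧ ξ) the term e¹²³ of φ contributes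
the four-dimensional star of ξ, and the remaining terms contribute the pairings of ξ with a basis of
the self-dual forms. Hence ξ + ⋆(φ ∧ ξ) = 0 says exactly that ξ is anti-self-dual on the horizontal
four-plane (`g2_hodge_equation_iff`). Rescaling that plane multiplies all components of ξ by one
factor, so the squashing does not affect the condition.

Both conditions are defined by the existence of a suitable frame. Any two admissible frames differ
by an orthogonal matrix of determinant one, so one frame decides (`IsG2Frame.exists_orthogonal`,
`isAntiSelfDual_iff`).

Bundles. The canonical map from the pulled-back bundle to P is smooth and equivariant, commutes with
d, and sends horizontal parts to horizontal parts; so the curvature of the pullback is the pullback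
of the curvature (`IsCurvatureAt.pullback`). The 2-form on the base that represents the curvature
exists and is unique (`exists_isCurvatureAt`, `IsCurvatureAt.unique`). As π is surjective, every
point of P is reached, and the pointwise equivalence transfers in both directions. -/

theorem factorial_smul_wedge_apply {k l : ℕ} (α : V [⋀^Fin k]→ₗ[ℝ] ℝ) (β : V [⋀^Fin l]→ₗ[ℝ] W)
    (v : Fin (k + l) → V) :
    ((k.factorial : ℝ) * l.factorial) • wedge α β v = ∑ σ : Equiv.Perm (Fin (k + l)),
      ((Equiv.Perm.sign σ : ℤ) : ℝ) • α (fun i => v (σ (Fin.castAdd l i))) •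
        β (fun j => v (σ (Fin.natAdd k j))) := by
  have h := congrArg (fun f => TensorProduct.lid ℝ W (f (v ∘ finSumFinEquiv)))
    (MultilinearMap.domCoprod_alternization_eq α β)
  simp only [Fintype.card_fin, AlternatingMap.smul_apply, map_nsmul] at h
  have h2 : TensorProduct.lid ℝ W (α.domCoprod β (v ∘ finSumFinEquiv)) = wedge α β v := rfl
  rw [h2] at h
  rw [← Nat.cast_mul, Nat.cast_smul_eq_nsmul, ← h, MultilinearMap.alternatization_apply, map_sum]
  refine Fintype.sum_equiv finSumFinEquiv.permCongr _ _ fun σ => ?_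
  rw [Equiv.Perm.sign_permCongr]
  simp [MultilinearMap.domDomCongr_apply, Units.smul_def, Function.comp_def,
    Int.cast_smul_eq_zsmul]

/-- A permutation of `n + 1` slots is determined by the slot `p` that receives `v₀` and by a
permutation of the rest. This is the combinatorial core of the Leibniz rule for interior products.
-/
theorem sum_perm_succ {V : Type*} {n : ℕ} {M : Type*} [AddCommGroup M] [Module ℝ M] (f : (Fin (n + 1) → V) → M)
    (v₀ : V) (v : Fin n → V) :
    ∑ σ : Equiv.Perm (Fin (n + 1)), ((Equiv.Perm.sign σ : ℤ) : ℝ) •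
        f (fun i => Matrix.vecCons v₀ v (σ i)) =
      ∑ p : Fin (n + 1), ∑ e : Equiv.Perm (Fin n),
        ((-1 : ℝ) ^ (p : ℕ) * ((Equiv.Perm.sign e : ℤ) : ℝ)) •
          f (p.insertNth v₀ (fun i => v (e i))) := by
  rw [← Fintype.sum_prod_type']
  symm
  -- `p.cycleRange` carries slot `p` to `0` and keeps the order of the others, with sign `(-1) ^ p`;
  -- then `e` permutes the nonzero indices.
  let g : Fin (n + 1) × Equiv.Perm (Fin n) → Equiv.Perm (Fin (n + 1)) := fun x =>
    Equiv.Perm.decomposeFin.symm (0, x.2) * x.1.cycleRange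
  have hg : ∀ p e i, g (p, e) (p.succAbove i) = (e i).succ := by
    intro p e i
    simp [g, Fin.cycleRange_succAbove]
  have hg0 : ∀ p e, g (p, e) p = 0 := by
    intro p e
    simp [g]
  have hbij : Function.Bijective g := by
    rw [Fintype.bijective_iff_injective_and_card]
    constructor
    · rintro ⟨p, e⟩ ⟨q, e'⟩ h
      have hpq : p = q := by
        apply (g (q, e')).injective
        rw [hg0, ← h, hg0]
      subst hpq
      congr 1
      ext i
      have := congrArg (fun s => s (p.succAbove i)) h
      simp only [hg] at this
      simpa using congrArg Fin.val this
    · simp [Fintype.card_perm, Nat.factorial_succ]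
  refine Fintype.sum_bijective g hbij _ _ ?_
  rintro ⟨p, e⟩
  have hs : Equiv.Perm.sign (g (p, e)) = (-1) ^ (p : ℕ) * Equiv.Perm.sign e := by
    simp [g, mul_comm]
  rw [hs]
  congr 1
  · simp
  · congr 1
    ext i
    refine Fin.succAboveCases p ?_ (fun j => ?_) i
    · simp [hg0]
    · simp [hg]

/-- Interior multiplication by `v₀` is an antiderivation of the wedge product. In the sum over
permutations, `v₀` is fed either to `α` or to `β`; each of the `k + 1`, respectively `l + 1`,
possible slots gives the same contribution, which accounts for the change in the factorials. -/
theorem wedge_apply_cons {k l : ℕ} (α : V [⋀^Fin (k + 1)]→ₗ[ℝ] ℝ) (β : V [⋀^Fin (l + 1)]→ₗ[ℝ] W)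
    (v₀ : V) (v : Fin (k + 1 + l) → V) :
    wedge α β (Matrix.vecCons v₀ v) =
      wedge (α.curryLeft v₀) β (fun i => v (Fin.cast (by omega) i)) +
        (-1 : ℝ) ^ (k + 1) • wedge α (β.curryLeft v₀) v := by
  have hpos : (((k + 1).factorial : ℝ) * (l + 1).factorial) ≠ 0 := by positivity
  refine smul_right_injective W hpos ?_
  simp only
  rw [factorial_smul_wedge_apply]
  have h1 : (((k + 1).factorial : ℝ) * (l + 1).factorial) •
      wedge (α.curryLeft v₀) β (fun i => v (Fin.cast (by omega) i)) =
      ∑ q : Fin (k + 1), ∑ e : Equiv.Perm (Fin (k + 1 + l)), ((Equiv.Perm.sign e : ℤ) : ℝ) •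
        α (Matrix.vecCons v₀ fun i => v (e ((Fin.castAdd (l + 1) i).cast (by omega)))) •
        β (fun j => v (e ((Fin.natAdd k j).cast (by omega)))) := by
    rw [Finset.sum_const, Finset.card_univ, Fintype.card_fin, ← Nat.cast_smul_eq_nsmul ℝ,
      Nat.factorial_succ k, Nat.cast_mul, mul_assoc, mul_smul, factorial_smul_wedge_apply]
    congr 1
    refine Fintype.sum_equiv (finCongr (by omega)).permCongr _ _ fun σ => ?_
    rw [Equiv.Perm.sign_permCongr]
    simp
  have h2 : (((k + 1).factorial : ℝ) * (l + 1).factorial) •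
      wedge α (β.curryLeft v₀) v =
      ∑ q : Fin (l + 1), ∑ e : Equiv.Perm (Fin (k + 1 + l)), ((Equiv.Perm.sign e : ℤ) : ℝ) •
        α (fun i => v (e (Fin.castAdd l i))) •
        β (Matrix.vecCons v₀ fun j => v (e (Fin.natAdd (k + 1) j))) := by
    rw [Finset.sum_const, Finset.card_univ, Fintype.card_fin, ← Nat.cast_smul_eq_nsmul ℝ,
      Nat.factorial_succ l, Nat.cast_mul, mul_left_comm, mul_smul, factorial_smul_wedge_apply]
    rfl
  have h3 := sum_perm_succ (fun w : Fin (k + 1 + l + 1) → V =>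
    α (fun i => w (Fin.castAdd (l + 1) i)) • β (fun j => w (Fin.natAdd (k + 1) j))) v₀ v
  refine h3.trans ?_
  rw [smul_add, smul_comm _ ((-1 : ℝ) ^ (k + 1)), h1, h2]
  refine (Fin.sum_univ_add (a := k + 1) (b := l + 1) _).trans ?_
  rw [Finset.smul_sum]
  congr 1
  · refine Finset.sum_congr rfl fun q _ => Finset.sum_congr rfl fun e _ => ?_
    have ha : (fun i => Fin.insertNth (α := fun _ => V) (n := k + 1 + l) (Fin.castAdd (l + 1) q) v₀
        (fun i => v (e i)) (Fin.castAdd (l + 1) i)) =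
        q.insertNth v₀ (fun i => v (e ((Fin.castAdd (l + 1) i).cast (by omega)))) := by
      rw [Fin.eq_insertNth_iff]
      refine ⟨Fin.insertNth_apply_same _ _ _, ?_⟩
      funext i
      have : Fin.castAdd (l + 1) (q.succAbove i) = Fin.succAbove (n := k + 1 + l)
          (Fin.castAdd (l + 1) q) ((Fin.castAdd (l + 1) i).cast (by omega)) := by
        ext
        simp only [Fin.succAbove, Fin.lt_def]
        split_ifs <;> simp_all <;> omega
      simp only [Fin.removeNth]
      rw [this]
      exact Fin.insertNth_apply_succAbove _ _ _ _
    have hb : (fun j => Fin.insertNth (α := fun _ => V) (n := k + 1 + l) (Fin.castAdd (l + 1) q) v₀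
        (fun i => v (e i)) (Fin.natAdd (k + 1) j)) =
        (fun j : Fin (l + 1) => v (e ((Fin.natAdd k j).cast (by omega)))) := by
      funext j
      have : Fin.natAdd (k + 1) j = Fin.succAbove (n := k + 1 + l)
          (Fin.castAdd (l + 1) q) ((Fin.natAdd k j).cast (by omega)) := by
        ext
        simp only [Fin.succAbove, Fin.lt_def]
        have := q.2
        split_ifs <;> simp_all <;> omega
      rw [this]
      exact Fin.insertNth_apply_succAbove _ _ _ _
    -- Bringing `v₀` from slot `q` to the front of `α` costs `(-1) ^ q`, which cancels the sign of
    -- the permutation.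
    rw [ha, hb, AlternatingMap.map_insertNth, mul_comm, mul_smul, Fin.val_castAdd]
    congr 1
    rcases Nat.even_or_odd (q : ℕ) with h | h <;> simp [h.neg_one_pow]
  · refine Finset.sum_congr rfl fun q _ => ?_
    rw [Finset.smul_sum]
    refine Finset.sum_congr rfl fun e _ => ?_
    have ha : (fun i => Fin.insertNth (α := fun _ => V) (n := k + 1 + l) (Fin.natAdd (k + 1) q) v₀
        (fun i => v (e i)) (Fin.castAdd (l + 1) i)) =
        (fun i => v (e (Fin.castAdd l i))) := by
      funext j
      have : Fin.castAdd (l + 1) j = Fin.succAbove (n := k + 1 + l)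
          (Fin.natAdd (k + 1) q) (Fin.castAdd l j) := by
        ext
        simp only [Fin.succAbove, Fin.lt_def]
        have := j.2
        split_ifs <;> simp_all <;> omega
      rw [this]
      exact Fin.insertNth_apply_succAbove _ _ _ _
    have hb : (fun j => Fin.insertNth (α := fun _ => V) (n := k + 1 + l) (Fin.natAdd (k + 1) q) v₀
        (fun i => v (e i)) (Fin.natAdd (k + 1) j)) =
        q.insertNth v₀ (fun j => v (e (Fin.natAdd (k + 1) j))) := by
      rw [Fin.eq_insertNth_iff]
      refine ⟨Fin.insertNth_apply_same _ _ _, ?_⟩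
      funext i
      have : Fin.natAdd (k + 1) (q.succAbove i) = Fin.succAbove (n := k + 1 + l)
          (Fin.natAdd (k + 1) q) (Fin.natAdd (k + 1) i) := by
        ext
        simp only [Fin.succAbove, Fin.lt_def]
        split_ifs <;> simp_all <;> omega
      simp only [Fin.removeNth]
      rw [this]
      exact Fin.insertNth_apply_succAbove _ _ _ _
    -- The slot is now `k + 1 + q`, and moving `v₀` to the front of `β` costs only `(-1) ^ q`; the
    -- factor `(-1) ^ (k + 1)` survives.
    rw [ha, hb, AlternatingMap.map_insertNth, Fin.val_natAdd, pow_add]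
    rcases Nat.even_or_odd (q : ℕ) with h | h <;> simp [h.neg_one_pow, smul_smul, mul_assoc]

theorem wedge_zero_left {l : ℕ} (α : V [⋀^Fin 0]→ₗ[ℝ] ℝ) (β : V [⋀^Fin l]→ₗ[ℝ] W)
    (v : Fin (0 + l) → V) :
    wedge α β v = α ![] • β (fun i => v (Fin.cast (by omega) i)) := by
  have hpos : ((Nat.factorial 0 : ℝ) * l.factorial) ≠ 0 := by positivity
  refine smul_right_injective W hpos ?_
  simp only
  rw [factorial_smul_wedge_apply]
  have h : ∀ σ : Equiv.Perm (Fin (0 + l)), ((Equiv.Perm.sign σ : ℤ) : ℝ) •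
      α (fun i => v (σ (Fin.castAdd l i))) • β (fun j => v (σ (Fin.natAdd 0 j))) =
      α ![] • β (fun i => v (Fin.cast (by omega) i)) := by
    intro σ
    have h1 := β.map_perm (fun i => v (Fin.cast (by omega) i))
      ((finCongr (by omega : 0 + l = l)).permCongr σ)
    have h2 : ((fun i => v (Fin.cast (by omega) i)) ∘
      ⇑((finCongr (by omega : 0 + l = l)).permCongr σ)) = fun j => v (σ (Fin.natAdd 0 j)) := by
      funext j
      simp only [Function.comp_apply, Equiv.permCongr_apply, finCongr_apply, Fin.cast_cast]
      congr 2
      ext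
      simp
    rw [← h2, h1, Equiv.Perm.sign_permCongr, Units.smul_def, ← Int.cast_smul_eq_zsmul ℝ,
      Subsingleton.elim (fun i => v (σ (Fin.castAdd l i))) ![], smul_comm (α ![]), smul_smul]
    rcases Int.units_eq_one_or (Equiv.Perm.sign σ) with h | h <;> simp [h]
  rw [Finset.sum_congr rfl fun σ _ => h σ, Finset.sum_const, Finset.card_univ, Fintype.card_perm,
    Fintype.card_fin, ← Nat.cast_smul_eq_nsmul ℝ]
  simp

theorem wedge_zero_right {k : ℕ} (α : V [⋀^Fin k]→ₗ[ℝ] ℝ) (β : V [⋀^Fin 0]→ₗ[ℝ] W)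
    (v : Fin (k + 0) → V) :
    wedge α β v = α v • β ![] := by
  have hpos : ((k.factorial : ℝ) * Nat.factorial 0) ≠ 0 := by positivity
  refine smul_right_injective W hpos ?_
  simp only
  rw [factorial_smul_wedge_apply]
  have h : ∀ σ : Equiv.Perm (Fin (k + 0)), ((Equiv.Perm.sign σ : ℤ) : ℝ) •
      α (fun i => v (σ (Fin.castAdd 0 i))) • β (fun j => v (σ (Fin.natAdd k j))) =
      α v • β ![] := by
    intro σ
    have h1 : α (fun i => v (σ (Fin.castAdd 0 i))) = _ := α.map_perm v σ
    rw [h1, Units.smul_def, ← Int.cast_smul_eq_zsmul ℝ,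
      Subsingleton.elim (fun j => v (σ (Fin.natAdd k j))) ![], smul_smul]
    rcases Int.units_eq_one_or (Equiv.Perm.sign σ) with h | h <;> simp [h]
  rw [Finset.sum_congr rfl fun σ _ => h σ, Finset.sum_const, Finset.card_univ, Fintype.card_perm,
    Fintype.card_fin, ← Nat.cast_smul_eq_nsmul ℝ]
  simp

end WedgeEvaluation

/-! ### Leibniz rule in fixed low degrees, as rewriting rules on explicit vectors -/

section WedgeLowDegree

variable {V W : Type*} [AddCommGroup V] [Module ℝ V] [AddCommGroup W] [Module ℝ W]

theorem wedge_one_apply_cons {l : ℕ} (α : V [⋀^Fin 1]→ₗ[ℝ] ℝ) (β : V [⋀^Fin (l + 1)]→ₗ[ℝ] W)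
    (a : V) (v : Fin (1 + l) → V) :
    wedge α β (Matrix.vecCons a v : Fin (1 + l + 1) → V) =
      α ![a] • β (fun i => v (Fin.cast (by omega) i)) - wedge α (β.curryLeft a) v := by
  refine (wedge_apply_cons (k := 0) α β a v).trans ?_
  rw [show (-1 : ℝ) ^ (0 + 1) = -1 by norm_num, neg_one_smul, ← sub_eq_add_neg]
  congr 1
  exact wedge_zero_left _ _ _

theorem wedge_apply_one_cons {k : ℕ} (α : V [⋀^Fin (k + 1)]→ₗ[ℝ] ℝ) (β : V [⋀^Fin 1]→ₗ[ℝ] W)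
    (a : V) (v : Fin (k + 1) → V) :
    wedge α β (Matrix.vecCons a v : Fin (k + 1 + 0 + 1) → V) =
      wedge (α.curryLeft a) β v + (-1 : ℝ) ^ (k + 1) • α v • β ![a] := by
  refine (wedge_apply_cons (l := 0) α β a v).trans ?_
  congr 2
  exact wedge_zero_right _ _ _

theorem wedge_apply_1_1 (α : V [⋀^Fin 1]→ₗ[ℝ] ℝ) (β : V [⋀^Fin 1]→ₗ[ℝ] W) (a b : V) :
    wedge α β ![a, b] = α ![a] • β ![b] - α ![b] • β ![a] := by
  refine (wedge_one_apply_cons (l := 0) α β a ![b]).trans ?_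
  congr 1
  exact wedge_zero_right _ _ _

theorem wedge_apply_1_2 (α : V [⋀^Fin 1]→ₗ[ℝ] ℝ) (β : V [⋀^Fin 2]→ₗ[ℝ] W)
    (a b c : V) :
    wedge α β ![a, b, c] =
      α ![a] • β ![b, c] -
        wedge (k := 1) (l := 1) α (β.curryLeft a) ![b, c] :=
  wedge_one_apply_cons (l := 1) α β a ![b, c]

theorem wedge_apply_2_1 (α : V [⋀^Fin 2]→ₗ[ℝ] ℝ) (β : V [⋀^Fin 1]→ₗ[ℝ] W)
    (a b c : V) :
    wedge α β ![a, b, c] =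
      wedge (k := 1) (l := 1) (α.curryLeft a) β ![b, c] +
        α ![b, c] • β ![a] := by
  rw [wedge_apply_one_cons (k := 1) α β a (![b, c] : Fin 2 → V)]
  rw [show (-1 : ℝ) ^ (1 + 1) = 1 by norm_num, one_smul]

theorem wedge_apply_2_2 (α : V [⋀^Fin 2]→ₗ[ℝ] ℝ) (β : V [⋀^Fin 2]→ₗ[ℝ] W)
    (a b c d : V) :
    wedge α β ![a, b, c, d] =
      wedge (k := 1) (l := 2) (α.curryLeft a) β ![b, c, d] +
        wedge (k := 2) (l := 1) α (β.curryLeft a) ![b, c, d] := by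
  rw [wedge_apply_cons (k := 1) (l := 1) α β a (![b, c, d] : Fin 3 → V)]
  rw [show (-1 : ℝ) ^ (1 + 1) = 1 by norm_num, one_smul]
  congr 1

theorem wedge_apply_3_1 (α : V [⋀^Fin 3]→ₗ[ℝ] ℝ) (β : V [⋀^Fin 1]→ₗ[ℝ] W)
    (a b c d : V) :
    wedge α β ![a, b, c, d] =
      wedge (k := 2) (l := 1) (α.curryLeft a) β ![b, c, d] -
        α ![b, c, d] • β ![a] := by
  rw [wedge_apply_one_cons (k := 2) α β a (![b, c, d] : Fin 3 → V)]
  rw [show (-1 : ℝ) ^ (2 + 1) = -1 by norm_num, neg_one_smul, ← sub_eq_add_neg]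

theorem wedge_apply_3_2 (α : V [⋀^Fin 3]→ₗ[ℝ] ℝ) (β : V [⋀^Fin 2]→ₗ[ℝ] W)
    (a b c d e : V) :
    wedge α β ![a, b, c, d, e] =
      wedge (k := 2) (l := 2) (α.curryLeft a) β ![b, c, d, e] -
        wedge (k := 3) (l := 1) α (β.curryLeft a) ![b, c, d, e] := by
  rw [wedge_apply_cons (k := 2) (l := 1) α β a (![b, c, d, e] : Fin 4 → V)]
  rw [show (-1 : ℝ) ^ (2 + 1) = -1 by norm_num, neg_one_smul, ← sub_eq_add_neg]
  congr 1

theorem wedge_apply_1_3 (α : V [⋀^Fin 1]→ₗ[ℝ] ℝ) (β : V [⋀^Fin 3]→ₗ[ℝ] W)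
    (a b c d : V) :
    wedge α β ![a, b, c, d] =
      α ![a] • β ![b, c, d] -
        wedge (k := 1) (l := 2) α (β.curryLeft a) ![b, c, d] :=
  wedge_one_apply_cons (l := 2) α β a ![b, c, d]

theorem wedge_apply_2_3 (α : V [⋀^Fin 2]→ₗ[ℝ] ℝ) (β : V [⋀^Fin 3]→ₗ[ℝ] W)
    (a b c d e : V) :
    wedge α β ![a, b, c, d, e] =
      wedge (k := 1) (l := 3) (α.curryLeft a) β ![b, c, d, e] +
        wedge (k := 2) (l := 2) α (β.curryLeft a) ![b, c, d, e] := by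
  rw [wedge_apply_cons (k := 1) (l := 2) α β a (![b, c, d, e] : Fin 4 → V)]
  rw [show (-1 : ℝ) ^ (1 + 1) = 1 by norm_num, one_smul]
  congr 1

set_option maxRecDepth 20000 in
theorem wedge_apply_3_3 (α : V [⋀^Fin 3]→ₗ[ℝ] ℝ) (β : V [⋀^Fin 3]→ₗ[ℝ] W)
    (a b c d e f : V) :
    wedge α β ![a, b, c, d, e, f] =
      wedge (k := 2) (l := 3) (α.curryLeft a) β ![b, c, d, e, f] -
        wedge (k := 3) (l := 2) α (β.curryLeft a) ![b, c, d, e, f] := by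
  rw [wedge_apply_cons (k := 2) (l := 2) α β a (![b, c, d, e, f] : Fin 5 → V)]
  rw [show (-1 : ℝ) ^ (2 + 1) = -1 by norm_num, neg_one_smul, ← sub_eq_add_neg]
  congr 1

theorem wedge_apply_4_1 (α : V [⋀^Fin 4]→ₗ[ℝ] ℝ) (β : V [⋀^Fin 1]→ₗ[ℝ] W)
    (a b c d e : V) :
    wedge α β ![a, b, c, d, e] =
      wedge (k := 3) (l := 1) (α.curryLeft a) β ![b, c, d, e] +
        α ![b, c, d, e] • β ![a] := by
  rw [wedge_apply_one_cons (k := 3) α β a (![b, c, d, e] : Fin 4 → V)]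
  rw [show (-1 : ℝ) ^ (3 + 1) = 1 by norm_num, one_smul]

set_option maxRecDepth 20000 in
theorem wedge_apply_4_2 (α : V [⋀^Fin 4]→ₗ[ℝ] ℝ) (β : V [⋀^Fin 2]→ₗ[ℝ] W)
    (a b c d e f : V) :
    wedge α β ![a, b, c, d, e, f] =
      wedge (k := 3) (l := 2) (α.curryLeft a) β ![b, c, d, e, f] +
        wedge (k := 4) (l := 1) α (β.curryLeft a) ![b, c, d, e, f] := by
  rw [wedge_apply_cons (k := 3) (l := 1) α β a (![b, c, d, e, f] : Fin 5 → V)]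
  rw [show (-1 : ℝ) ^ (3 + 1) = 1 by norm_num, one_smul]
  congr 1

set_option maxRecDepth 20000 in
theorem wedge_apply_4_3 (α : V [⋀^Fin 4]→ₗ[ℝ] ℝ) (β : V [⋀^Fin 3]→ₗ[ℝ] W)
    (a b c d e f g : V) :
    wedge α β ![a, b, c, d, e, f, g] =
      wedge (k := 3) (l := 3) (α.curryLeft a) β ![b, c, d, e, f, g] +
        wedge (k := 4) (l := 2) α (β.curryLeft a) ![b, c, d, e, f, g] := by
  rw [wedge_apply_cons (k := 3) (l := 2) α β a (![b, c, d, e, f, g] : Fin 6 → V)]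
  rw [show (-1 : ℝ) ^ (3 + 1) = 1 by norm_num, one_smul]
  congr 1

end WedgeLowDegree

/-! ## The Hodge star in a frame -/

section HodgeStar

variable {V W : Type*} [AddCommGroup V] [Module ℝ V] [AddCommGroup W] [Module ℝ W]

/-- The multilinear map `u ↦ (v ↦ η (u, v))` of an alternating map `η`. -/
def curryAppend {k m : ℕ} (η : V [⋀^Fin (k + m)]→ₗ[ℝ] ℝ) :
    MultilinearMap ℝ (fun _ : Fin k => V) (MultilinearMap ℝ (fun _ : Fin m => V) ℝ) :=
  (η.toMultilinearMap.domDomCongr finSumFinEquiv.symm).currySum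

theorem curryAppend_apply {k m : ℕ} (η : V [⋀^Fin (k + m)]→ₗ[ℝ] ℝ) (u : Fin k → V)
    (v : Fin m → V) : curryAppend η u v = η (Fin.append u v) := by
  simp only [curryAppend, MultilinearMap.currySum_apply', MultilinearMap.domDomCongr_apply]
  change η _ = _
  congr 1
  funext i
  refine Fin.addCases (fun i => ?_) (fun i => ?_) i <;> simp

/-- The alternating map `v ↦ η (u, v)`. -/
def interiorProd {k m : ℕ} (η : V [⋀^Fin (k + m)]→ₗ[ℝ] ℝ) (u : Fin k → V) :
    V [⋀^Fin m]→ₗ[ℝ] ℝ :=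
  { curryAppend η u with
    map_eq_zero_of_eq' := by
      intro v i j hv hij
      change curryAppend η u v = 0
      rw [curryAppend_apply]
      refine η.map_eq_zero_of_eq _ (i := Fin.natAdd k i) (j := Fin.natAdd k j) (by simpa using hv)
        fun h => hij (by simpa using h) }

theorem interiorProd_apply {k m : ℕ} (η : V [⋀^Fin (k + m)]→ₗ[ℝ] ℝ) (u : Fin k → V)
    (v : Fin m → V) : interiorProd η u v = η (Fin.append u v) :=
  curryAppend_apply η u v

/-- The Hodge star as an alternating map. -/
def hodgeStarForm {k m : ℕ} (b : Basis (Fin (k + m)) ℝ V) (α : V [⋀^Fin k]→ₗ[ℝ] W) :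
    V [⋀^Fin m]→ₗ[ℝ] W :=
  (k.factorial : ℝ)⁻¹ • ∑ i : Fin k → Fin (k + m),
    (LinearMap.toSpanSingleton ℝ W (α fun j => b (i j))).compAlternatingMap
      (interiorProd b.det fun j => b (i j))

theorem hodgeStarForm_apply {k m : ℕ} (b : Basis (Fin (k + m)) ℝ V) (α : V [⋀^Fin k]→ₗ[ℝ] W)
    (v : Fin m → V) : hodgeStarForm b α v = hodgeStar b α v := by
  have h : ∀ (s : Finset (Fin k → Fin (k + m))) (f : (Fin k → Fin (k + m)) → V [⋀^Fin m]→ₗ[ℝ] W),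
      (∑ i ∈ s, f i) v = ∑ i ∈ s, f i v := fun s f => by
    induction s using Finset.cons_induction with
    | empty => simp
    | cons a s ha ih => rw [Finset.sum_cons, Finset.sum_cons, AlternatingMap.add_apply, ih]
  simp [hodgeStarForm, hodgeStar, interiorProd_apply, h]

/-- Once the last `m` basis vectors are fixed, only multi-indices that enumerate the complementary
`k` vectors contribute. These are the `k!` reorderings of one of them; the signs from `b.det` and
`α` cancel, so all terms agree and the normalisation `1 / k!` leaves one. -/
theorem hodgeStar_apply_perm {k m : ℕ} (b : Basis (Fin (k + m)) ℝ V) (α : V [⋀^Fin k]→ₗ[ℝ] W)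
    (τ : Equiv.Perm (Fin (k + m))) :
    hodgeStar b α (fun j => b (τ (Fin.natAdd k j))) =
      ((Equiv.Perm.sign τ : ℤ) : ℝ) • α (fun i => b (τ (Fin.castAdd m i))) := by
  unfold hodgeStar
  have hinj : Function.Injective
      (fun (ρ : Equiv.Perm (Fin k)) (i : Fin k) => τ (Fin.castAdd m (ρ i))) := by
    intro ρ ρ' h
    ext i
    have := congrFun h i
    simpa [Fin.ext_iff] using this
  have key : ∑ i : Fin k → Fin (k + m),
      b.det (Fin.append (fun j => b (i j)) fun j => b (τ (Fin.natAdd k j))) • α (fun j => b (i j)) =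
      ∑ _ρ : Equiv.Perm (Fin k),
        ((Equiv.Perm.sign τ : ℤ) : ℝ) • α (fun i => b (τ (Fin.castAdd m i))) := by
    symm
    refine Fintype.sum_of_injective _ hinj _ _ ?_ ?_
    -- If the determinant does not vanish, the indices `i j` avoid the last `m` slots of `τ` and are
    -- distinct, so `i` is one of the reorderings after all.
    · intro i hi
      rw [AlternatingMap.map_eq_zero_of_not_injective, zero_smul]
      intro h
      apply hi
      have hmem : ∀ j : Fin k, ∃ j' : Fin k, τ (Fin.castAdd m j') = i j := by
        intro j
        obtain ⟨p, hp⟩ := τ.surjective (i j)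
        revert hp
        refine Fin.addCases (fun j' h' => ⟨j', h'⟩) (fun j' h' => ?_) p
        exfalso
        have : Fin.castAdd m j = Fin.natAdd k j' := by
          apply h
          simp [h']
        have := congrArg Fin.val this
        simp at this
        omega
      choose ρ hρ using hmem
      have hρi : Function.Injective ρ := by
        intro j j' hj
        have : Fin.castAdd m j = Fin.castAdd m j' := by
          apply h
          simp [← hρ, hj]
        simpa using this
      refine ⟨Equiv.ofBijective ρ (Finite.injective_iff_bijective.1 hρi), ?_⟩
      funext j
      exact hρ j
    · intro ρ
      have h1 : (Fin.append (fun j => b (τ (Fin.castAdd m (ρ j))))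
          fun j => b (τ (Fin.natAdd k j))) =
          b ∘ (τ * (finSumFinEquiv (m := k) (n := m)).permCongr (Equiv.Perm.sumCongr ρ 1) :
            Equiv.Perm (Fin (k + m))) := by
        funext p
        refine Fin.addCases (fun j => ?_) (fun j => ?_) p <;> simp
      have h2 : (fun j => b (τ (Fin.castAdd m (ρ j)))) =
          (fun i => b (τ (Fin.castAdd m i))) ∘ ρ := rfl
      rw [h1, h2, AlternatingMap.map_perm, AlternatingMap.map_perm, Basis.det_self,
        Equiv.Perm.sign_mul, Equiv.Perm.sign_permCongr, Equiv.Perm.sign_sumCongr]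
      rcases Int.units_eq_one_or (Equiv.Perm.sign ρ) with h | h <;>
        rcases Int.units_eq_one_or (Equiv.Perm.sign τ) with h' | h' <;> simp [h, h']
  rw [key, Finset.sum_const, Finset.card_univ, Fintype.card_perm, Fintype.card_fin,
    ← Nat.cast_smul_eq_nsmul ℝ, smul_smul, inv_mul_cancel₀ (by positivity), one_smul]

/-- The full contraction of two tensors over an orthonormal frame does not depend on the frame: the
tensor powers of an orthogonal matrix are orthogonal, which is `hM'`, proved slot by slot. -/
theorem sum_smul_eq_of_orthogonal {n k : ℕ} (b b' : Fin n → V) (M : Matrix (Fin n) (Fin n) ℝ)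
    (hM : M * M.transpose = 1) (hb : ∀ j, b' j = ∑ p, M p j • b p)
    (A : MultilinearMap ℝ (fun _ : Fin k => V) ℝ) (B : MultilinearMap ℝ (fun _ : Fin k => V) W) :
    ∑ i : Fin k → Fin n, A (fun j => b' (i j)) • B (fun j => b' (i j)) =
      ∑ i : Fin k → Fin n, A (fun j => b (i j)) • B (fun j => b (i j)) := by
  have hA : ∀ i : Fin k → Fin n, A (fun j => b' (i j)) =
      ∑ p : Fin k → Fin n, (∏ j, M (p j) (i j)) • A (fun j => b (p j)) := by
    intro i
    simp only [hb]
    rw [A.map_sum]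
    exact Finset.sum_congr rfl fun p _ => A.map_smul_univ _ _
  have hB : ∀ i : Fin k → Fin n, B (fun j => b' (i j)) =
      ∑ p : Fin k → Fin n, (∏ j, M (p j) (i j)) • B (fun j => b (p j)) := by
    intro i
    simp only [hb]
    rw [B.map_sum]
    exact Finset.sum_congr rfl fun p _ => B.map_smul_univ _ _
  have hM' : ∀ p q : Fin k → Fin n,
      ∑ i : Fin k → Fin n, (∏ j, M (p j) (i j)) * (∏ j, M (q j) (i j)) = if p = q then 1 else 0 := by
    intro p q
    simp only [← Finset.prod_mul_distrib]
    have := Finset.prod_univ_sum (fun _ : Fin k => (Finset.univ : Finset (Fin n)))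
      (fun j i => M (p j) i * M (q j) i)
    rw [Fintype.piFinset_univ] at this
    rw [← this]
    have h2 : ∀ j, ∑ i, M (p j) i * M (q j) i = if p j = q j then 1 else 0 := by
      intro j
      have := congrFun (congrFun hM (p j)) (q j)
      simpa [Matrix.mul_apply, Matrix.one_apply] using this
    simp only [h2]
    split_ifs with h
    · simp [h]
    · obtain ⟨j, hj⟩ := Function.ne_iff.1 h
      exact Finset.prod_eq_zero (Finset.mem_univ j) (by simp [hj])
  simp only [hA, hB, Finset.sum_smul_sum]
  rw [Finset.sum_comm]
  have : ∀ p : Fin k → Fin n, ∑ i : Fin k → Fin n, ∑ q : Fin k → Fin n,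
      ((∏ j, M (p j) (i j)) • A (fun j => b (p j))) • (∏ j, M (q j) (i j)) • B (fun j => b (q j)) =
      A (fun j => b (p j)) • B (fun j => b (p j)) := by
    intro p
    rw [Finset.sum_comm]
    have h : ∀ q : Fin k → Fin n, ∑ i : Fin k → Fin n,
      ((∏ j, M (p j) (i j)) • A (fun j => b (p j))) • (∏ j, M (q j) (i j)) • B (fun j => b (q j)) =
      (if p = q then (1 : ℝ) else 0) • A (fun j => b (p j)) • B (fun j => b (q j)) := by
      intro q
      rw [← hM', Finset.sum_smul]
      refine Finset.sum_congr rfl fun i _ => ?_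
      simp only [smul_smul, smul_eq_mul]
      congr 1
      ring
    rw [Finset.sum_congr rfl fun q _ => h q]
    simp
  exact Finset.sum_congr rfl fun p _ => this p

theorem hodgeStar_eq_of_orthogonal {k m : ℕ} (b b' : Basis (Fin (k + m)) ℝ V)
    (M : Matrix (Fin (k + m)) (Fin (k + m)) ℝ)
    (hM : M * M.transpose = 1) (hb : ∀ j, b' j = ∑ p, M p j • b p)
    (hdet : (b'.det : V [⋀^Fin (k + m)]→ₗ[ℝ] ℝ) = b.det) (α : V [⋀^Fin k]→ₗ[ℝ] W)
    (v : Fin m → V) : hodgeStar b' α v = hodgeStar b α v := by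
  unfold hodgeStar
  rw [hdet]
  congr 1
  -- Freezing the last `m` arguments at `v` turns the volume form into a `k`-linear map, so the star
  -- becomes a contraction with `α`.
  let ev : MultilinearMap ℝ (fun _ : Fin m => V) ℝ →ₗ[ℝ] ℝ :=
    { toFun := fun f => f v, map_add' := fun _ _ => rfl, map_smul' := fun _ _ => rfl }
  have := sum_smul_eq_of_orthogonal b b' M hM hb
    (ev.compMultilinearMap (curryAppend b.det)) α.toMultilinearMap
  simpa [ev, curryAppend_apply] using this

end HodgeStar

/-! ## Frames of a `G₂`-structure -/

section G2Frames

variable {V W : Type*} [AddCommGroup V] [Module ℝ V] [AddCommGroup W] [Module ℝ W]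

/-- The defining identity fixes only the product of metric and volume form, so a common rescaling
must be excluded. If `d` is the determinant of the change of frame `M`, comparing the two identities
gives `d • (Mᵀ * M) = 1`; taking determinants in dimension 7 yields `d ^ 9 = 1`, hence `d = 1`. -/
theorem IsG2Frame.exists_orthogonal {φ : V [⋀^Fin 3]→ₗ[ℝ] ℝ} {b b' : Basis (Fin 7) ℝ V}
    (hb : IsG2Frame φ b) (hb' : IsG2Frame φ b') :
    ∃ M : Matrix (Fin 7) (Fin 7) ℝ, M * M.transpose = 1 ∧ (∀ j, b' j = ∑ p, M p j • b p) ∧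
      (b'.det : V [⋀^Fin 7]→ₗ[ℝ] ℝ) = b.det := by
  set d : ℝ := b.det b' with hd
  have hdet : (b.det : V [⋀^Fin 7]→ₗ[ℝ] ℝ) = d • b'.det := b.det.eq_smul_basis_det b'
  have hQ : ∀ v, ∑ i, (b'.repr v i) ^ 2 = d * ∑ i, (b.repr v i) ^ 2 := by
    intro v
    -- Both 7-forms are compared on `b'`, where `b'.det` is 1 and `b.det` is `d`.
    have h := congrArg (fun f => f b') ((hb v).symm.trans (hb' v))
    simp only [AlternatingMap.smul_apply, smul_eq_mul, Basis.det_self, ← hd] at h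
    linarith
  have hB : ∀ v w, ∑ i, b'.repr v i * b'.repr w i = d * ∑ i, b.repr v i * b.repr w i := by
    intro v w
    have h1 := hQ (v + w)
    have h2 := hQ v
    have h3 := hQ w
    simp only [map_add, Finsupp.add_apply, add_sq, Finset.sum_add_distrib, mul_add] at h1
    simp only [mul_assoc, ← Finset.mul_sum] at h1
    linarith
  set M := b.toMatrix b' with hM
  have hMM : d • (M.transpose * M) = 1 := by
    ext i j
    have := hB (b' i) (b' j)
    simp only [Basis.repr_self, Finsupp.single_apply] at this
    simp [Matrix.mul_apply, Matrix.one_apply, hM, Basis.toMatrix_apply, ← this]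
  have hdM : M.det = d := by rw [hd, Basis.det_apply]
  have hd9 : d ^ 9 = 1 := by
    have := congrArg Matrix.det hMM
    rw [Matrix.det_smul, Matrix.det_mul, Matrix.det_transpose, hdM, Matrix.det_one,
      Fintype.card_fin] at this
    linarith
  have hd1 : d = 1 := by
    have hodd : Odd 9 := by decide
    exact hodd.pow_injective (by simpa using hd9)
  rw [hd1, one_smul] at hMM hdet
  refine ⟨M, mul_eq_one_comm.1 hMM, fun j => ?_, hdet.symm⟩
  exact (b.sum_toMatrix_smul_self b' j).symm

theorem satisfiesG2Equation_iff {φ : V [⋀^Fin 3]→ₗ[ℝ] ℝ} {b : Basis (Fin 7) ℝ V}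
    (hb : IsG2Frame φ b) (ξ : V [⋀^Fin 2]→ₗ[ℝ] W) :
    SatisfiesG2Equation φ ξ ↔
      ∀ v : Fin 2 → V, ξ v + hodgeStar (k := 5) (m := 2) b (wedge φ ξ) v = 0 := by
  refine ⟨fun ⟨b', hb', h⟩ v => ?_, fun h => ⟨b, hb, h⟩⟩
  obtain ⟨M, hM, hM', hdet⟩ := hb.exists_orthogonal hb'
  rw [← h v]
  congr 1
  exact (hodgeStar_eq_of_orthogonal (k := 5) (m := 2) b b' M hM hM' hdet _ v).symm

theorem alternating_two_swap (f : V [⋀^Fin 2]→ₗ[ℝ] W) (v w : V) : f ![v, w] = -f ![w, v] := by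
  have := f.map_swap ![w, v] (i := 0) (j := 1) (by decide)
  rw [← this]
  congr 1
  ext i
  fin_cases i <;> rfl

/-- Two alternating 2-forms agree if they agree on the pairs `b i, b j`, `i < j`. -/
theorem alternating_two_ext {n : ℕ} (b : Basis (Fin n) ℝ V) {f g : V [⋀^Fin 2]→ₗ[ℝ] W}
    (h : ∀ i j, i < j → f ![b i, b j] = g ![b i, b j]) : f = g := by
  refine Basis.ext_alternating b fun v hv => ?_
  have e : (fun i => b (v i)) = ![b (v 0), b (v 1)] := by
    ext i
    fin_cases i <;> rfl
  rw [e]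
  have hne : v 0 ≠ v 1 := fun h => by simpa using hv h
  rcases lt_or_gt_of_ne hne with h' | h'
  · exact h _ _ h'
  · rw [alternating_two_swap f, alternating_two_swap g, h _ _ h']

/-- The matrices of the 2-forms `ω_iˣ + ω_iʸ` in the coordinates of `ℝ⁸`. -/
def hyperCoeff : Fin 3 → Fin 8 → Fin 8 → ℤ :=
  ![![![0, 1, 0, 0, 0, 0, 0, 0], ![-1, 0, 0, 0, 0, 0, 0, 0],
      ![0, 0, 0, 1, 0, 0, 0, 0], ![0, 0, -1, 0, 0, 0, 0, 0],
      ![0, 0, 0, 0, 0, 1, 0, 0], ![0, 0, 0, 0, -1, 0, 0, 0],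
      ![0, 0, 0, 0, 0, 0, 0, 1], ![0, 0, 0, 0, 0, 0, -1, 0]],
    ![![0, 0, 1, 0, 0, 0, 0, 0], ![0, 0, 0, -1, 0, 0, 0, 0],
      ![-1, 0, 0, 0, 0, 0, 0, 0], ![0, 1, 0, 0, 0, 0, 0, 0],
      ![0, 0, 0, 0, 0, 0, 1, 0], ![0, 0, 0, 0, 0, 0, 0, -1],
      ![0, 0, 0, 0, -1, 0, 0, 0], ![0, 0, 0, 0, 0, 1, 0, 0]],
    ![![0, 0, 0, 1, 0, 0, 0, 0], ![0, 0, 1, 0, 0, 0, 0, 0],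
      ![0, -1, 0, 0, 0, 0, 0, 0], ![-1, 0, 0, 0, 0, 0, 0, 0],
      ![0, 0, 0, 0, 0, 0, 0, 1], ![0, 0, 0, 0, 0, 0, 1, 0],
      ![0, 0, 0, 0, 0, -1, 0, 0], ![0, 0, 0, 0, -1, 0, 0, 0]]]

/-- The coefficients of `r ⌟ ½ (σ ∧ σ)` at `r = (1, 0)` for the 2-form `σ = ω_aˣ + ω_aʸ`. -/
def cubicCoeff (a : Fin 3) (i j k : Fin 7) : ℤ :=
  hyperCoeff a 0 i.succ * hyperCoeff a j.succ k.succ -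
    hyperCoeff a 0 j.succ * hyperCoeff a i.succ k.succ +
    hyperCoeff a 0 k.succ * hyperCoeff a i.succ j.succ

/-- The coefficients of the 3-form
`e¹²³ + e¹ (e⁴⁵ + e⁶⁷) + e² (e⁴⁶ - e⁵⁷) - e³ (e⁴⁷ + e⁵⁶)` on `ℝ⁷`. -/
def g2Coeff (i j k : Fin 7) : ℤ :=
  cubicCoeff 0 i j k + cubicCoeff 1 i j k - cubicCoeff 2 i j k

-- The model 3-form on `ℝ⁷` defines the Euclidean metric and the standard orientation. In
-- coordinates of `v` the identity is an equality of two quadratic polynomials, checked by full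
-- expansion.
set_option maxRecDepth 20000 in
theorem isG2Frame_of_coeff {φ : V [⋀^Fin 3]→ₗ[ℝ] ℝ} {b : Basis (Fin 7) ℝ V}
    (h : ∀ i j k, φ ![b i, b j, b k] = g2Coeff i j k) : IsG2Frame φ b := by
  intro v
  have hv : ∀ i j, φ ![v, b i, b j] = ∑ m, b.repr v m * g2Coeff m i j := by
    intro i j
    have h1 : ∀ w, φ ![w, b i, b j] = φ.toMultilinearMap.toLinearMap ![0, b i, b j] 0 w := by
      intro w
      simp only [MultilinearMap.toLinearMap_apply]
      change _ = φ _
      congr 1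
      ext k
      fin_cases k <;> rfl
    conv_lhs => rw [← b.sum_repr v]
    rw [h1, map_sum]
    refine Finset.sum_congr rfl fun m _ => ?_
    rw [map_smul, ← h1, h, smul_eq_mul]
  set a := φ.curryLeft v with ha
  -- A top-degree form is determined by its value on the basis, so a single number remains to be
  -- computed.
  have hdet : ∀ (η : V [⋀^Fin 7]→ₗ[ℝ] ℝ) (c : ℝ), η b = c → η = c • b.det :=
    fun η c h => h ▸ AlternatingMap.eq_smul_basis_det b η
  apply hdet
  have hb : (b : Fin 7 → V) = ![b 0, b 1, b 2, b 3, b 4, b 5, b 6] := by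
    ext i
    fin_cases i <;> rfl
  have hva : ∀ i j, a ![b i, b j] = ∑ m, b.repr v m * g2Coeff m i j := hv
  rw [hb]
  set x := fun i => b.repr v i with hx
  have hx' : ∀ i, b.repr v i = x i := fun _ => rfl
  simp only [hx'] at hva ⊢
  rw [wedge_apply_4_3]
  simp only [wedge_apply_4_2, wedge_apply_4_1, wedge_apply_3_3, wedge_apply_3_2, wedge_apply_3_1,
    wedge_apply_2_3, wedge_apply_2_2, wedge_apply_2_1, wedge_apply_1_3, wedge_apply_1_2,
    wedge_apply_1_1, AlternatingMap.curryLeft_apply_apply, smul_eq_mul, h, hva]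
  simp only [Fin.sum_univ_seven]
  simp [g2Coeff, cubicCoeff, hyperCoeff]
  ring

theorem hodgeStar_five_apply (b : Basis (Fin 7) ℝ V) (α : V [⋀^Fin 5]→ₗ[ℝ] W) {i j : Fin 7}
    (hij : i < j) :
    hodgeStar (k := 5) (m := 2) b α ![b i, b j] =
      (((Equiv.Perm.sign (Equiv.swap j 6 * Equiv.swap i 5) : ℤˣ) : ℤ) : ℝ) •
        α ![b (Equiv.swap j 6 (Equiv.swap i 5 0)), b (Equiv.swap j 6 (Equiv.swap i 5 1)),
          b (Equiv.swap j 6 (Equiv.swap i 5 2)), b (Equiv.swap j 6 (Equiv.swap i 5 3)),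
          b (Equiv.swap j 6 (Equiv.swap i 5 4))] := by
  -- This permutation puts `i` and `j` into the last two slots. The order matters: `i < j`
  -- guarantees `i ≠ 6`, so the outer swap does not move `i` again.
  have h := hodgeStar_apply_perm (k := 5) (m := 2) b α (Equiv.swap j 6 * Equiv.swap i 5)
  have h5 : Equiv.swap j 6 (Equiv.swap i 5 5) = i := by clear h; revert i j; decide
  have h6 : Equiv.swap j 6 (Equiv.swap i 5 6) = j := by clear h h5; revert i j; decide
  have e1 : (fun p => b ((Equiv.swap j 6 * Equiv.swap i 5 : Equiv.Perm (Fin (5 + 2)))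
      (Fin.natAdd 5 p))) = ![b i, b j] := by
    ext p
    fin_cases p
    · exact congrArg b h5
    · exact congrArg b h6
  rw [e1] at h
  rw [h]
  congr 2
  ext p
  fin_cases p <;> rfl

/-- With `b 0, b 1, b 2` in the kernel of `ξ`, the mixed components of the equation are trivial. The
components on two horizontal vectors state that the four-dimensional star of `ξ` is `-ξ`; those on
two vertical vectors state that `ξ` wedges to zero with the self-dual forms. Both sets amount to the
same three equations, so the first set suffices for the forward direction. -/
theorem g2_hodge_equation_iff {φ : V [⋀^Fin 3]→ₗ[ℝ] ℝ} {b : Basis (Fin 7) ℝ V}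
    (h : ∀ i j k, φ ![b i, b j, b k] = g2Coeff i j k) (ξ : V [⋀^Fin 2]→ₗ[ℝ] W)
    (h0 : ∀ v, ξ ![b 0, v] = 0) (h1 : ∀ v, ξ ![b 1, v] = 0) (h2 : ∀ v, ξ ![b 2, v] = 0) :
    (∀ v : Fin 2 → V, ξ v + hodgeStar (k := 5) (m := 2) b (wedge φ ξ) v = 0) ↔
      ξ ![b 3, b 4] + ξ ![b 5, b 6] = 0 ∧ ξ ![b 3, b 5] - ξ ![b 4, b 6] = 0 ∧
        ξ ![b 3, b 6] + ξ ![b 4, b 5] = 0 := by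
  have h1' : ∀ v, ξ ![v, b 1] = 0 := fun v => by rw [alternating_two_swap, h1, neg_zero]
  have h2' : ∀ v, ξ ![v, b 2] = 0 := fun v => by rw [alternating_two_swap, h2, neg_zero]
  have s35 := alternating_two_swap ξ (b 5) (b 3)
  have s36 := alternating_two_swap ξ (b 6) (b 3)
  have s45 := alternating_two_swap ξ (b 5) (b 4)
  have s46 := alternating_two_swap ξ (b 6) (b 4)
  constructor
  · intro H
    have H34 := H ![b 3, b 4]
    have H35 := H ![b 3, b 5]
    have H36 := H ![b 3, b 6]
    rw [hodgeStar_five_apply b _ (by decide)] at H34 H35 H36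
    simp [Equiv.swap_apply_def, wedge_apply_3_2, wedge_apply_3_1, wedge_apply_2_2, wedge_apply_2_1,
      wedge_apply_1_2, wedge_apply_1_1, AlternatingMap.curryLeft_apply_apply, h, h0, h1, h2,
      g2Coeff, cubicCoeff, hyperCoeff, s45, s46] at H34 H35 H36
    exact ⟨H34, by rw [sub_eq_add_neg, H35], H36⟩
  · rintro ⟨H1, H2, H3⟩ v
    have H1' : ξ ![b 5, b 6] = -ξ ![b 3, b 4] := (neg_eq_of_add_eq_zero_right H1).symm
    have H2' : ξ ![b 4, b 6] = ξ ![b 3, b 5] := (sub_eq_zero.1 H2).symm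
    have H3' : ξ ![b 4, b 5] = -ξ ![b 3, b 6] := (neg_eq_of_add_eq_zero_right H3).symm
    have key : ξ + hodgeStarForm (k := 5) (m := 2) b (wedge φ ξ) = 0 := by
      refine alternating_two_ext b fun i j hij => ?_
      rw [AlternatingMap.add_apply, hodgeStarForm_apply, hodgeStar_five_apply b _ hij]
      fin_cases i <;> fin_cases j <;> first | exact absurd hij (by decide) | clear hij <;>
        simp [Equiv.swap_apply_def, wedge_apply_3_2, wedge_apply_3_1, wedge_apply_2_2,
          wedge_apply_2_1, wedge_apply_1_2, wedge_apply_1_1, AlternatingMap.curryLeft_apply_apply,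
          h, h0, h1, h2, h1', h2', g2Coeff, cubicCoeff, hyperCoeff, s35, s36, s45, s46, H1',
          H2', H3']
    have := congrArg (fun f => f v) key
    simpa [hodgeStarForm_apply] using this

/-! ## Anti-self-duality in a frame -/

theorem hodgeStar_two_apply (b : Basis (Fin 4) ℝ V) (β : V [⋀^Fin 2]→ₗ[ℝ] W) {i j : Fin 4}
    (hij : i < j) :
    hodgeStar (k := 2) (m := 2) b β ![b i, b j] =
      (((Equiv.Perm.sign (Equiv.swap j 3 * Equiv.swap i 2) : ℤˣ) : ℤ) : ℝ) •
        β ![b (Equiv.swap j 3 (Equiv.swap i 2 0)), b (Equiv.swap j 3 (Equiv.swap i 2 1))] := by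
  have h5 : Equiv.swap j 3 (Equiv.swap i 2 2) = i := by revert i j; decide
  have h6 : Equiv.swap j 3 (Equiv.swap i 2 3) = j := by clear h5; revert i j; decide
  have h := hodgeStar_apply_perm (k := 2) (m := 2) b β (Equiv.swap j 3 * Equiv.swap i 2)
  have e1 : (fun p => b ((Equiv.swap j 3 * Equiv.swap i 2 : Equiv.Perm (Fin (2 + 2)))
      (Fin.natAdd 2 p))) = ![b i, b j] := by
    ext p
    fin_cases p
    · exact congrArg b h5
    · exact congrArg b h6
  rw [e1] at h
  rw [h]
  congr 2
  ext p
  fin_cases p <;> rfl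

theorem antiSelfDual_iff (b : Basis (Fin 4) ℝ V) (β : V [⋀^Fin 2]→ₗ[ℝ] W) :
    (∀ v : Fin 2 → V, hodgeStar (k := 2) (m := 2) b β v = -β v) ↔
      β ![b 0, b 1] + β ![b 2, b 3] = 0 ∧ β ![b 0, b 2] - β ![b 1, b 3] = 0 ∧
        β ![b 0, b 3] + β ![b 1, b 2] = 0 := by
  have s12 := alternating_two_swap β (b 2) (b 1)
  have s13 := alternating_two_swap β (b 3) (b 1)
  constructor
  · intro H
    have H01 := H ![b 0, b 1]
    have H02 := H ![b 0, b 2]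
    have H03 := H ![b 0, b 3]
    rw [hodgeStar_two_apply b _ (by decide)] at H01 H02 H03
    simp [Equiv.swap_apply_def, s12, s13] at H01 H02 H03
    exact ⟨by simp [H01], by simp [H02], by simp [H03]⟩
  · rintro ⟨H1, H2, H3⟩ v
    have H1' : β ![b 2, b 3] = -β ![b 0, b 1] := (neg_eq_of_add_eq_zero_right H1).symm
    have H2' : β ![b 1, b 3] = β ![b 0, b 2] := (sub_eq_zero.1 H2).symm
    have H3' : β ![b 1, b 2] = -β ![b 0, b 3] := (neg_eq_of_add_eq_zero_right H3).symm
    have key : hodgeStarForm (k := 2) (m := 2) b β = -β := by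
      refine alternating_two_ext b fun i j hij => ?_
      rw [AlternatingMap.neg_apply, hodgeStarForm_apply, hodgeStar_two_apply b _ hij]
      fin_cases i <;> fin_cases j <;> first | exact absurd hij (by decide) | clear hij <;>
        simp [Equiv.swap_apply_def, s12, s13, H1', H2', H3']
    have := congrArg (fun f => f v) key
    simpa [hodgeStarForm_apply] using this

end G2Frames

/-! ## The hyperkähler forms on `ℝ⁸` -/

/-- The 2-forms `ω_iˣ + ω_iʸ` on `ℝ⁸`. -/
def sigmaForm (a : Fin 3) : R8 [⋀^Fin 2]→ₗ[ℝ] ℝ := omegaForm xIdx a + omegaForm yIdx a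

theorem dCoord_apply (i : Fin 8) (v : R8) : dCoord i ![v] = v i := rfl

theorem sigmaForm_zero_apply (u v : R8) : sigmaForm 0 ![u, v] =
    u 0 * v 1 - u 1 * v 0 + (u 2 * v 3 - u 3 * v 2) +
      (u 4 * v 5 - u 5 * v 4 + (u 6 * v 7 - u 7 * v 6)) := by
  simp [sigmaForm, omegaForm, wedge_apply_1_1, dCoord_apply, xIdx, yIdx]
  ring

theorem sigmaForm_one_apply (u v : R8) : sigmaForm 1 ![u, v] =
    u 0 * v 2 - u 2 * v 0 - (u 1 * v 3 - u 3 * v 1) +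
      (u 4 * v 6 - u 6 * v 4 - (u 5 * v 7 - u 7 * v 5)) := by
  simp [sigmaForm, omegaForm, wedge_apply_1_1, dCoord_apply, xIdx, yIdx]
  ring

theorem sigmaForm_two_apply (u v : R8) : sigmaForm 2 ![u, v] =
    u 0 * v 3 - u 3 * v 0 + (u 1 * v 2 - u 2 * v 1) +
      (u 4 * v 7 - u 7 * v 4 + (u 5 * v 6 - u 6 * v 5)) := by
  simp [sigmaForm, omegaForm, wedge_apply_1_1, dCoord_apply, xIdx, yIdx]
  ring

/-- This is `Ψ₀ = ½(σ₁² + σ₂² - σ₃²)`. Each `½σ_a²` contains `dx⁰¹²³ + dy⁰¹²³` once, and the signs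
add up to `1 + 1 - 1 = 1`. Consequently every linear map that preserves the `σ_a` preserves `Ψ₀`. -/
theorem Psi0_apply (r u v w : R8) : Psi0 ![r, u, v, w] =
    ∑ a, (![1, 1, -1] : Fin 3 → ℝ) a * (sigmaForm a ![r, u] * sigmaForm a ![v, w] -
      sigmaForm a ![r, v] * sigmaForm a ![u, w] + sigmaForm a ![r, w] * sigmaForm a ![u, v]) := by
  simp [Psi0, volForm, Fin.sum_univ_three, sigmaForm_zero_apply, sigmaForm_one_apply,
    sigmaForm_two_apply, omegaForm, wedge_apply_1_1, wedge_apply_2_1, wedge_apply_3_1,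
    wedge_apply_2_2, wedge_apply_1_2, dCoord_apply, xIdx, yIdx,
    AlternatingMap.curryLeft_apply_apply]
  ring

/-- The standard basis vectors of `ℝ⁸`. -/
def stdVec (i : Fin 8) : R8 := EuclideanSpace.single i 1

theorem sigmaForm_stdVec (a : Fin 3) (i j : Fin 8) :
    sigmaForm a ![stdVec i, stdVec j] = hyperCoeff a i j := by
  -- The coordinates are written as integer casts so that all 64 entries can be decided over `ℤ`.
  have h : ∀ p q : Fin 8, stdVec p q = ((if q = p then 1 else 0 : ℤ) : ℝ) := by
    intro p q
    simp [stdVec]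
  fin_cases a
  · change sigmaForm 0 _ = _
    rw [sigmaForm_zero_apply]
    simp only [h]
    norm_cast
    revert i j
    decide
  · change sigmaForm 1 _ = _
    rw [sigmaForm_one_apply]
    simp only [h]
    norm_cast
    revert i j
    decide
  · change sigmaForm 2 _ = _
    rw [sigmaForm_two_apply]
    simp only [h]
    norm_cast
    revert i j
    decide

/-! ## Symmetries of the Hopf fibration -/

/-- The linear map `L` of `ℝ⁸` preserves the inner product and the 2-forms `ω_iˣ + ω_iʸ`, and
covers the rotation `N` of `ℝ⁵` under the Hopf map. -/
structure HopfSymmetry (L : R8 →ₗ[ℝ] R8) (N : Matrix (Fin 5) (Fin 5) ℝ) : Prop where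
  sigma : ∀ a u v, sigmaForm a ![L u, L v] = sigmaForm a ![u, v]
  inner_map : ∀ u v, inner ℝ (L u) (L v) = inner ℝ u v
  hopf_map : ∀ u i, hopfAmbient (L u) i = ∑ j, N i j * hopfAmbient u j
  orthogonal : N.transpose * N = 1
  det : N.det = 1

theorem HopfSymmetry.comp {L L' : R8 →ₗ[ℝ] R8} {N N' : Matrix (Fin 5) (Fin 5) ℝ}
    (h : HopfSymmetry L N) (h' : HopfSymmetry L' N') : HopfSymmetry (L ∘ₗ L') (N * N') where
  sigma a u v := by simp only [LinearMap.comp_apply, h.sigma, h'.sigma]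
  inner_map u v := by simp only [LinearMap.comp_apply, h.inner_map, h'.inner_map]
  hopf_map u i := by
    simp only [LinearMap.comp_apply, h.hopf_map, h'.hopf_map, Matrix.mul_apply, Finset.mul_sum,
      Finset.sum_mul]
    rw [Finset.sum_comm]
    simp only [mul_assoc]
  orthogonal := by
    rw [Matrix.transpose_mul, Matrix.mul_assoc, ← Matrix.mul_assoc N.transpose, h.orthogonal,
      Matrix.one_mul, h'.orthogonal]
  det := by rw [Matrix.det_mul, h.det, h'.det, one_mul]

/-- Left multiplication of the first quaternionic coordinate by `a`. -/
def leftMulX (a : Fin 4 → ℝ) : R8 →ₗ[ℝ] R8 where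
  toFun u := !₂[a 0 * u 0 - a 1 * u 1 - a 2 * u 2 - a 3 * u 3,
    a 0 * u 1 + a 1 * u 0 - a 2 * u 3 + a 3 * u 2,
    a 0 * u 2 + a 2 * u 0 - a 3 * u 1 + a 1 * u 3,
    a 0 * u 3 + a 3 * u 0 - a 1 * u 2 + a 2 * u 1, u 4, u 5, u 6, u 7]
  map_add' u v := by ext i; fin_cases i <;> simp <;> ring
  map_smul' c u := by ext i; fin_cases i <;> simp <;> ring

/-- Left multiplication of the second quaternionic coordinate by `b`. -/
def leftMulY (b : Fin 4 → ℝ) : R8 →ₗ[ℝ] R8 where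
  toFun u := !₂[u 0, u 1, u 2, u 3, b 0 * u 4 - b 1 * u 5 - b 2 * u 6 - b 3 * u 7,
    b 0 * u 5 + b 1 * u 4 - b 2 * u 7 + b 3 * u 6,
    b 0 * u 6 + b 2 * u 4 - b 3 * u 5 + b 1 * u 7,
    b 0 * u 7 + b 3 * u 4 - b 1 * u 6 + b 2 * u 5]
  map_add' u v := by ext i; fin_cases i <;> simp <;> ring
  map_smul' c u := by ext i; fin_cases i <;> simp <;> ring

/-- The rotation of `ℍ ⊕ ℍ` by the real matrix `[[s, -t], [t, s]]`. -/
def rotXY (s t : ℝ) : R8 →ₗ[ℝ] R8 where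
  toFun u := !₂[s * u 0 - t * u 4, s * u 1 - t * u 5, s * u 2 - t * u 6, s * u 3 - t * u 7,
    t * u 0 + s * u 4, t * u 1 + s * u 5, t * u 2 + s * u 6, t * u 3 + s * u 7]
  map_add' u v := by ext i; fin_cases i <;> simp <;> ring
  map_smul' c u := by ext i; fin_cases i <;> simp <;> ring

theorem leftMulX_apply (a : Fin 4 → ℝ) (u : R8) :
    leftMulX a u = !₂[a 0 * u 0 - a 1 * u 1 - a 2 * u 2 - a 3 * u 3,
      a 0 * u 1 + a 1 * u 0 - a 2 * u 3 + a 3 * u 2,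
      a 0 * u 2 + a 2 * u 0 - a 3 * u 1 + a 1 * u 3,
      a 0 * u 3 + a 3 * u 0 - a 1 * u 2 + a 2 * u 1, u 4, u 5, u 6, u 7] := rfl

theorem leftMulY_apply (b : Fin 4 → ℝ) (u : R8) :
    leftMulY b u = !₂[u 0, u 1, u 2, u 3, b 0 * u 4 - b 1 * u 5 - b 2 * u 6 - b 3 * u 7,
      b 0 * u 5 + b 1 * u 4 - b 2 * u 7 + b 3 * u 6,
      b 0 * u 6 + b 2 * u 4 - b 3 * u 5 + b 1 * u 7,
      b 0 * u 7 + b 3 * u 4 - b 1 * u 6 + b 2 * u 5] := rfl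

theorem rotXY_apply (s t : ℝ) (u : R8) :
    rotXY s t u = !₂[s * u 0 - t * u 4, s * u 1 - t * u 5, s * u 2 - t * u 6, s * u 3 - t * u 7,
      t * u 0 + s * u 4, t * u 1 + s * u 5, t * u 2 + s * u 6, t * u 3 + s * u 7] := rfl

theorem inner_R8 (u v : R8) : inner ℝ u v = u 0 * v 0 + u 1 * v 1 + u 2 * v 2 + u 3 * v 3 +
    u 4 * v 4 + u 5 * v 5 + u 6 * v 6 + u 7 * v 7 := by
  simp [PiLp.inner_apply, Fin.sum_univ_eight, mul_comm]

/-- Left multiplication commutes with the right multiplications that define the `σ_a`. Since `y` is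
paired with `x̄`, it acts on `z = 2yx̄` as right multiplication by `ā`. Every defect is a multiple
of `|a|² - 1`; the determinant is `|a|⁴`. -/
theorem hopfSymmetry_leftMulX {a : Fin 4 → ℝ} (ha : a 0 ^ 2 + a 1 ^ 2 + a 2 ^ 2 + a 3 ^ 2 = 1) :
    HopfSymmetry (leftMulX a) !![1, 0, 0, 0, 0; 0, a 0, a 1, a 2, a 3; 0, -a 1, a 0, a 3, -a 2;
      0, -a 2, -a 3, a 0, a 1; 0, -a 3, a 2, -a 1, a 0] where
  sigma i u v := by
    fin_cases i
    · change sigmaForm 0 _ = sigmaForm 0 _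
      simp [sigmaForm_zero_apply, leftMulX_apply]
      linear_combination (u 0 * v 1 - u 1 * v 0 + u 2 * v 3 - u 3 * v 2) * ha
    · change sigmaForm 1 _ = sigmaForm 1 _
      simp [sigmaForm_one_apply, leftMulX_apply]
      linear_combination (u 0 * v 2 - u 2 * v 0 - u 1 * v 3 + u 3 * v 1) * ha
    · change sigmaForm 2 _ = sigmaForm 2 _
      simp [sigmaForm_two_apply, leftMulX_apply]
      linear_combination (u 0 * v 3 - u 3 * v 0 + u 1 * v 2 - u 2 * v 1) * ha
  inner_map u v := by
    simp [inner_R8, leftMulX_apply]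
    linear_combination (u 0 * v 0 + u 1 * v 1 + u 2 * v 2 + u 3 * v 3) * ha
  hopf_map u i := by
    rw [hopfAmbient_eq, hopfAmbient_eq, leftMulX_apply]
    fin_cases i <;> simp [Fin.sum_univ_five]
    · linear_combination (u 0 ^ 2 + u 1 ^ 2 + u 2 ^ 2 + u 3 ^ 2) * ha
    all_goals ring
  orthogonal := by
    ext i j
    fin_cases i <;> fin_cases j <;> simp [Matrix.mul_apply, Fin.sum_univ_five] <;>
      first | ring1 | linear_combination ha
  det := by
    simp [Matrix.det_succ_row_zero, Fin.sum_univ_succ, Fin.succAbove]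
    linear_combination (a 0 ^ 2 + a 1 ^ 2 + a 2 ^ 2 + a 3 ^ 2 + 1) * ha

/-- Here `z = 2yx̄` is multiplied by `b` on the left. -/
theorem hopfSymmetry_leftMulY {b : Fin 4 → ℝ} (hb : b 0 ^ 2 + b 1 ^ 2 + b 2 ^ 2 + b 3 ^ 2 = 1) :
    HopfSymmetry (leftMulY b) !![1, 0, 0, 0, 0; 0, b 0, -b 1, -b 2, -b 3; 0, b 1, b 0, b 3, -b 2;
      0, b 2, -b 3, b 0, b 1; 0, b 3, b 2, -b 1, b 0] where
  sigma i u v := by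
    fin_cases i
    · change sigmaForm 0 _ = sigmaForm 0 _
      simp [sigmaForm_zero_apply, leftMulY_apply]
      linear_combination (u 4 * v 5 - u 5 * v 4 + u 6 * v 7 - u 7 * v 6) * hb
    · change sigmaForm 1 _ = sigmaForm 1 _
      simp [sigmaForm_one_apply, leftMulY_apply]
      linear_combination (u 4 * v 6 - u 6 * v 4 - u 5 * v 7 + u 7 * v 5) * hb
    · change sigmaForm 2 _ = sigmaForm 2 _
      simp [sigmaForm_two_apply, leftMulY_apply]
      linear_combination (u 4 * v 7 - u 7 * v 4 + u 5 * v 6 - u 6 * v 5) * hb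
  inner_map u v := by
    simp [inner_R8, leftMulY_apply]
    linear_combination (u 4 * v 4 + u 5 * v 5 + u 6 * v 6 + u 7 * v 7) * hb
  hopf_map u i := by
    rw [hopfAmbient_eq, hopfAmbient_eq, leftMulY_apply]
    fin_cases i <;> simp [Fin.sum_univ_five]
    · linear_combination (u 4 ^ 2 + u 5 ^ 2 + u 6 ^ 2 + u 7 ^ 2) * hb
    all_goals ring
  orthogonal := by
    ext i j
    fin_cases i <;> fin_cases j <;> simp [Matrix.mul_apply, Fin.sum_univ_five] <;>
      first | ring1 | linear_combination hb
  det := by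
    simp [Matrix.det_succ_row_zero, Fin.sum_univ_succ, Fin.succAbove]
    linear_combination (b 0 ^ 2 + b 1 ^ 2 + b 2 ^ 2 + b 3 ^ 2 + 1) * hb

/-- A real matrix commutes with right quaternionic multiplication. On `ℝ⁵` it rotates the plane of
`a` and `z⁰` through twice the angle and fixes the imaginary part of `z`. -/
theorem hopfSymmetry_rotXY {s t : ℝ} (h : s ^ 2 + t ^ 2 = 1) :
    HopfSymmetry (rotXY s t) !![s ^ 2 - t ^ 2, -2 * s * t, 0, 0, 0;
      2 * s * t, s ^ 2 - t ^ 2, 0, 0, 0; 0, 0, 1, 0, 0; 0, 0, 0, 1, 0; 0, 0, 0, 0, 1] where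
  sigma i u v := by
    fin_cases i
    · change sigmaForm 0 _ = sigmaForm 0 _
      simp only [sigmaForm_zero_apply, rotXY_apply]
      simp
      linear_combination (u 0 * v 1 - u 1 * v 0 + u 2 * v 3 - u 3 * v 2 +
        u 4 * v 5 - u 5 * v 4 + u 6 * v 7 - u 7 * v 6) * h
    · change sigmaForm 1 _ = sigmaForm 1 _
      simp only [sigmaForm_one_apply, rotXY_apply]
      simp
      linear_combination (u 0 * v 2 - u 2 * v 0 - u 1 * v 3 + u 3 * v 1 +
        u 4 * v 6 - u 6 * v 4 - u 5 * v 7 + u 7 * v 5) * h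
    · change sigmaForm 2 _ = sigmaForm 2 _
      simp only [sigmaForm_two_apply, rotXY_apply]
      simp
      linear_combination (u 0 * v 3 - u 3 * v 0 + u 1 * v 2 - u 2 * v 1 +
        u 4 * v 7 - u 7 * v 4 + u 5 * v 6 - u 6 * v 5) * h
  inner_map u v := by
    simp [inner_R8, rotXY_apply]
    linear_combination (u 0 * v 0 + u 1 * v 1 + u 2 * v 2 + u 3 * v 3 +
      u 4 * v 4 + u 5 * v 5 + u 6 * v 6 + u 7 * v 7) * h
  hopf_map u i := by
    rw [hopfAmbient_eq, hopfAmbient_eq, rotXY_apply]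
    fin_cases i <;> simp [Fin.sum_univ_five]
    · ring
    · ring
    · linear_combination (-u 4 * u 1 + u 5 * u 0 + u 6 * u 3 - u 7 * u 2) * h
    · linear_combination (-u 4 * u 2 - u 5 * u 3 + u 6 * u 0 + u 7 * u 1) * h
    · linear_combination (-u 4 * u 3 + u 5 * u 2 - u 6 * u 1 + u 7 * u 0) * h
  orthogonal := by
    ext i j
    fin_cases i <;> fin_cases j <;> simp [Matrix.mul_apply, Fin.sum_univ_five] <;>
      first | ring1 | linear_combination (s ^ 2 + t ^ 2 + 1) * h
  det := by
    simp [Matrix.det_succ_row_zero, Fin.sum_univ_succ, Fin.succAbove]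
    linear_combination (s ^ 2 + t ^ 2 + 1) * h

/-! ### Transitivity of the symmetries on the 7-sphere -/

theorem exists_polar (x : Fin 4 → ℝ) : ∃ (s : ℝ) (a : Fin 4 → ℝ),
    a 0 ^ 2 + a 1 ^ 2 + a 2 ^ 2 + a 3 ^ 2 = 1 ∧ (∀ i, x i = a i * s) ∧
      s ^ 2 = x 0 ^ 2 + x 1 ^ 2 + x 2 ^ 2 + x 3 ^ 2 := by
  have hnn : 0 ≤ x 0 ^ 2 + x 1 ^ 2 + x 2 ^ 2 + x 3 ^ 2 := by positivity
  set s := √(x 0 ^ 2 + x 1 ^ 2 + x 2 ^ 2 + x 3 ^ 2) with hs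
  have hs2 : s ^ 2 = x 0 ^ 2 + x 1 ^ 2 + x 2 ^ 2 + x 3 ^ 2 := Real.sq_sqrt hnn
  by_cases h0 : s = 0
  -- The zero quaternion has no preferred direction; any unit quaternion serves.
  · refine ⟨s, ![1, 0, 0, 0], by simp, fun i => ?_, hs2⟩
    have hz : x 0 ^ 2 + x 1 ^ 2 + x 2 ^ 2 + x 3 ^ 2 = 0 := by rw [← hs2, h0]; norm_num
    rw [h0, mul_zero]
    fin_cases i <;> simp <;> nlinarith [sq_nonneg (x 0), sq_nonneg (x 1), sq_nonneg (x 2),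
      sq_nonneg (x 3)]
  · refine ⟨s, fun i => x i / s, ?_, fun i => by field_simp, hs2⟩
    field_simp
    linarith

/-- In polar form `r = (a s, b t)` with `a, b` unit and `s² + t² = 1`: the real rotation takes `(1,
0)` to `(s, t)`, and the left multiplications then supply `a` and `b`. -/
theorem exists_hopfSymmetry {r : R8} (hr : ‖r‖ = 1) :
    ∃ L N, HopfSymmetry L N ∧ L (stdVec 0) = r := by
  obtain ⟨s, a, ha, hxa, hs⟩ := exists_polar ![r 0, r 1, r 2, r 3]
  obtain ⟨t, b, hb, hyb, ht⟩ := exists_polar ![r 4, r 5, r 6, r 7]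
  have hr2 : ‖r‖ ^ 2 = 1 := by rw [hr]; norm_num
  have hst : s ^ 2 + t ^ 2 = 1 := by
    rw [← hr2, hs, ht, EuclideanSpace.norm_sq_eq]
    simp [Fin.sum_univ_eight]
    ring
  refine ⟨_, _, (hopfSymmetry_leftMulX ha).comp
    ((hopfSymmetry_leftMulY hb).comp (hopfSymmetry_rotXY hst)), ?_⟩
  ext i
  have h0 := hxa 0
  have h1 := hxa 1
  have h2 := hxa 2
  have h3 := hxa 3
  have h4 := hyb 0
  have h5 := hyb 1
  have h6 := hyb 2
  have h7 := hyb 3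
  simp at h0 h1 h2 h3 h4 h5 h6 h7
  fin_cases i <;> simp [leftMulX_apply, leftMulY_apply, rotXY_apply, stdVec, *]

/-! ## Oriented orthonormal frames of the 4-sphere -/

/-- The form `(v₁, …, v₄) ↦ det (x, v₁, …, v₄)` on `T_x S⁴`. -/
def sphereVolume (x : S4) : TangentSpace (𝓡 4) x [⋀^Fin 4]→ₗ[ℝ] ℝ :=
  ((Matrix.detRowAlternating (R := ℝ) (n := Fin 5)).curryLeft (fun k => (x : R5) k)).compLinearMap
    ((WithLp.linearEquiv 2 ℝ (Fin 5 → ℝ)).toLinearMap ∘ₗ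
      (mfderiv (𝓡 4) 𝓘(ℝ, R5) ((↑) : S4 → R5) x).toLinearMap)

theorem sphereVolume_apply (x : S4) (b : Fin 4 → TangentSpace (𝓡 4) x) :
    sphereVolume x b = (Matrix.of ![fun k => (x : R5) k, fun k => tangentToR5 x (b 0) k,
      fun k => tangentToR5 x (b 1) k, fun k => tangentToR5 x (b 2) k,
      fun k => tangentToR5 x (b 3) k] : Matrix (Fin 5) (Fin 5) ℝ).det := by
  refine congrArg (Matrix.det (R := ℝ) (n := Fin 5)) ?_
  ext i k
  fin_cases i <;> rfl

theorem tangentToR5_sum {n : ℕ} (x : S4) (c : Fin n → ℝ) (b : Fin n → TangentSpace (𝓡 4) x) :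
    tangentToR5 x (∑ i, c i • b i) = ∑ i, c i • tangentToR5 x (b i) := by
  unfold tangentToR5
  refine (map_sum (mfderiv (𝓡 4) 𝓘(ℝ, R5) ((↑) : S4 → R5) x) _ _).trans ?_
  refine Finset.sum_congr rfl fun i _ => ?_
  exact map_smul (mfderiv (𝓡 4) 𝓘(ℝ, R5) ((↑) : S4 → R5) x) _ _

/-- Two oriented orthonormal frames are related by a matrix with `Mᵀ * M = 1`. Evaluating
`sphereVolume` on both shows that its determinant is positive, hence 1, and such a change of frame
leaves the star unchanged. -/
theorem isAntiSelfDual_iff {W : Type*} [AddCommGroup W] [Module ℝ W] {x : S4}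
    {b : Basis (Fin 4) ℝ (TangentSpace (𝓡 4) x)} (hb : IsOrientedFrameS4 x b)
    (β : TangentSpace (𝓡 4) x [⋀^Fin 2]→ₗ[ℝ] W) :
    IsAntiSelfDual x β ↔ ∀ v : Fin 2 → TangentSpace (𝓡 4) x,
      hodgeStar (k := 2) (m := 2) b β v = -β v := by
  refine ⟨fun ⟨b', hb', h⟩ v => ?_, fun h => ⟨b, hb, h⟩⟩
  rw [← h v]
  set M := b.toMatrix b' with hM
  have hsum : ∀ j, b' j = ∑ p, M p j • b p := fun j => (b.sum_toMatrix_smul_self b' j).symm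
  have hMM : M.transpose * M = 1 := by
    ext i j
    have h1 := orthonormal_iff_ite.1 hb'.1 i j
    rw [hsum i, hsum j, tangentToR5_sum, tangentToR5_sum, hb.1.inner_sum] at h1
    simpa [Matrix.mul_apply, Matrix.one_apply] using h1
  have hvol : sphereVolume x b' = sphereVolume x b * M.det := by
    conv_lhs => rw [(sphereVolume x).eq_smul_basis_det b]
    rw [AlternatingMap.smul_apply, smul_eq_mul, Basis.det_apply]
  have hpos : 0 < M.det := by
    have h1 : 0 < sphereVolume x b := by rw [sphereVolume_apply]; exact hb.2
    have h2 : 0 < sphereVolume x b' := by rw [sphereVolume_apply]; exact hb'.2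
    rw [hvol] at h2
    exact pos_of_mul_pos_right h2 h1.le
  have hdet : M.det = 1 := by
    have := congrArg Matrix.det hMM
    rw [Matrix.det_mul, Matrix.det_transpose, Matrix.det_one] at this
    nlinarith
  refine (hodgeStar_eq_of_orthogonal (k := 2) (m := 2) b b' M (mul_eq_one_comm.1 hMM) hsum ?_
    β v).symm
  have := b.det.eq_smul_basis_det b'
  rw [Basis.det_apply, ← hM, hdet, one_smul] at this
  exact this.symm

/-! ## The derivative of the Hopf map -/

/-- The ambient Hopf map is homogeneous quadratic, so its derivative is its polarization. -/
theorem fderiv_hopfAmbient (p v : R8) : fderiv ℝ hopfAmbient p v =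
    hopfAmbient (p + v) - hopfAmbient p - hopfAmbient v := by
  have hd : DifferentiableAt ℝ hopfAmbient p :=
    (contDiff_hopfAmbient.contDiffAt).differentiableAt (by simp)
  have h1 : HasDerivAt (fun t : ℝ => hopfAmbient (p + t • v)) (fderiv ℝ hopfAmbient p v) 0 := by
    have hl : HasDerivAt (fun t : ℝ => p + t • v) v 0 := by
      simpa using ((hasDerivAt_id (0 : ℝ)).smul_const v).const_add p
    have hd' : HasFDerivAt hopfAmbient (fderiv ℝ hopfAmbient p) (p + (0 : ℝ) • v) := by
      simpa using hd.hasFDerivAt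
    exact hd'.comp_hasDerivAt (0 : ℝ) hl
  have h2 : (fun t : ℝ => hopfAmbient (p + t • v)) = fun t : ℝ => hopfAmbient p +
      t • (hopfAmbient (p + v) - hopfAmbient p - hopfAmbient v) + t ^ 2 • hopfAmbient v := by
    funext t
    simp only [hopfAmbient_eq]
    ext i
    fin_cases i <;> simp <;> ring
  have h3 : HasDerivAt (fun t : ℝ => hopfAmbient p +
      t • (hopfAmbient (p + v) - hopfAmbient p - hopfAmbient v) + t ^ 2 • hopfAmbient v)
      (hopfAmbient (p + v) - hopfAmbient p - hopfAmbient v) 0 := by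
    have ha := ((hasDerivAt_id (0 : ℝ)).smul_const
      (hopfAmbient (p + v) - hopfAmbient p - hopfAmbient v)).const_add (hopfAmbient p)
    have hb := ((hasDerivAt_id (0 : ℝ)).pow 2).smul_const (hopfAmbient v)
    exact (ha.add hb).congr_deriv (by simp)
  rw [h2] at h1
  exact h1.unique h3

theorem hopfAmbient_stdVec_zero (i : Fin 5) :
    hopfAmbient (stdVec 0) i = if i = 0 then 1 else 0 := by
  rw [hopfAmbient_eq]
  fin_cases i <;> simp [stdVec]

/-- The horizontal vector `∂/∂y^m` at `(1, 0)` is mapped to twice the `m`-th unit vector. -/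
theorem hopfAmbient_polar_horizontal (m : Fin 4) (i : Fin 5) :
    (hopfAmbient (stdVec 0 + stdVec (Fin.natAdd 4 m)) - hopfAmbient (stdVec 0) -
      hopfAmbient (stdVec (Fin.natAdd 4 m))) i = if i = m.succ then 2 else 0 := by
  simp only [hopfAmbient_eq]
  fin_cases m <;> fin_cases i <;> simp [stdVec, Fin.ext_iff]

theorem hopfAmbient_polar_vertical (m : Fin 3) :
    hopfAmbient (stdVec 0 + stdVec (Fin.castAdd 4 m.succ)) - hopfAmbient (stdVec 0) -
      hopfAmbient (stdVec (Fin.castAdd 4 m.succ)) = 0 := by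
  simp only [hopfAmbient_eq]
  ext i
  fin_cases m <;> fin_cases i <;> simp [stdVec, Fin.ext_iff]

theorem tangentToR5_mfderiv_hopf (x : S7) (v : TangentSpace (𝓡 7) x) :
    tangentToR5 (hopf x) (mfderiv (𝓡 7) (𝓡 4) hopf x v) =
      fderiv ℝ hopfAmbient x (mfderiv (𝓡 7) 𝓘(ℝ, R8) ((↑) : S7 → R8) x v) := by
  have : Fact (finrank ℝ R8 = 7 + 1) := ⟨by simp⟩
  have : Fact (finrank ℝ R5 = 4 + 1) := ⟨by simp⟩
  have h1 : MDifferentiableAt (𝓡 7) (𝓡 4) hopf x := (contMDiff_hopf x).mdifferentiableAt (by simp)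
  have h2 : MDifferentiableAt (𝓡 4) 𝓘(ℝ, R5) ((↑) : S4 → R5) (hopf x) :=
    ((contMDiff_coe_sphere (n := 4) (m := 1)) (hopf x)).mdifferentiableAt (by simp)
  have h3 : MDifferentiableAt (𝓡 7) 𝓘(ℝ, R8) ((↑) : S7 → R8) x :=
    ((contMDiff_coe_sphere (n := 7) (m := 1)) x).mdifferentiableAt (by simp)
  have h4 : MDifferentiableAt 𝓘(ℝ, R8) 𝓘(ℝ, R5) hopfAmbient x :=
    ((contDiff_hopfAmbient.contDiffAt).differentiableAt (by simp)).mdifferentiableAt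
  have e1 := mfderiv_comp x h2 h1
  have e2 := mfderiv_comp x h4 h3
  have e3 : ((↑) : S4 → R5) ∘ hopf = hopfAmbient ∘ ((↑) : S7 → R8) := rfl
  rw [e3, e2, mfderiv_eq_fderiv] at e1
  exact (congrArg (fun f : TangentSpace (𝓡 7) x →L[ℝ] R5 => f v) e1).symm

/-! ## Adapted frames of the 7-sphere and the 4-sphere -/

theorem HopfSymmetry.inner_stdVec {L : R8 →ₗ[ℝ] R8} {N : Matrix (Fin 5) (Fin 5) ℝ}
    (h : HopfSymmetry L N) (i j : Fin 8) :
    inner ℝ (L (stdVec i)) (L (stdVec j)) = if i = j then (1 : ℝ) else 0 := by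
  rw [h.inner_map]
  simp [stdVec, EuclideanSpace.inner_single_left]

/-- The tangent space is the orthogonal complement of `x = L e₀`, and `L` is an isometry, so the
images of the other seven standard vectors form an orthonormal basis of it. -/
theorem HopfSymmetry.exists_basis {L : R8 →ₗ[ℝ] R8} {N : Matrix (Fin 5) (Fin 5) ℝ}
    (h : HopfSymmetry L N) {x : S7} (hx : L (stdVec 0) = x) :
    ∃ t : Basis (Fin 7) ℝ (TangentSpace (𝓡 7) x),
      ∀ i, mfderiv (𝓡 7) 𝓘(ℝ, R8) ((↑) : S7 → R8) x (t i) = L (stdVec i.succ) := by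
  have : Fact (finrank ℝ R8 = 7 + 1) := ⟨by simp⟩
  have hrange : ∀ i : Fin 7, ∃ t : TangentSpace (𝓡 7) x,
      mfderiv (𝓡 7) 𝓘(ℝ, R8) ((↑) : S7 → R8) x t = L (stdVec i.succ) := by
    intro i
    have hmem : L (stdVec i.succ) ∈ (ℝ ∙ (x : R8))ᗮ := by
      rw [Submodule.mem_orthogonal_singleton_iff_inner_right, ← hx, h.inner_stdVec,
        if_neg (Fin.succ_ne_zero i).symm]
    have hr := range_mvfderiv_subtypeVal (n := 7) x
    rw [← hr] at hmem
    exact hmem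
  choose t ht using hrange
  have hli : LinearIndependent ℝ t := by
    have ho : Orthonormal ℝ (fun i : Fin 7 => L (stdVec i.succ)) := by
      rw [orthonormal_iff_ite]
      intro i j
      rw [h.inner_stdVec]
      simp
    have := ho.linearIndependent
    simp only [← ht] at this
    exact LinearIndependent.of_comp
      (mfderiv (𝓡 7) 𝓘(ℝ, R8) ((↑) : S7 → R8) x).toLinearMap this
  have hcard : Fintype.card (Fin 7) = finrank ℝ (TangentSpace (𝓡 7) x) := by
    change _ = finrank ℝ (EuclideanSpace ℝ (Fin 7))
    simp
  refine ⟨basisOfLinearIndependentOfCardEqFinrank hli hcard, fun i => ?_⟩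
  rw [coe_basisOfLinearIndependentOfCardEqFinrank, ht]

theorem HopfSymmetry.fderiv_apply {L : R8 →ₗ[ℝ] R8} {N : Matrix (Fin 5) (Fin 5) ℝ}
    (h : HopfSymmetry L N) (p v : R8) (i : Fin 5) :
    fderiv ℝ hopfAmbient (L p) (L v) i =
      ∑ j, N i j * (hopfAmbient (p + v) - hopfAmbient p - hopfAmbient v) j := by
  rw [fderiv_hopfAmbient, ← map_add]
  simp only [PiLp.sub_apply, h.hopf_map, mul_sub, Finset.sum_sub_distrib]

/-- At `(1, 0)` the derivative of the Hopf map kills the imaginary `x`-directions and doubles the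
`y`-directions; equivariance transports this to `x`. The base point and the frame `f` are then the
columns of `N`, so orthonormality and orientation are exactly `Nᵀ * N = 1` and `det N = 1`. -/
theorem HopfSymmetry.exists_frame {L : R8 →ₗ[ℝ] R8} {N : Matrix (Fin 5) (Fin 5) ℝ}
    (h : HopfSymmetry L N) {x : S7} (hx : L (stdVec 0) = x)
    {t : Basis (Fin 7) ℝ (TangentSpace (𝓡 7) x)}
    (ht : ∀ i, mfderiv (𝓡 7) 𝓘(ℝ, R8) ((↑) : S7 → R8) x (t i) = L (stdVec i.succ)) :
    (∀ i : Fin 3, mfderiv (𝓡 7) (𝓡 4) hopf x (t (Fin.castAdd 4 i)) = 0) ∧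
    ∃ f : Basis (Fin 4) ℝ (TangentSpace (𝓡 4) (hopf x)), IsOrientedFrameS4 (hopf x) f ∧
      ∀ m, mfderiv (𝓡 7) (𝓡 4) hopf x (t (Fin.natAdd 3 m)) = (2 : ℝ) • f m := by
  have : Fact (finrank ℝ R5 = 4 + 1) := ⟨by simp⟩
  have hd : ∀ i j, tangentToR5 (hopf x) (mfderiv (𝓡 7) (𝓡 4) hopf x (t i)) j =
      ∑ k, N j k * (hopfAmbient (stdVec 0 + stdVec i.succ) - hopfAmbient (stdVec 0) -
        hopfAmbient (stdVec i.succ)) k := by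
    intro i j
    rw [tangentToR5_mfderiv_hopf, ht, ← hx, h.fderiv_apply]
  refine ⟨fun i => ?_, ?_⟩
  · refine injective_mvfderiv_subtypeVal_sphere (n := 4) (hopf x) ?_
    rw [map_zero]
    change tangentToR5 (hopf x) _ = 0
    ext j
    rw [hd]
    have h0 := hopfAmbient_polar_vertical i
    have e : Fin.castAdd 4 i.succ = (Fin.castAdd 4 i : Fin 7).succ := rfl
    rw [e] at h0
    simp [h0]
  · set f : Fin 4 → TangentSpace (𝓡 4) (hopf x) := fun m =>
      (2 : ℝ)⁻¹ • mfderiv (𝓡 7) (𝓡 4) hopf x (t (Fin.natAdd 3 m)) with hf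
    have hfN : ∀ m j, tangentToR5 (hopf x) (f m) j = N j m.succ := by
      intro m j
      have h1 : tangentToR5 (hopf x) (f m) = (2 : ℝ)⁻¹ • tangentToR5 (hopf x)
          (mfderiv (𝓡 7) (𝓡 4) hopf x (t (Fin.natAdd 3 m))) :=
        map_smul (mfderiv (𝓡 4) 𝓘(ℝ, R5) ((↑) : S4 → R5) (hopf x)) _ _
      rw [h1, PiLp.smul_apply, hd]
      have h0 := hopfAmbient_polar_horizontal m
      have e : Fin.natAdd 4 m = (Fin.natAdd 3 m : Fin 7).succ := by
        ext
        simp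
        omega
      rw [e] at h0
      simp [h0]
      ring
    have hxN : ∀ j, (hopf x : R5) j = N j 0 := by
      intro j
      have : (hopf x : R5) = hopfAmbient (L (stdVec 0)) := by rw [hx]; rfl
      rw [this, h.hopf_map]
      simp [hopfAmbient_stdVec_zero]
    have ho : Orthonormal ℝ (fun m => tangentToR5 (hopf x) (f m)) := by
      rw [orthonormal_iff_ite]
      intro i j
      have := congrFun (congrFun h.orthogonal i.succ) j.succ
      rw [PiLp.inner_apply]
      simpa [hfN, Matrix.mul_apply, Matrix.one_apply, mul_comm] using this
    have hli : LinearIndependent ℝ f :=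
      LinearIndependent.of_comp
        (mfderiv (𝓡 4) 𝓘(ℝ, R5) ((↑) : S4 → R5) (hopf x)).toLinearMap ho.linearIndependent
    have hcard : Fintype.card (Fin 4) = finrank ℝ (TangentSpace (𝓡 4) (hopf x)) := by
      change _ = finrank ℝ (EuclideanSpace ℝ (Fin 4))
      simp
    refine ⟨basisOfLinearIndependentOfCardEqFinrank hli hcard, ⟨?_, ?_⟩, fun m => ?_⟩
    · simpa only [coe_basisOfLinearIndependentOfCardEqFinrank] using ho
    · simp only [coe_basisOfLinearIndependentOfCardEqFinrank]
      have e : (Matrix.of ![fun k => (hopf x : R5) k, fun k => tangentToR5 (hopf x) (f 0) k,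
          fun k => tangentToR5 (hopf x) (f 1) k, fun k => tangentToR5 (hopf x) (f 2) k,
          fun k => tangentToR5 (hopf x) (f 3) k] : Matrix (Fin 5) (Fin 5) ℝ) = N.transpose := by
        ext i k
        fin_cases i
        · exact hxN k
        · exact hfN 0 k
        · exact hfN 1 k
        · exact hfN 2 k
        · exact hfN 3 k
      rw [e, Matrix.det_transpose, h.det]
      norm_num
    · rw [coe_basisOfLinearIndependentOfCardEqFinrank, hf, smul_smul]
      norm_num

/-! ## The two `G₂`-structures in an adapted frame -/

theorem HopfSymmetry.sigma_frame {L : R8 →ₗ[ℝ] R8} {N : Matrix (Fin 5) (Fin 5) ℝ}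
    (h : HopfSymmetry L N) (a : Fin 3) (i j : Fin 8) :
    sigmaForm a ![L (stdVec i), L (stdVec j)] = hyperCoeff a i j := by
  rw [h.sigma, sigmaForm_stdVec]

theorem restrictToS7_apply (x : S7) (Φ : R8 [⋀^Fin 3]→ₗ[ℝ] ℝ) (u v w : TangentSpace (𝓡 7) x) :
    restrictToS7 x Φ ![u, v, w] =
      Φ ![mfderiv (𝓡 7) 𝓘(ℝ, R8) ((↑) : S7 → R8) x u, mfderiv (𝓡 7) 𝓘(ℝ, R8) ((↑) : S7 → R8) x v,
        mfderiv (𝓡 7) 𝓘(ℝ, R8) ((↑) : S7 → R8) x w] := by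
  change Φ _ = Φ _
  congr 1
  ext i
  fin_cases i <;> rfl

theorem phiStd_frame {L : R8 →ₗ[ℝ] R8} {N : Matrix (Fin 5) (Fin 5) ℝ}
    (h : HopfSymmetry L N) {x : S7} (hx : L (stdVec 0) = x)
    {t : Fin 7 → TangentSpace (𝓡 7) x}
    (ht : ∀ i, mfderiv (𝓡 7) 𝓘(ℝ, R8) ((↑) : S7 → R8) x (t i) = L (stdVec i.succ))
    (i j k : Fin 7) : phiStd x ![t i, t j, t k] = g2Coeff i j k := by
  rw [phiStd, restrictToS7_apply, ht, ht, ht, AlternatingMap.curryLeft_apply_apply, Psi0_apply]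
  simp only [← hx, h.sigma_frame, Fin.sum_univ_three, g2Coeff, cubicCoeff]
  simp
  ring

/-- The coefficients of `ζ₁ ∧ ζ₂ ∧ ζ₃` at `(1, 0)`. -/
def verticalCoeff (i j k : Fin 7) : ℤ :=
  let z : Fin 3 → Fin 7 → ℤ := fun a i => hyperCoeff a 0 i.succ
  z 0 i * (z 1 j * z 2 k - z 1 k * z 2 j) - z 0 j * (z 1 i * z 2 k - z 1 k * z 2 i) +
    z 0 k * (z 1 i * z 2 j - z 1 j * z 2 i)

/-- The coefficients of `ζ_a ∧ ω̄_a` at `(1, 0)`. -/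
def mixedCoeff (a : Fin 3) (i j k : Fin 7) : ℤ :=
  let z : Fin 3 → Fin 7 → ℤ := fun a i => hyperCoeff a 0 i.succ
  let o : Fin 7 → Fin 7 → ℤ := fun i j => hyperCoeff a i.succ j.succ -
    (z (a + 1) i * z (a + 2) j - z (a + 1) j * z (a + 2) i)
  z a i * o j k - z a j * o i k + z a k * o i j

theorem zetaForm_apply (r u : R8) (a : Fin 3) : zetaForm r a ![u] = sigmaForm a ![r, u] := rfl

theorem omegaBar_apply (r u v : R8) (a : Fin 3) : omegaBar r a ![u, v] = sigmaForm a ![u, v] -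
    (sigmaForm (a + 1) ![r, u] * sigmaForm (a + 2) ![r, v] -
      sigmaForm (a + 1) ![r, v] * sigmaForm (a + 2) ![r, u]) := by
  rw [omegaBar, AlternatingMap.sub_apply, wedge_apply_1_1]
  rfl

theorem phiSq_frame {L : R8 →ₗ[ℝ] R8} {N : Matrix (Fin 5) (Fin 5) ℝ}
    (h : HopfSymmetry L N) {x : S7} (hx : L (stdVec 0) = x)
    {t : Fin 7 → TangentSpace (𝓡 7) x}
    (ht : ∀ i, mfderiv (𝓡 7) 𝓘(ℝ, R8) ((↑) : S7 → R8) x (t i) = L (stdVec i.succ))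
    (i j k : Fin 7) : phiSq x ![t i, t j, t k] =
      27 / 25 * (1 / 5 * verticalCoeff i j k - (∑ a, mixedCoeff a i j k : ℤ)) := by
  rw [phiSq, restrictToS7_apply, ht, ht, ht, Fin.sum_univ_three, Fin.sum_univ_three]
  simp only [AlternatingMap.smul_apply, AlternatingMap.sub_apply, AlternatingMap.add_apply,
    wedge_apply_1_2, wedge_apply_2_1, wedge_apply_1_1, AlternatingMap.curryLeft_apply_apply,
    zetaForm_apply, omegaBar_apply, smul_eq_mul, ← hx, h.sigma_frame, verticalCoeff, mixedCoeff]
  push_cast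
  ring

/-! ## The instanton equations at a point -/

/-- The signs by which the squashed coframe differs from the standard one. -/
def squashSign : Fin 7 → ℤ := ![-1, -1, 1, 1, 1, 1, 1]

/-- The lengths that rescale the standard frame to a frame of the squashed metric. -/
def squashScale (i : Fin 7) : ℝ := squashSign i * if i < 3 then 5 / 3 else √5 / 3

theorem squashScale_ne_zero (i : Fin 7) : squashScale i ≠ 0 := by
  have h5 : √(5 : ℝ) ≠ 0 := by positivity
  refine mul_ne_zero ?_ ?_
  · fin_cases i <;> norm_num [squashSign]
  · split_ifs <;> positivity

/-- The scales solve two equations: `(5/3)³ · 27/125 = 1` for `ζ₁ ∧ ζ₂ ∧ ζ₃`, and `(5/3) · (√5/3)² ·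
27/25 = 1` for the terms `ζ_a ∧ ω̄_a`. The signs `-1, -1, 1` have product one and turn `-∑ ζ_a ∧
ω̄_a` into the pattern `+, +, -` of the model form. -/
theorem squash_coeff (i j k : Fin 7) :
    squashScale i * squashScale j * squashScale k *
      (27 / 25 * (1 / 5 * verticalCoeff i j k - (∑ a, mixedCoeff a i j k : ℤ))) =
      g2Coeff i j k := by
  have h5 : √(5 : ℝ) * √5 = 5 := Real.mul_self_sqrt (by norm_num)
  -- The form `ω̄_a` is horizontal on the sphere, so a nonzero coefficient has either three vertical
  -- indices or exactly one; no other powers of the scales occur.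
  have key : ∀ i j k : Fin 7,
      (verticalCoeff i j k = 0 ∧ ∑ a, mixedCoeff a i j k = 0 ∧ g2Coeff i j k = 0) ∨
      ((i < 3 ∧ j < 3 ∧ k < 3) ∧ ∑ a, mixedCoeff a i j k = 0 ∧
        squashSign i * squashSign j * squashSign k * verticalCoeff i j k = g2Coeff i j k) ∨
      (((i < 3 ∧ ¬ j < 3 ∧ ¬ k < 3) ∨ (¬ i < 3 ∧ j < 3 ∧ ¬ k < 3) ∨ (¬ i < 3 ∧ ¬ j < 3 ∧ k < 3)) ∧
        verticalCoeff i j k = 0 ∧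
        squashSign i * squashSign j * squashSign k * -∑ a, mixedCoeff a i j k = g2Coeff i j k) := by
    decide +kernel
  have hijk := key i j k
  generalize ∑ a, mixedCoeff a i j k = m at hijk ⊢
  rcases hijk with ⟨h1, h2, h3⟩ | ⟨⟨hi, hj, hk⟩, h2, h3⟩ | ⟨h, h2, h3⟩
  · simp only [h1, h2, h3]
    simp
  · have h3' := congrArg (Int.cast (R := ℝ)) h3
    push_cast at h3'
    simp only [squashScale, hi, hj, hk, if_true, h2]
    push_cast
    linear_combination h3'
  · have h3' := congrArg (Int.cast (R := ℝ)) h3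
    push_cast at h3'
    rcases h with ⟨hi, hj, hk⟩ | ⟨hi, hj, hk⟩ | ⟨hi, hj, hk⟩
    all_goals
      simp only [squashScale, hi, hj, hk, if_true, if_false, h2]
      push_cast
      linear_combination h3' - (squashSign i * squashSign j * squashSign k *
        m / 5 : ℝ) * h5

section Pointwise

variable {W : Type*} [AddCommGroup W] [Module ℝ W]

/-- The pullback of a 2-form on `T S⁴` by the differential of the Hopf map. -/
def hopfPullback (x : S7) (β : TangentSpace (𝓡 4) (hopf x) [⋀^Fin 2]→ₗ[ℝ] W) :
    TangentSpace (𝓡 7) x [⋀^Fin 2]→ₗ[ℝ] W :=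
  β.compLinearMap (mfderiv (𝓡 7) (𝓡 4) hopf x).toLinearMap

theorem hopfPullback_apply (x : S7) (β : TangentSpace (𝓡 4) (hopf x) [⋀^Fin 2]→ₗ[ℝ] W)
    (u v : TangentSpace (𝓡 7) x) : hopfPullback x β ![u, v] =
      β ![mfderiv (𝓡 7) (𝓡 4) hopf x u, mfderiv (𝓡 7) (𝓡 4) hopf x v] := by
  change β _ = β _
  congr 1
  ext i
  fin_cases i <;> rfl

theorem AlternatingMap.map_pair_smul {V : Type*} [AddCommGroup V] [Module ℝ V]
    (β : V [⋀^Fin 2]→ₗ[ℝ] W) (c d : ℝ) (u v : V) : β ![c • u, d • v] = (c * d) • β ![u, v] := by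
  have h := β.map_smul_univ ![c, d] ![u, v]
  simp only [Fin.prod_univ_two, Matrix.cons_val_zero, Matrix.cons_val_one] at h
  rw [← h]
  congr 1
  ext i
  fin_cases i <;> rfl

theorem AlternatingMap.map_triple_smul {V : Type*} [AddCommGroup V] [Module ℝ V]
    (β : V [⋀^Fin 3]→ₗ[ℝ] ℝ) (c d e : ℝ) (u v w : V) :
    β ![c • u, d • v, e • w] = c * d * e * β ![u, v, w] := by
  have h := β.map_smul_univ ![c, d, e] ![u, v, w]
  simp only [Fin.prod_univ_three, smul_eq_mul] at h
  refine Eq.trans ?_ h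
  congr 1
  ext i
  fin_cases i <;> rfl

/-- The common core of both cases: only the coefficients of `φ` in `b` and a nonzero horizontal
scale `c` enter. The factor `c * c` multiplies all three equations and cancels. -/
theorem satisfiesG2Equation_iff_isAntiSelfDual {x : S7} {φ : TangentSpace (𝓡 7) x [⋀^Fin 3]→ₗ[ℝ] ℝ}
    {b : Basis (Fin 7) ℝ (TangentSpace (𝓡 7) x)}
    (hφ : ∀ i j k, φ ![b i, b j, b k] = g2Coeff i j k)
    {f : Basis (Fin 4) ℝ (TangentSpace (𝓡 4) (hopf x))} (hf : IsOrientedFrameS4 (hopf x) f)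
    (hv : ∀ i : Fin 3, mfderiv (𝓡 7) (𝓡 4) hopf x (b (Fin.castAdd 4 i)) = 0) {c : ℝ} (hc : c ≠ 0)
    (hh : ∀ m, mfderiv (𝓡 7) (𝓡 4) hopf x (b (Fin.natAdd 3 m)) = c • f m)
    (β : TangentSpace (𝓡 4) (hopf x) [⋀^Fin 2]→ₗ[ℝ] W) :
    IsAntiSelfDual (hopf x) β ↔ SatisfiesG2Equation φ (hopfPullback x β) := by
  have hz : ∀ (i : Fin 3) v, hopfPullback x β ![b (Fin.castAdd 4 i), v] = 0 := by
    intro i v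
    rw [hopfPullback_apply, hv]
    exact β.map_coord_zero (i := 0) rfl
  have hn : ∀ m n : Fin 4, hopfPullback x β ![b (Fin.natAdd 3 m), b (Fin.natAdd 3 n)] =
      (c * c) • β ![f m, f n] := by
    intro m n
    rw [hopfPullback_apply, hh, hh, AlternatingMap.map_pair_smul]
  rw [isAntiSelfDual_iff hf, antiSelfDual_iff, satisfiesG2Equation_iff (isG2Frame_of_coeff hφ),
    g2_hodge_equation_iff hφ _ (hz 0) (hz 1) (hz 2)]
  have h34 := hn 0 1
  have h35 := hn 0 2
  have h36 := hn 0 3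
  have h45 := hn 1 2
  have h46 := hn 1 3
  have h56 := hn 2 3
  change hopfPullback x β ![b 3, b 4] = _ at h34
  change hopfPullback x β ![b 3, b 5] = _ at h35
  change hopfPullback x β ![b 3, b 6] = _ at h36
  change hopfPullback x β ![b 4, b 5] = _ at h45
  change hopfPullback x β ![b 4, b 6] = _ at h46
  change hopfPullback x β ![b 5, b 6] = _ at h56
  rw [h34, h35, h36, h45, h46, h56, ← smul_add, ← smul_sub, ← smul_add]
  simp only [smul_eq_zero, mul_eq_zero, hc, or_self, false_or]

theorem isAntiSelfDual_iff_std (x : S7) (β : TangentSpace (𝓡 4) (hopf x) [⋀^Fin 2]→ₗ[ℝ] W) :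
    IsAntiSelfDual (hopf x) β ↔ SatisfiesG2Equation (phiStd x) (hopfPullback x β) := by
  obtain ⟨L, N, h, hx⟩ := exists_hopfSymmetry (r := (x : R8)) (by simp)
  obtain ⟨t, ht⟩ := h.exists_basis hx
  obtain ⟨hv, f, hf, hh⟩ := h.exists_frame hx ht
  exact satisfiesG2Equation_iff_isAntiSelfDual (phiStd_frame h hx ht) hf hv two_ne_zero hh β

theorem isAntiSelfDual_iff_sq (x : S7) (β : TangentSpace (𝓡 4) (hopf x) [⋀^Fin 2]→ₗ[ℝ] W) :
    IsAntiSelfDual (hopf x) β ↔ SatisfiesG2Equation (phiSq x) (hopfPullback x β) := by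
  obtain ⟨L, N, h, hx⟩ := exists_hopfSymmetry (r := (x : R8)) (by simp)
  obtain ⟨t, ht⟩ := h.exists_basis hx
  obtain ⟨hv, f, hf, hh⟩ := h.exists_frame hx ht
  let b := t.isUnitSMul (fun i => (squashScale_ne_zero i).isUnit)
  have hb : ∀ i, b i = squashScale i • t i := fun i => Basis.isUnitSMul_apply _ i
  refine satisfiesG2Equation_iff_isAntiSelfDual (b := b) (c := √5 / 3 * 2) ?_ hf ?_
    (by positivity) ?_ β
  · intro i j k
    rw [hb, hb, hb, AlternatingMap.map_triple_smul, phiSq_frame h hx ht, squash_coeff]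
  · intro i
    rw [hb, map_smul, hv, smul_zero]
  · intro m
    have hs : squashScale (Fin.natAdd 3 m) = √5 / 3 := by
      fin_cases m <;> simp [squashScale, squashSign]
    rw [hb, map_smul, hh, smul_smul, hs]

end Pointwise

/-! ## The total space of a smooth principal bundle as a manifold -/

section TotalSpaceManifold

variable {n : ℕ} {F : Type*} [NormedAddCommGroup F] [NormedSpace ℝ F]
  {B : Type*} [TopologicalSpace B] [ChartedSpace (EuclideanSpace ℝ (Fin n)) B]
  {G : Type*} [TopologicalSpace G] [ChartedSpace F G] [Group G]
  {E : B → Type*} [TopologicalSpace (TotalSpace G E)] [∀ x, TopologicalSpace (E x)]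
  [FiberBundle G E] [∀ x, MulAction Gᵐᵒᵖ (E x)]

variable (n F) in
theorem trivialization_rightMul_eq [SmoothPrincipalBundle n F G E]
    (e : Trivialization G (π G E)) [MemTrivializationAtlas e]
    {p : TotalSpace G E} (hp : p.proj ∈ e.baseSet) (g : G) :
    e (rightMul g p) = ((e p).1, (e p).2 * g) := by
  ext
  · rw [e.coe_fst' hp, e.coe_fst' (show (rightMul g p).proj ∈ e.baseSet from hp)]; rfl
  · exact SmoothPrincipalBundle.trivialization_rightMul n F e p g hp

-- A change of trivialization commutes with right translation, and a map `G → G` with this property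
-- is left multiplication by its value at 1.
variable (n F) in
theorem coordChange_eq_mul [SmoothPrincipalBundle n F G E]
    (e e' : Trivialization G (π G E)) [MemTrivializationAtlas e]
    [MemTrivializationAtlas e'] {x : B} (hx : x ∈ e.baseSet) (hx' : x ∈ e'.baseSet) (g : G) :
    e.coordChange e' x g = e.coordChange e' x 1 * g := by
  have h : ∀ h : G, e.toOpenPartialHomeomorph.symm (x, h) ∈ e.source := fun h =>
    e.toOpenPartialHomeomorph.map_target (e.mem_target.2 hx)
  have hpr : ∀ h : G, (e.toOpenPartialHomeomorph.symm (x, h)).proj = x := fun h =>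
    e.proj_symm_apply' hx
  have key : rightMul g (e.toOpenPartialHomeomorph.symm (x, 1)) =
      e.toOpenPartialHomeomorph.symm (x, g) := by
    apply e.injOn (e.mem_source.2 _) (h g)
    · rw [Trivialization.coe_coe, trivialization_rightMul_eq n F e (by rw [hpr]; exact hx),
        e.apply_symm_apply' hx, e.apply_symm_apply' hx, one_mul]
    · change (e.toOpenPartialHomeomorph.symm (x, 1)).proj ∈ _
      rw [hpr]; exact hx
  rw [Trivialization.coordChange, Trivialization.coordChange, ← key,
    SmoothPrincipalBundle.trivialization_rightMul n F e' _ g (by rw [hpr]; exact hx')]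

/-- In two trivializations the identity reads `(x, g) ↦ (x, c(x) g)`, smooth because `c` and the
multiplication of `G` are. -/
theorem contMDiffOn_transition_prod [SmoothPrincipalBundle n F G E] [LieGroup 𝓘(ℝ, F) ∞ G]
    (e e' : Trivialization G (π G E)) [MemTrivializationAtlas e] [MemTrivializationAtlas e'] :
    ContMDiffOn ((𝓡 n).prod 𝓘(ℝ, F)) ((𝓡 n).prod 𝓘(ℝ, F)) ∞
      (e.toOpenPartialHomeomorph.symm.trans e'.toOpenPartialHomeomorph)
      (e.toOpenPartialHomeomorph.symm.trans e'.toOpenPartialHomeomorph).source := by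
  have hs : (e.toOpenPartialHomeomorph.symm.trans e'.toOpenPartialHomeomorph).source ⊆
      Prod.fst ⁻¹' (e.baseSet ∩ e'.baseSet) := by
    intro z hz
    have h1 : z.1 ∈ e.baseSet := e.mem_target.1 hz.1
    have h2 : (e.toOpenPartialHomeomorph.symm z).proj ∈ e'.baseSet := e'.mem_source.1 hz.2
    rw [e.proj_symm_apply (e.mem_target.2 h1)] at h2
    exact ⟨h1, h2⟩
  have h1 : ContMDiffOn ((𝓡 n).prod 𝓘(ℝ, F)) ((𝓡 n).prod 𝓘(ℝ, F)) ∞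
      (fun z : B × G => (z.1, e.coordChange e' z.1 1 * z.2))
      (e.toOpenPartialHomeomorph.symm.trans e'.toOpenPartialHomeomorph).source :=
    contMDiffOn_fst.prodMk
      (((SmoothPrincipalBundle.contMDiffOn_transition (n := n) (F := F) e e').comp
        contMDiffOn_fst hs).mul contMDiffOn_snd)
  refine h1.congr fun z hz => ?_
  obtain ⟨hz1, hz2⟩ := hs hz
  change e' (e.toOpenPartialHomeomorph.symm z) = _
  rw [← coordChange_eq_mul n F e e' hz1 hz2, ← e.mk_coordChange e' hz1 hz2]

/-- Local homeomorphisms of a manifold that are smooth in both directions. -/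
def smoothStructureGroupoid {H V : Type*} [TopologicalSpace H] [NormedAddCommGroup V]
    [NormedSpace ℝ V] (I : ModelWithCorners ℝ V H) (M : Type*) [TopologicalSpace M]
    [ChartedSpace H M] : StructureGroupoid M :=
  Pregroupoid.groupoid
    { property := fun f s => ContMDiffOn I I ∞ f s
      comp := fun hf hg _ _ _ => (hg.comp (hf.mono Set.inter_subset_left)
        fun _ hx => hx.2)
      id_mem := contMDiffOn_id
      locality := fun _ h x hx => by
        obtain ⟨v, hv, hxv, hf⟩ := h x hx
        exact (hf x ⟨hx, hxv⟩).mono_of_mem_nhdsWithin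
          (Filter.inter_mem self_mem_nhdsWithin (mem_nhdsWithin_of_mem_nhds (hv.mem_nhds hxv)))
      congr := fun _ h hf => hf.congr h }

variable (n F G E) in
theorem hasGroupoid_totalSpace [SmoothPrincipalBundle n F G E] [LieGroup 𝓘(ℝ, F) ∞ G] :
    HasGroupoid (TotalSpace G E) (smoothStructureGroupoid ((𝓡 n).prod 𝓘(ℝ, F)) (B × G)) where
  compatible := by
    rintro _ _ ⟨e, he, rfl⟩ ⟨e', he', rfl⟩
    have : MemTrivializationAtlas e := ⟨he⟩
    have : MemTrivializationAtlas e' := ⟨he'⟩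
    exact ⟨contMDiffOn_transition_prod e e', contMDiffOn_transition_prod e' e⟩

-- The charts factor through `B × G`: the trivializations change by diffeomorphisms of open subsets
-- of `B × G`, and these are local structomorphisms for its smooth atlas.
variable (n F G E) in
theorem isManifold_totalSpace [IsManifold (𝓡 n) ∞ B] [SmoothPrincipalBundle n F G E] [LieGroup 𝓘(ℝ, F) ∞ G] :
    IsManifold ((𝓡 n).prod 𝓘(ℝ, F)) ∞ (TotalSpace G E) := by
  have := hasGroupoid_totalSpace n F G E
  refine { StructureGroupoid.HasGroupoid.comp
    (smoothStructureGroupoid ((𝓡 n).prod 𝓘(ℝ, F)) (B × G)) ?_ with }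
  intro e he
  rw [isLocalStructomorphOn_contDiffGroupoid_iff]
  exact he


variable [LieGroup 𝓘(ℝ, F) ∞ G]

/-! ### Smoothness of trivializations, projection, right translations and orbit maps -/

theorem contMDiffAt_trivializationAt [SmoothPrincipalBundle n F G E] [IsManifold (𝓡 n) ∞ B]
    (p : TotalSpace G E) :
    ContMDiffAt ((𝓡 n).prod 𝓘(ℝ, F)) ((𝓡 n).prod 𝓘(ℝ, F)) ∞ (trivializationAt G E p.proj) p := by
  have := isManifold_totalSpace n F G E
  set e := trivializationAt G E p.proj with he
  have h1 : ContMDiffAt ((𝓡 n).prod 𝓘(ℝ, F)) ((𝓡 n).prod 𝓘(ℝ, F)) ∞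
      ((chartAt (ModelProd (EuclideanSpace ℝ (Fin n)) F) (e p)).symm ∘
        (chartAt (ModelProd (EuclideanSpace ℝ (Fin n)) F) p)) p := by
    refine ContMDiffAt.comp p (I' := (𝓡 n).prod 𝓘(ℝ, F)) ?_ ?_
    · refine contMDiffOn_chart_symm.contMDiffAt ?_
      exact (chartAt (ModelProd (EuclideanSpace ℝ (Fin n)) F) (e p)).open_target.mem_nhds
        (mem_chart_target _ (e p))
    · exact contMDiffOn_chart.contMDiffAt (chart_source_mem_nhds _ p)
  refine h1.congr_of_eventuallyEq ?_
  filter_upwards [chart_source_mem_nhds (ModelProd (EuclideanSpace ℝ (Fin n)) F) p] with q hq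
  exact ((chartAt (ModelProd (EuclideanSpace ℝ (Fin n)) F) (e p)).left_inv hq.2).symm

theorem contMDiffAt_trivializationAt_symm [SmoothPrincipalBundle n F G E]
    [IsManifold (𝓡 n) ∞ B] (p : TotalSpace G E) :
    ContMDiffAt ((𝓡 n).prod 𝓘(ℝ, F)) ((𝓡 n).prod 𝓘(ℝ, F)) ∞
      (trivializationAt G E p.proj).toOpenPartialHomeomorph.symm
      (trivializationAt G E p.proj p) := by
  have := isManifold_totalSpace n F G E
  set e := trivializationAt G E p.proj with he
  have h1 : ContMDiffAt ((𝓡 n).prod 𝓘(ℝ, F)) ((𝓡 n).prod 𝓘(ℝ, F)) ∞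
      ((chartAt (ModelProd (EuclideanSpace ℝ (Fin n)) F) p).symm ∘
        (chartAt (ModelProd (EuclideanSpace ℝ (Fin n)) F) (e p))) (e p) := by
    refine ContMDiffAt.comp (e p) (I' := (𝓡 n).prod 𝓘(ℝ, F)) ?_ ?_
    · refine contMDiffOn_chart_symm.contMDiffAt ?_
      exact (chartAt (ModelProd (EuclideanSpace ℝ (Fin n)) F) p).open_target.mem_nhds
        (mem_chart_target _ p)
    · exact contMDiffOn_chart.contMDiffAt (chart_source_mem_nhds _ (e p))
  refine h1.congr_of_eventuallyEq ?_
  filter_upwards [chart_source_mem_nhds (ModelProd (EuclideanSpace ℝ (Fin n)) F) (e p)] with q hq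
  exact congrArg e.toOpenPartialHomeomorph.symm
    ((chartAt (ModelProd (EuclideanSpace ℝ (Fin n)) F) (e p)).left_inv hq).symm

theorem contMDiffAt_trivialization [SmoothPrincipalBundle n F G E] [IsManifold (𝓡 n) ∞ B]
    (e : Trivialization G (π G E)) [MemTrivializationAtlas e] {p : TotalSpace G E}
    (hp : p.proj ∈ e.baseSet) :
    ContMDiffAt ((𝓡 n).prod 𝓘(ℝ, F)) ((𝓡 n).prod 𝓘(ℝ, F)) ∞ e p := by
  set e₀ := trivializationAt G E p.proj with he₀
  have hp₀ : p ∈ e₀.source := FiberBundle.mem_trivializationAt_proj_source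
  have hmem : e₀ p ∈ (e₀.toOpenPartialHomeomorph.symm.trans e.toOpenPartialHomeomorph).source :=
    ⟨e₀.toOpenPartialHomeomorph.map_source hp₀, e.mem_source.2 (by
      change (e₀.toOpenPartialHomeomorph.symm (e₀.toOpenPartialHomeomorph p)).proj ∈ _
      rwa [e₀.toOpenPartialHomeomorph.left_inv hp₀])⟩
  have h1 := ((contMDiffOn_transition_prod (n := n) (F := F) e₀ e).contMDiffAt
    ((OpenPartialHomeomorph.open_source _).mem_nhds hmem)).comp p (contMDiffAt_trivializationAt p)
  refine h1.congr_of_eventuallyEq ?_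
  filter_upwards [e₀.open_source.mem_nhds hp₀] with q hq
  exact congrArg e (e₀.toOpenPartialHomeomorph.left_inv hq).symm

theorem contMDiffAt_trivialization_symm [SmoothPrincipalBundle n F G E] [IsManifold (𝓡 n) ∞ B]
    (e : Trivialization G (π G E)) [MemTrivializationAtlas e] {z : B × G}
    (hz : z.1 ∈ e.baseSet) :
    ContMDiffAt ((𝓡 n).prod 𝓘(ℝ, F)) ((𝓡 n).prod 𝓘(ℝ, F)) ∞
      e.toOpenPartialHomeomorph.symm z := by
  have hz' : z ∈ e.target := e.mem_target.2 hz
  set p := e.toOpenPartialHomeomorph.symm z with hpz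
  have hpe : p ∈ e.source := e.toOpenPartialHomeomorph.map_target hz'
  set e₀ := trivializationAt G E p.proj with he₀
  have hp₀ : p ∈ e₀.source := FiberBundle.mem_trivializationAt_proj_source
  have hmem : z ∈ (e.toOpenPartialHomeomorph.symm.trans e₀.toOpenPartialHomeomorph).source :=
    ⟨hz', hp₀⟩
  have h1 := ContMDiffAt.comp z (contMDiffAt_trivializationAt_symm p)
    ((contMDiffOn_transition_prod (n := n) (F := F) e e₀).contMDiffAt
      ((OpenPartialHomeomorph.open_source _).mem_nhds hmem))
  refine h1.congr_of_eventuallyEq ?_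
  filter_upwards [(OpenPartialHomeomorph.open_source _).mem_nhds hmem] with q hq
  exact (e₀.toOpenPartialHomeomorph.left_inv hq.2).symm

theorem contMDiffAt_totalSpace_of_trivialization [SmoothPrincipalBundle n F G E]
    [IsManifold (𝓡 n) ∞ B]
    {V H M : Type*} [NormedAddCommGroup V] [NormedSpace ℝ V] [TopologicalSpace H]
    {J : ModelWithCorners ℝ V H} [TopologicalSpace M] [ChartedSpace H M]
    {f : M → TotalSpace G E} {x : M} (e : Trivialization G (π G E)) [MemTrivializationAtlas e]
    (hs : ∀ᶠ y in 𝓝 x, (f y).proj ∈ e.baseSet)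
    (h : ContMDiffAt J ((𝓡 n).prod 𝓘(ℝ, F)) ∞ (fun y => e (f y)) x) :
    ContMDiffAt J ((𝓡 n).prod 𝓘(ℝ, F)) ∞ f x := by
  have hx := hs.self_of_nhds
  have h2 := ContMDiffAt.comp x (contMDiffAt_trivialization_symm (n := n) (F := F) e
    (z := e (f x)) (by rwa [e.coe_fst' hx])) h
  refine h2.congr_of_eventuallyEq ?_
  filter_upwards [hs] with y hy
  exact (e.toOpenPartialHomeomorph.left_inv (e.mem_source.2 hy)).symm

theorem contMDiff_totalSpace_proj [SmoothPrincipalBundle n F G E] [IsManifold (𝓡 n) ∞ B] :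
    ContMDiff ((𝓡 n).prod 𝓘(ℝ, F)) (𝓡 n) ∞ (π G E) := by
  intro p
  have h := (contMDiffAt_trivialization (n := n) (F := F) (trivializationAt G E p.proj)
    (mem_baseSet_trivializationAt G E p.proj)).fst
  refine h.congr_of_eventuallyEq ?_
  filter_upwards [(trivializationAt G E p.proj).open_source.mem_nhds
    FiberBundle.mem_trivializationAt_proj_source] with q hq
  exact ((trivializationAt G E p.proj).coe_fst hq).symm

theorem contMDiff_rightMul [SmoothPrincipalBundle n F G E] [IsManifold (𝓡 n) ∞ B] (g : G) :
    ContMDiff ((𝓡 n).prod 𝓘(ℝ, F)) ((𝓡 n).prod 𝓘(ℝ, F)) ∞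
      (rightMul g : TotalSpace G E → TotalSpace G E) := by
  intro p
  set e := trivializationAt G E p.proj with he
  have hp : p.proj ∈ e.baseSet := mem_baseSet_trivializationAt G E p.proj
  have hs : ∀ᶠ q : TotalSpace G E in 𝓝 p, q.proj ∈ e.baseSet := by
    filter_upwards [e.open_source.mem_nhds (e.mem_source.2 hp)] with q hq
    exact e.mem_source.1 hq
  refine contMDiffAt_totalSpace_of_trivialization e hs ?_
  have h := contMDiffAt_trivialization (n := n) (F := F) e hp
  refine (h.fst.prodMk (h.snd.mul (contMDiffAt_const (c := g)))).congr_of_eventuallyEq ?_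
  filter_upwards [hs] with q hq
  exact trivialization_rightMul_eq n F e hq g

theorem contMDiff_orbitMap [SmoothPrincipalBundle n F G E] [IsManifold (𝓡 n) ∞ B]
    (p : TotalSpace G E) :
    ContMDiff 𝓘(ℝ, F) ((𝓡 n).prod 𝓘(ℝ, F)) ∞ (fun g : G => rightMul g p) := by
  intro g
  set e := trivializationAt G E p.proj with he
  have hp : p.proj ∈ e.baseSet := mem_baseSet_trivializationAt G E p.proj
  refine contMDiffAt_totalSpace_of_trivialization e (Filter.Eventually.of_forall fun _ => hp) ?_
  simp only [trivialization_rightMul_eq n F e hp]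
  exact contMDiffAt_const.prodMk (contMDiffAt_const.mul contMDiffAt_id)

variable (n F) in
theorem exists_contMDiffAt_section [SmoothPrincipalBundle n F G E] [IsManifold (𝓡 n) ∞ B]
    (p : TotalSpace G E) :
    ∃ s : B → TotalSpace G E, s p.proj = p ∧ (∀ᶠ x in 𝓝 p.proj, (s x).proj = x) ∧
      ContMDiffAt (𝓡 n) ((𝓡 n).prod 𝓘(ℝ, F)) ∞ s p.proj := by
  set e := trivializationAt G E p.proj with he
  have hp : p.proj ∈ e.baseSet := mem_baseSet_trivializationAt G E p.proj
  refine ⟨fun x => e.toOpenPartialHomeomorph.symm (x, (e p).2), ?_, ?_, ?_⟩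
  · have : (p.proj, (e p).2) = e p := by ext <;> simp [e.coe_fst' hp]
    simp only [this]
    exact e.toOpenPartialHomeomorph.left_inv (e.mem_source.2 hp)
  · filter_upwards [e.open_baseSet.mem_nhds hp] with x hx
    exact e.proj_symm_apply' hx
  · exact (contMDiffAt_trivialization_symm (n := n) (F := F) e
      (z := (p.proj, (e p).2)) hp).comp p.proj (contMDiffAt_id.prodMk contMDiffAt_const)

end TotalSpaceManifold

/-! ## Horizontal vectors and the existence of the curvature form -/

theorem rightMul_one {B G : Type*} [Group G] {E : B → Type*} [∀ x, MulAction Gᵐᵒᵖ (E x)]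
    (p : TotalSpace G E) : rightMul (1 : G) p = p := by
  simp [rightMul]

section Horizontal

variable {n : ℕ} {F : Type*} [NormedAddCommGroup F] [NormedSpace ℝ F]
  {B : Type*} [TopologicalSpace B] [ChartedSpace (EuclideanSpace ℝ (Fin n)) B]
  {G : Type*} [TopologicalSpace G] [ChartedSpace F G] [Group G]
  {E : B → Type*} [TopologicalSpace (TotalSpace G E)] [∀ x, TopologicalSpace (E x)]
  [FiberBundle G E] [∀ x, MulAction Gᵐᵒᵖ (E x)]

/-- `fundamentalVector` as a linear map. -/
def fundamentalMap (n : ℕ) [ChartedSpace (EuclideanSpace ℝ (Fin n)) B] (p : TotalSpace G E) :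
    GroupLieAlgebra 𝓘(ℝ, F) G →L[ℝ] TangentSpace ((𝓡 n).prod 𝓘(ℝ, F)) p :=
  (mfderiv 𝓘(ℝ, F) ((𝓡 n).prod 𝓘(ℝ, F)) (fun g : G => rightMul g p) 1 :
    F →L[ℝ] EuclideanSpace ℝ (Fin n) × F)

/-- `horizontalPart` as a linear map. -/
def horizontalMap (A : LieValuedForm n F G E) (p : TotalSpace G E) :
    TangentSpace ((𝓡 n).prod 𝓘(ℝ, F)) p →L[ℝ] TangentSpace ((𝓡 n).prod 𝓘(ℝ, F)) p :=
  ContinuousLinearMap.id ℝ _ - (fundamentalMap n p).comp (A p)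

theorem horizontalMap_apply (A : LieValuedForm n F G E) (p : TotalSpace G E)
    (u : TangentSpace ((𝓡 n).prod 𝓘(ℝ, F)) p) :
    horizontalMap A p u = horizontalPart A p u := rfl

/-- Points such as `p · 1` and `p` are equal without being syntactically so; their tangent spaces
are compared inside the common model space. -/
theorem mfderiv_apply_congr_point {V H M V' H' M' : Type*} [NormedAddCommGroup V]
    [NormedSpace ℝ V] [TopologicalSpace H] [TopologicalSpace M] [ChartedSpace H M]
    [NormedAddCommGroup V'] [NormedSpace ℝ V'] [TopologicalSpace H'] [TopologicalSpace M']
    [ChartedSpace H' M'] (I : ModelWithCorners ℝ V H) (I' : ModelWithCorners ℝ V' H')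
    (f : M → M') {x y : M} (h : x = y) (v : V) :
    (show V' from mfderiv I I' f x v) = (show V' from mfderiv I I' f y v) := by
  subst h; rfl

variable [LieGroup 𝓘(ℝ, F) ∞ G] [IsManifold (𝓡 n) ∞ B]

theorem mfderiv_proj_fundamentalVector [SmoothPrincipalBundle n F G E] (p : TotalSpace G E)
    (X : GroupLieAlgebra 𝓘(ℝ, F) G) :
    mfderiv ((𝓡 n).prod 𝓘(ℝ, F)) (𝓡 n) (π G E) p (fundamentalVector n p X) = 0 := by
  have h := mfderiv_comp (I := 𝓘(ℝ, F)) (I' := (𝓡 n).prod 𝓘(ℝ, F)) (I'' := 𝓡 n) (1 : G)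
    (g := π G E) (f := fun g : G => rightMul g p)
    ((contMDiff_totalSpace_proj (n := n) (F := F)).mdifferentiableAt (by simp))
    ((contMDiff_orbitMap (n := n) (F := F) p).mdifferentiableAt (by simp))
  have hc : (π G E) ∘ (fun g : G => rightMul g p) = fun _ => p.proj := rfl
  rw [hc, mfderiv_const] at h
  have h2 := DFunLike.congr_fun h X
  exact (mfderiv_apply_congr_point ((𝓡 n).prod 𝓘(ℝ, F)) (𝓡 n) (π G E) (rightMul_one p)
    _).symm.trans h2.symm

variable (n F) in
theorem mfderiv_proj_surjective [SmoothPrincipalBundle n F G E] (p : TotalSpace G E) :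
    Function.Surjective (mfderiv ((𝓡 n).prod 𝓘(ℝ, F)) (𝓡 n) (π G E) p) := by
  obtain ⟨s, hs, hsx, hsm⟩ := exists_contMDiffAt_section n F p
  intro v
  have h := mfderiv_comp (I := 𝓡 n) (I' := (𝓡 n).prod 𝓘(ℝ, F)) (I'' := 𝓡 n) p.proj
    (g := π G E) (f := s)
    ((contMDiff_totalSpace_proj (n := n) (F := F)).mdifferentiableAt (by simp))
    (hsm.mdifferentiableAt (by simp))
  have hc : mfderiv (𝓡 n) (𝓡 n) ((π G E) ∘ s) p.proj = mfderiv (𝓡 n) (𝓡 n) id p.proj :=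
    Filter.EventuallyEq.mfderiv_eq hsx
  rw [hc, mfderiv_id] at h
  have h2 := DFunLike.congr_fun h v
  exact ⟨_, (mfderiv_apply_congr_point ((𝓡 n).prod 𝓘(ℝ, F)) (𝓡 n) (π G E) hs _).symm.trans
    h2.symm⟩

/-- Fundamental vectors are vertical, and the connection makes the map from the Lie algebra
injective. Since `dπ` is onto, its kernel has the dimension of `F`, so the inclusion is an equality.
-/
theorem exists_fundamentalVector_eq [FiniteDimensional ℝ F] [SmoothPrincipalBundle n F G E]
    {A : LieValuedForm n F G E} (hA : IsConnection A) (p : TotalSpace G E)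
    {u : TangentSpace ((𝓡 n).prod 𝓘(ℝ, F)) p}
    (hu : mfderiv ((𝓡 n).prod 𝓘(ℝ, F)) (𝓡 n) (π G E) p u = 0) :
    ∃ X, fundamentalVector n p X = u := by
  let D : (EuclideanSpace ℝ (Fin n) × F) →ₗ[ℝ] EuclideanSpace ℝ (Fin n) :=
    (mfderiv ((𝓡 n).prod 𝓘(ℝ, F)) (𝓡 n) (π G E) p).toLinearMap
  let φ : F →ₗ[ℝ] (EuclideanSpace ℝ (Fin n) × F) :=
    (fundamentalMap (F := F) n p).toLinearMap
  have hφ : Function.Injective φ := fun X Y h => by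
    have h2 := congrArg (A p) (show fundamentalVector n p X = fundamentalVector n p Y from h)
    exact (hA.fundamental p X).symm.trans (h2.trans (hA.fundamental p Y))
  have hle : LinearMap.range φ ≤ LinearMap.ker D := by
    rintro _ ⟨X, rfl⟩
    exact mfderiv_proj_fundamentalVector p X
  have hD : LinearMap.range D = ⊤ := LinearMap.range_eq_top.2 (mfderiv_proj_surjective n F p)
  have hdim := LinearMap.finrank_range_add_finrank_ker D
  rw [hD, finrank_top, Module.finrank_prod] at hdim
  have heq := Submodule.eq_of_le_of_finrank_eq hle (by
    rw [LinearMap.finrank_range_of_inj hφ]; omega)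
  have hmem : (u : EuclideanSpace ℝ (Fin n) × F) ∈ LinearMap.ker D := hu
  rw [← heq] at hmem
  exact hmem

theorem horizontalPart_eq_of_mfderiv_proj_eq [FiniteDimensional ℝ F]
    [SmoothPrincipalBundle n F G E] {A : LieValuedForm n F G E} (hA : IsConnection A)
    (p : TotalSpace G E) {u v : TangentSpace ((𝓡 n).prod 𝓘(ℝ, F)) p}
    (h : mfderiv ((𝓡 n).prod 𝓘(ℝ, F)) (𝓡 n) (π G E) p u =
      mfderiv ((𝓡 n).prod 𝓘(ℝ, F)) (𝓡 n) (π G E) p v) :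
    horizontalPart A p u = horizontalPart A p v := by
  obtain ⟨X, hX⟩ := exists_fundamentalVector_eq hA p (u := u - v) (by rw [map_sub, h, sub_self])
  have h0 : horizontalMap A p (u - v) = 0 := by
    rw [← hX, horizontalMap_apply, horizontalPart, hA.fundamental, sub_self]
  rw [map_sub, sub_eq_zero] at h0
  exact h0

/-- The horizontal part of a vector depends only on its projection, so `dA` on horizontal parts
descends through any linear right inverse `s` of `dπ`. -/
theorem exists_isCurvatureAt [FiniteDimensional ℝ F] [SmoothPrincipalBundle n F G E]
    {A : LieValuedForm n F G E} (hA : IsConnection A) (p : TotalSpace G E) :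
    ∃ β, IsCurvatureAt A p β := by
  obtain ⟨s, hs⟩ := LinearMap.exists_rightInverse_of_surjective
    (mfderiv ((𝓡 n).prod 𝓘(ℝ, F)) (𝓡 n) (π G E) p).toLinearMap
    (LinearMap.range_eq_top.2 (mfderiv_proj_surjective n F p))
  let η : (EuclideanSpace ℝ (Fin n) × F) [⋀^Fin 2]→ₗ[ℝ] F :=
    (extDeriv (formInChart A p) (extChartAt ((𝓡 n).prod 𝓘(ℝ, F)) p p)).toAlternatingMap
  let D : TangentSpace (𝓡 n) p.proj →ₗ[ℝ] EuclideanSpace ℝ (Fin n) × F :=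
    ((mfderiv ((𝓡 n).prod 𝓘(ℝ, F)) 𝓘(ℝ, EuclideanSpace ℝ (Fin n) × F)
        (extChartAt ((𝓡 n).prod 𝓘(ℝ, F)) p) p).toLinearMap ∘ₗ
        (horizontalMap A p).toLinearMap) ∘ₗ s
  refine ⟨η.compLinearMap D, fun u v => ?_⟩
  have key : ∀ u, D (mfderiv ((𝓡 n).prod 𝓘(ℝ, F)) (𝓡 n) (π G E) p u) =
      mfderiv ((𝓡 n).prod 𝓘(ℝ, F)) 𝓘(ℝ, EuclideanSpace ℝ (Fin n) × F)
        (extChartAt ((𝓡 n).prod 𝓘(ℝ, F)) p) p (horizontalPart A p u) := fun u =>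
    congrArg (mfderiv ((𝓡 n).prod 𝓘(ℝ, F)) 𝓘(ℝ, EuclideanSpace ℝ (Fin n) × F)
        (extChartAt ((𝓡 n).prod 𝓘(ℝ, F)) p) p)
      (horizontalPart_eq_of_mfderiv_proj_eq hA p (LinearMap.congr_fun hs _))
  have hv : (fun i => D (![mfderiv ((𝓡 n).prod 𝓘(ℝ, F)) (𝓡 n) (π G E) p u,
      mfderiv ((𝓡 n).prod 𝓘(ℝ, F)) (𝓡 n) (π G E) p v] i)) =
      ![mfderiv ((𝓡 n).prod 𝓘(ℝ, F)) 𝓘(ℝ, EuclideanSpace ℝ (Fin n) × F)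
          (extChartAt ((𝓡 n).prod 𝓘(ℝ, F)) p) p (horizontalPart A p u),
        mfderiv ((𝓡 n).prod 𝓘(ℝ, F)) 𝓘(ℝ, EuclideanSpace ℝ (Fin n) × F)
          (extChartAt ((𝓡 n).prod 𝓘(ℝ, F)) p) p (horizontalPart A p v)] := by
    funext i
    fin_cases i
    · exact key u
    · exact key v
  exact (congrArg η hv).symm

theorem IsCurvatureAt.unique [SmoothPrincipalBundle n F G E] {A : LieValuedForm n F G E}
    {p : TotalSpace G E}
    {β β' : TangentSpace (𝓡 n) p.proj [⋀^Fin 2]→ₗ[ℝ] GroupLieAlgebra 𝓘(ℝ, F) G}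
    (h : IsCurvatureAt A p β) (h' : IsCurvatureAt A p β') : β = β' := by
  ext v
  obtain ⟨u₀, h₀⟩ := mfderiv_proj_surjective n F p (v 0)
  obtain ⟨u₁, h₁⟩ := mfderiv_proj_surjective n F p (v 1)
  have hv : v = ![v 0, v 1] := by
    funext i
    fin_cases i <;> rfl
  rw [hv, ← h₀, ← h₁, ← h u₀ u₁, ← h' u₀ u₁]

end Horizontal

/-! ## Pulling back connection forms and their curvature -/

section PullbackForm

variable {m n : ℕ} {F : Type*} [NormedAddCommGroup F] [NormedSpace ℝ F]
  {B : Type*} [TopologicalSpace B] [ChartedSpace (EuclideanSpace ℝ (Fin n)) B]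
  {B' : Type*} [TopologicalSpace B'] [ChartedSpace (EuclideanSpace ℝ (Fin m)) B']
  {G : Type*} [TopologicalSpace G] [ChartedSpace F G] [Group G]
  {E : B → Type*} [TopologicalSpace (TotalSpace G E)] [∀ x, TopologicalSpace (E x)]
  [FiberBundle G E]
  {E' : B' → Type*} [TopologicalSpace (TotalSpace G E')] [∀ x, TopologicalSpace (E' x)]
  [FiberBundle G E']

/-! ### Pullback of 1-forms and of their exterior derivatives in charts -/

section Charts

variable [IsManifold ((𝓡 n).prod 𝓘(ℝ, F)) ∞ (TotalSpace G E)]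
  [IsManifold ((𝓡 m).prod 𝓘(ℝ, F)) ∞ (TotalSpace G E')]
  {Φ : TotalSpace G E' → TotalSpace G E}

variable (n m F) in
/-- The coordinate expression of a map between total spaces. -/
def coordExpression (Φ : TotalSpace G E' → TotalSpace G E) (q : TotalSpace G E')
    (p : TotalSpace G E) : EuclideanSpace ℝ (Fin m) × F → EuclideanSpace ℝ (Fin n) × F :=
  extChartAt ((𝓡 n).prod 𝓘(ℝ, F)) p ∘ Φ ∘ (extChartAt ((𝓡 m).prod 𝓘(ℝ, F)) q).symm

omit [Group G] [IsManifold ((𝓡 n).prod 𝓘(ℝ, F)) ∞ (TotalSpace G E)] in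
theorem contMDiffAt_comp_extChartAt_symm
    (hΦ : ContMDiff ((𝓡 m).prod 𝓘(ℝ, F)) ((𝓡 n).prod 𝓘(ℝ, F)) ∞ Φ) (q : TotalSpace G E')
    {z : EuclideanSpace ℝ (Fin m) × F} (hz : z ∈ (extChartAt ((𝓡 m).prod 𝓘(ℝ, F)) q).target) :
    ContMDiffAt 𝓘(ℝ, EuclideanSpace ℝ (Fin m) × F) ((𝓡 n).prod 𝓘(ℝ, F)) ∞
      (Φ ∘ (extChartAt ((𝓡 m).prod 𝓘(ℝ, F)) q).symm) z :=
  (hΦ _).comp z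
    ((contMDiffOn_extChartAt_symm q).contMDiffAt ((isOpen_extChartAt_target q).mem_nhds hz))

omit [Group G] in
theorem contDiffAt_coordExpression
    (hΦ : ContMDiff ((𝓡 m).prod 𝓘(ℝ, F)) ((𝓡 n).prod 𝓘(ℝ, F)) ∞ Φ) (q : TotalSpace G E')
    (p : TotalSpace G E) {z : EuclideanSpace ℝ (Fin m) × F}
    (hz : z ∈ (extChartAt ((𝓡 m).prod 𝓘(ℝ, F)) q).target)
    (hp : Φ ((extChartAt ((𝓡 m).prod 𝓘(ℝ, F)) q).symm z) ∈
      (extChartAt ((𝓡 n).prod 𝓘(ℝ, F)) p).source) :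
    ContDiffAt ℝ ∞ (coordExpression m n F Φ q p) z := by
  rw [← contMDiffAt_iff_contDiffAt]
  rw [extChartAt_source] at hp
  exact (contMDiffAt_extChartAt' hp).comp z (contMDiffAt_comp_extChartAt_symm hΦ q hz)

/-- In coordinates this is the chain rule for `χ ∘ φ = Φ ∘ ψ`, where `ψ` and `χ` are inverse charts
and `φ` is the coordinate expression; the identity holds near `z`, so it can be differentiated. -/
theorem formInChart_pullback {A : LieValuedForm n F G E} {A' : LieValuedForm m F G E'}
    (hΦ : ContMDiff ((𝓡 m).prod 𝓘(ℝ, F)) ((𝓡 n).prod 𝓘(ℝ, F)) ∞ Φ)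
    (hA' : ∀ q, A' q =
      (A (Φ q)).comp (mfderiv ((𝓡 m).prod 𝓘(ℝ, F)) ((𝓡 n).prod 𝓘(ℝ, F)) Φ q))
    (q : TotalSpace G E') (p : TotalSpace G E) {z : EuclideanSpace ℝ (Fin m) × F}
    (hz : z ∈ (extChartAt ((𝓡 m).prod 𝓘(ℝ, F)) q).target)
    (hp : Φ ((extChartAt ((𝓡 m).prod 𝓘(ℝ, F)) q).symm z) ∈
      (extChartAt ((𝓡 n).prod 𝓘(ℝ, F)) p).source) :
    formInChart A' q z = (formInChart A p (coordExpression m n F Φ q p z)).compContinuousLinearMap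
      (fderiv ℝ (coordExpression m n F Φ q p) z) := by
  set ψ := (extChartAt ((𝓡 m).prod 𝓘(ℝ, F)) q).symm with hψ
  set χ := (extChartAt ((𝓡 n).prod 𝓘(ℝ, F)) p).symm with hχ
  set φ := coordExpression m n F Φ q p with hφ
  have hsm := contMDiffAt_comp_extChartAt_symm hΦ q hz
  have hχφ : χ (φ z) = Φ (ψ z) := (extChartAt ((𝓡 n).prod 𝓘(ℝ, F)) p).left_inv hp
  have hev : χ ∘ φ =ᶠ[𝓝 z] Φ ∘ ψ := by
    filter_upwards [hsm.continuousAt.preimage_mem_nhds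
      ((isOpen_extChartAt_source p).mem_nhds hp)] with y hy
    exact (extChartAt ((𝓡 n).prod 𝓘(ℝ, F)) p).left_inv hy
  have htarget : φ z ∈ (extChartAt ((𝓡 n).prod 𝓘(ℝ, F)) p).target :=
    (extChartAt ((𝓡 n).prod 𝓘(ℝ, F)) p).map_source hp
  have hχd : MDifferentiableAt 𝓘(ℝ, EuclideanSpace ℝ (Fin n) × F) ((𝓡 n).prod 𝓘(ℝ, F)) χ (φ z) :=
    ((contMDiffOn_extChartAt_symm (n := ∞) p).contMDiffAt
      ((isOpen_extChartAt_target p).mem_nhds htarget)).mdifferentiableAt (by simp)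
  have hψd : MDifferentiableAt 𝓘(ℝ, EuclideanSpace ℝ (Fin m) × F) ((𝓡 m).prod 𝓘(ℝ, F)) ψ z :=
    ((contMDiffOn_extChartAt_symm (n := ∞) q).contMDiffAt
      ((isOpen_extChartAt_target q).mem_nhds hz)).mdifferentiableAt (by simp)
  have hφd : MDifferentiableAt 𝓘(ℝ, EuclideanSpace ℝ (Fin m) × F)
      𝓘(ℝ, EuclideanSpace ℝ (Fin n) × F) φ z :=
    ((contDiffAt_coordExpression hΦ q p hz hp).differentiableAt (by simp)).mdifferentiableAt
  have h1 := mfderiv_comp z hχd hφd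
  have h2 := mfderiv_comp z ((hΦ (ψ z)).mdifferentiableAt (by simp)) hψd
  rw [hev.mfderiv_eq] at h1
  rw [mfderiv_eq_fderiv] at h1
  have hAcongr : ∀ (p₁ p₂ : TotalSpace G E), p₁ = p₂ → ∀ v : EuclideanSpace ℝ (Fin n) × F,
      (show F from A p₁ v) = (show F from A p₂ v) := by rintro _ _ rfl _; rfl
  ext v
  have h12 := DFunLike.congr_fun (h1.symm.trans h2) (v 0)
  change A' (ψ z) (mfderiv _ _ ψ z (v 0)) =
    A (χ (φ z)) (mfderiv _ _ χ (φ z) (fderiv ℝ φ z (v 0)))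
  rw [hA']
  exact ((hAcongr _ _ hχφ _).trans (congrArg (A (Φ (ψ z))) h12)).symm

theorem eventually_formInChart_pullback {A : LieValuedForm n F G E} {A' : LieValuedForm m F G E'}
    (hΦ : ContMDiff ((𝓡 m).prod 𝓘(ℝ, F)) ((𝓡 n).prod 𝓘(ℝ, F)) ∞ Φ)
    (hA' : ∀ q, A' q =
      (A (Φ q)).comp (mfderiv ((𝓡 m).prod 𝓘(ℝ, F)) ((𝓡 n).prod 𝓘(ℝ, F)) Φ q))
    (q : TotalSpace G E') (p : TotalSpace G E) {z : EuclideanSpace ℝ (Fin m) × F}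
    (hz : z ∈ (extChartAt ((𝓡 m).prod 𝓘(ℝ, F)) q).target)
    (hp : Φ ((extChartAt ((𝓡 m).prod 𝓘(ℝ, F)) q).symm z) ∈
      (extChartAt ((𝓡 n).prod 𝓘(ℝ, F)) p).source) :
    formInChart A' q =ᶠ[𝓝 z] fun z =>
      (formInChart A p (coordExpression m n F Φ q p z)).compContinuousLinearMap
        (fderiv ℝ (coordExpression m n F Φ q p) z) := by
  filter_upwards [(isOpen_extChartAt_target q).mem_nhds hz,
    (contMDiffAt_comp_extChartAt_symm hΦ q hz).continuousAt.preimage_mem_nhds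
      ((isOpen_extChartAt_source p).mem_nhds hp)] with y hy hy'
  exact formInChart_pullback hΦ hA' q p hy hy'

theorem contDiffOn_formInChart_pullback {A : LieValuedForm n F G E}
    {A' : LieValuedForm m F G E'}
    (hΦ : ContMDiff ((𝓡 m).prod 𝓘(ℝ, F)) ((𝓡 n).prod 𝓘(ℝ, F)) ∞ Φ)
    (hA' : ∀ q, A' q =
      (A (Φ q)).comp (mfderiv ((𝓡 m).prod 𝓘(ℝ, F)) ((𝓡 n).prod 𝓘(ℝ, F)) Φ q))
    (hA : ∀ p : TotalSpace G E,
      ContDiffOn ℝ ∞ (formInChart A p) (extChartAt ((𝓡 n).prod 𝓘(ℝ, F)) p).target)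
    (q : TotalSpace G E') :
    ContDiffOn ℝ ∞ (formInChart A' q) (extChartAt ((𝓡 m).prod 𝓘(ℝ, F)) q).target := by
  intro z hz
  refine ContDiffAt.contDiffWithinAt ?_
  set p := Φ ((extChartAt ((𝓡 m).prod 𝓘(ℝ, F)) q).symm z) with hp
  have hps : p ∈ (extChartAt ((𝓡 n).prod 𝓘(ℝ, F)) p).source := mem_extChartAt_source p
  refine ContDiffAt.congr_of_eventuallyEq ?_
    (eventually_formInChart_pullback hΦ hA' q p hz hps)
  have hφ := contDiffAt_coordExpression hΦ q p hz hps
  have htarget : coordExpression m n F Φ q p z ∈ (extChartAt ((𝓡 n).prod 𝓘(ℝ, F)) p).target :=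
    (extChartAt ((𝓡 n).prod 𝓘(ℝ, F)) p).map_source hps
  have hform := ((hA p).contDiffAt ((isOpen_extChartAt_target p).mem_nhds htarget)).comp z hφ
  -- Treating 1-forms as linear maps turns the pullback into a composition, which is smooth in both
  -- factors.
  let L : ((EuclideanSpace ℝ (Fin n) × F) →L[ℝ] F) ≃ₗᵢ[ℝ] _ :=
    ContinuousAlternatingMap.ofSubsingletonLIE (0 : Fin 1)
  let L' : ((EuclideanSpace ℝ (Fin m) × F) →L[ℝ] F) ≃ₗᵢ[ℝ] _ :=
    ContinuousAlternatingMap.ofSubsingletonLIE (0 : Fin 1)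
  have h1 := L.symm.contDiff.contDiffAt.comp z hform
  have h2 : ContDiffAt ℝ ∞ (fderiv ℝ (coordExpression m n F Φ q p)) z :=
    hφ.fderiv_right (by simp)
  have h3 := L'.contDiff.contDiffAt.comp z (h1.clm_comp h2)
  refine h3.congr_of_eventuallyEq (Filter.Eventually.of_forall fun y => ?_)
  ext v
  change _ = (L.symm (formInChart A p (coordExpression m n F Φ q p y)))
    (fderiv ℝ (coordExpression m n F Φ q p) y (v 0))
  rw [← L.apply_symm_apply (formInChart A p (coordExpression m n F Φ q p y))]
  simp only [LinearIsometryEquiv.symm_apply_apply]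
  rfl

/-- The exterior derivative commutes with pullback along the coordinate expression; `hchain`
converts this to tangent vectors and so also makes the preferred charts on the two sides irrelevant.
-/
theorem extDerivForm_pullback {A : LieValuedForm n F G E}
    {A' : LieValuedForm m F G E'}
    (hΦ : ContMDiff ((𝓡 m).prod 𝓘(ℝ, F)) ((𝓡 n).prod 𝓘(ℝ, F)) ∞ Φ)
    (hA' : ∀ q, A' q =
      (A (Φ q)).comp (mfderiv ((𝓡 m).prod 𝓘(ℝ, F)) ((𝓡 n).prod 𝓘(ℝ, F)) Φ q))
    (hA : ∀ p : TotalSpace G E,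
      ContDiffOn ℝ ∞ (formInChart A p) (extChartAt ((𝓡 n).prod 𝓘(ℝ, F)) p).target)
    (q : TotalSpace G E') (u v : TangentSpace ((𝓡 m).prod 𝓘(ℝ, F)) q) :
    extDerivForm A' q u v =
      extDerivForm A (Φ q) (mfderiv ((𝓡 m).prod 𝓘(ℝ, F)) ((𝓡 n).prod 𝓘(ℝ, F)) Φ q u)
        (mfderiv ((𝓡 m).prod 𝓘(ℝ, F)) ((𝓡 n).prod 𝓘(ℝ, F)) Φ q v) := by
  set z := extChartAt ((𝓡 m).prod 𝓘(ℝ, F)) q q with hzdef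
  set φ := coordExpression m n F Φ q (Φ q) with hφdef
  have hz : z ∈ (extChartAt ((𝓡 m).prod 𝓘(ℝ, F)) q).target := mem_extChartAt_target q
  have hψz : (extChartAt ((𝓡 m).prod 𝓘(ℝ, F)) q).symm z = q := extChartAt_to_inv q
  have hps : Φ ((extChartAt ((𝓡 m).prod 𝓘(ℝ, F)) q).symm z) ∈
      (extChartAt ((𝓡 n).prod 𝓘(ℝ, F)) (Φ q)).source := by
    rw [hψz]; exact mem_extChartAt_source (Φ q)
  have hφ : ContDiffAt ℝ ∞ φ z := contDiffAt_coordExpression hΦ q (Φ q) hz hps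
  have hφz : φ z = extChartAt ((𝓡 n).prod 𝓘(ℝ, F)) (Φ q) (Φ q) := by
    simp only [hφdef, coordExpression, Function.comp_apply, hψz]
  have hd : DifferentiableAt ℝ (formInChart A (Φ q)) (φ z) := by
    rw [hφz]
    exact ((hA (Φ q)).contDiffAt (extChartAt_target_mem_nhds (Φ q))).differentiableAt (by simp)
  have hext : extDeriv (formInChart A' q) z =
      (extDeriv (formInChart A (Φ q)) (φ z)).compContinuousLinearMap (fderiv ℝ φ z) := by
    rw [(eventually_formInChart_pullback hΦ hA' q (Φ q) hz hps).extDeriv_eq]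
    exact extDeriv_pullback hd hφ (by
      rw [minSmoothness_of_isRCLikeNormedField]
      exact (WithTop.coe_le_coe.2 le_top : ((2 : ℕ∞) : ℕ∞ω) ≤ ∞))
  have hchain : ∀ w : TangentSpace ((𝓡 m).prod 𝓘(ℝ, F)) q,
      fderiv ℝ φ z (mfderiv ((𝓡 m).prod 𝓘(ℝ, F)) 𝓘(ℝ, EuclideanSpace ℝ (Fin m) × F)
        (extChartAt ((𝓡 m).prod 𝓘(ℝ, F)) q) q w) =
      mfderiv ((𝓡 n).prod 𝓘(ℝ, F)) 𝓘(ℝ, EuclideanSpace ℝ (Fin n) × F)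
        (extChartAt ((𝓡 n).prod 𝓘(ℝ, F)) (Φ q)) (Φ q)
        (mfderiv ((𝓡 m).prod 𝓘(ℝ, F)) ((𝓡 n).prod 𝓘(ℝ, F)) Φ q w) := by
    intro w
    have hev : φ ∘ extChartAt ((𝓡 m).prod 𝓘(ℝ, F)) q =ᶠ[𝓝 q]
        extChartAt ((𝓡 n).prod 𝓘(ℝ, F)) (Φ q) ∘ Φ := by
      filter_upwards [extChartAt_source_mem_nhds (I := (𝓡 m).prod 𝓘(ℝ, F)) q] with y hy
      simp only [hφdef, coordExpression, Function.comp_apply,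
        (extChartAt ((𝓡 m).prod 𝓘(ℝ, F)) q).left_inv hy]
    have h1 := mfderiv_comp q ((hφ.differentiableAt (by simp)).mdifferentiableAt)
      ((contMDiffAt_extChartAt (I := (𝓡 m).prod 𝓘(ℝ, F)) (n := ∞) (x := q)).mdifferentiableAt
        (by simp))
    have h2 := mfderiv_comp q
      ((contMDiffAt_extChartAt (I := (𝓡 n).prod 𝓘(ℝ, F)) (n := ∞) (x := Φ q)).mdifferentiableAt
        (by simp)) ((hΦ q).mdifferentiableAt (by simp))
    rw [hev.mfderiv_eq, mfderiv_eq_fderiv] at h1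
    exact DFunLike.congr_fun (h1.symm.trans h2) w
  rw [extDerivForm, extDerivForm, ← hzdef, hext, hφz]
  refine congrArg (extDeriv (formInChart A (Φ q))
    (extChartAt ((𝓡 n).prod 𝓘(ℝ, F)) (Φ q) (Φ q))) (funext fun i => ?_)
  fin_cases i
  · exact hchain u
  · exact hchain v

end Charts

end PullbackForm

/-! ## The pullback of a connection is a connection -/

section PullbackConnection

variable {m n : ℕ} {F : Type*} [NormedAddCommGroup F] [NormedSpace ℝ F]
  {B : Type*} [TopologicalSpace B] [ChartedSpace (EuclideanSpace ℝ (Fin n)) B]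
  [IsManifold (𝓡 n) ∞ B]
  {B' : Type*} [TopologicalSpace B'] [ChartedSpace (EuclideanSpace ℝ (Fin m)) B']
  [IsManifold (𝓡 m) ∞ B']
  {G : Type*} [TopologicalSpace G] [ChartedSpace F G] [Group G] [LieGroup 𝓘(ℝ, F) ∞ G]
  {E : B → Type*} [TopologicalSpace (TotalSpace G E)] [∀ x, TopologicalSpace (E x)]
  [FiberBundle G E] [∀ x, MulAction Gᵐᵒᵖ (E x)] [∀ x, Nonempty (E x)]
  [SmoothPrincipalBundle n F G E]

/-- In a trivialization of `E` and its pullback, the lift is `(x, g) ↦ (f x, g)`. -/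
theorem contMDiff_pullbackLift (f : C(B', B)) (hf : ContMDiff (𝓡 m) (𝓡 n) ∞ f) :
    ContMDiff ((𝓡 m).prod 𝓘(ℝ, F)) ((𝓡 n).prod 𝓘(ℝ, F)) ∞
      (Pullback.lift f : TotalSpace G (f *ᵖ E) → TotalSpace G E) := by
  have := SmoothPrincipalBundle.pullback (F := F) (G := G) (E := E) f hf
  intro q
  set e := trivializationAt G E (f q.proj) with he
  have : MemTrivializationAtlas (e.pullback f) := ⟨⟨e, inferInstance, rfl⟩⟩
  have hq : q.proj ∈ (e.pullback f).baseSet := mem_baseSet_trivializationAt G E (f q.proj)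
  have hs : ∀ᶠ y in 𝓝 q, (Pullback.lift f y).proj ∈ e.baseSet := by
    filter_upwards [(e.pullback f).open_source.mem_nhds ((e.pullback f).mem_source.2 hq)] with y hy
    exact (e.pullback f).mem_source.1 hy
  refine contMDiffAt_totalSpace_of_trivialization e hs ?_
  have h1 := contMDiffAt_trivialization (n := m) (F := F) (e.pullback f) hq
  have h2 : ContMDiffAt ((𝓡 m).prod 𝓘(ℝ, F)) (𝓡 n) ∞
      (fun y : TotalSpace G (f *ᵖ E) => f y.proj) q :=
    (hf _).comp q (contMDiff_totalSpace_proj (n := m) (F := F) q)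
  refine (h2.prodMk h1.snd).congr_of_eventuallyEq ?_
  filter_upwards [hs] with y hy
  ext
  · exact e.coe_fst' hy
  · rfl

variable {f : C(B', B)} (hf : ContMDiff (𝓡 m) (𝓡 n) ∞ f) {A : LieValuedForm n F G E}

include hf

theorem mfderiv_pullbackLift_fundamentalVector (q : TotalSpace G (f *ᵖ E))
    (X : GroupLieAlgebra 𝓘(ℝ, F) G) :
    mfderiv ((𝓡 m).prod 𝓘(ℝ, F)) ((𝓡 n).prod 𝓘(ℝ, F))
      (Pullback.lift f : TotalSpace G (f *ᵖ E) → TotalSpace G E) q (fundamentalVector m q X) =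
      fundamentalVector n (Pullback.lift f q) X := by
  have := SmoothPrincipalBundle.pullback (F := F) (G := G) (E := E) f hf
  have h := mfderiv_comp (I := 𝓘(ℝ, F)) (I' := (𝓡 m).prod 𝓘(ℝ, F))
    (I'' := (𝓡 n).prod 𝓘(ℝ, F)) (1 : G)
    (g := (Pullback.lift f : TotalSpace G (f *ᵖ E) → TotalSpace G E))
    (f := fun g : G => rightMul g q)
    ((contMDiff_pullbackLift (F := F) f hf).mdifferentiableAt (by simp))
    ((contMDiff_orbitMap (n := m) (F := F) q).mdifferentiableAt (by simp))
  exact (mfderiv_apply_congr_point ((𝓡 m).prod 𝓘(ℝ, F)) ((𝓡 n).prod 𝓘(ℝ, F))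
    (Pullback.lift f : TotalSpace G (f *ᵖ E) → TotalSpace G E) (rightMul_one q) _).symm.trans
    (DFunLike.congr_fun h X).symm

theorem mfderiv_pullbackLift_rightMul (g : G) (q : TotalSpace G (f *ᵖ E))
    (u : TangentSpace ((𝓡 m).prod 𝓘(ℝ, F)) q) :
    mfderiv ((𝓡 m).prod 𝓘(ℝ, F)) ((𝓡 n).prod 𝓘(ℝ, F))
      (Pullback.lift f : TotalSpace G (f *ᵖ E) → TotalSpace G E) (rightMul g q)
      (mfderiv ((𝓡 m).prod 𝓘(ℝ, F)) ((𝓡 m).prod 𝓘(ℝ, F)) (rightMul g) q u) =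
    mfderiv ((𝓡 n).prod 𝓘(ℝ, F)) ((𝓡 n).prod 𝓘(ℝ, F)) (rightMul g) (Pullback.lift f q)
      (mfderiv ((𝓡 m).prod 𝓘(ℝ, F)) ((𝓡 n).prod 𝓘(ℝ, F))
        (Pullback.lift f : TotalSpace G (f *ᵖ E) → TotalSpace G E) q u) := by
  have := SmoothPrincipalBundle.pullback (F := F) (G := G) (E := E) f hf
  have hΦ := contMDiff_pullbackLift (F := F) (G := G) (E := E) f hf
  have h1 := mfderiv_comp q (hΦ.mdifferentiableAt (by simp))
    ((contMDiff_rightMul (n := m) (F := F) (E := f *ᵖ E) g).mdifferentiableAt (by simp))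
  have h2 := mfderiv_comp q
    ((contMDiff_rightMul (n := n) (F := F) (E := E) g).mdifferentiableAt (by simp))
    (hΦ.mdifferentiableAt (x := q) (by simp))
  exact DFunLike.congr_fun (h1.symm.trans h2) u

theorem mfderiv_proj_pullbackLift (q : TotalSpace G (f *ᵖ E))
    (u : TangentSpace ((𝓡 m).prod 𝓘(ℝ, F)) q) :
    mfderiv ((𝓡 n).prod 𝓘(ℝ, F)) (𝓡 n) (π G E) (Pullback.lift f q)
      (mfderiv ((𝓡 m).prod 𝓘(ℝ, F)) ((𝓡 n).prod 𝓘(ℝ, F))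
        (Pullback.lift f : TotalSpace G (f *ᵖ E) → TotalSpace G E) q u) =
    mfderiv (𝓡 m) (𝓡 n) f q.proj
      (mfderiv ((𝓡 m).prod 𝓘(ℝ, F)) (𝓡 m) (π G (f *ᵖ E)) q u) := by
  have := SmoothPrincipalBundle.pullback (F := F) (G := G) (E := E) f hf
  have h1 := mfderiv_comp q
    ((contMDiff_totalSpace_proj (n := n) (F := F) (E := E)).mdifferentiableAt (by simp))
    ((contMDiff_pullbackLift (F := F) (G := G) (E := E) f hf).mdifferentiableAt (x := q) (by simp))
  have h2 := mfderiv_comp q (hf.mdifferentiableAt (by simp))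
    ((contMDiff_totalSpace_proj (n := m) (F := F) (E := f *ᵖ E)).mdifferentiableAt (by simp))
  exact DFunLike.congr_fun (h1.symm.trans h2) u

theorem IsConnection.pullback [SmoothPrincipalBundle m F G (f *ᵖ E)] (hA : IsConnection A) :
    IsConnection (pullbackForm (m := m) f A) where
  smooth := by
    have := isManifold_totalSpace n F G E
    have := isManifold_totalSpace m F G (f *ᵖ E)
    exact contDiffOn_formInChart_pullback (contMDiff_pullbackLift f hf) (fun _ => rfl) hA.smooth
  equivariant p g u :=
    (congrArg (A (Pullback.lift f (rightMul g p)))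
      (mfderiv_pullbackLift_rightMul hf g p u)).trans
      (hA.equivariant (Pullback.lift f p) g _)
  fundamental p X :=
    (congrArg (A (Pullback.lift f p)) (mfderiv_pullbackLift_fundamentalVector hf p X)).trans
      (hA.fundamental _ X)

/-- Because the lift respects fundamental vectors, its differential intertwines the two horizontal
projections (`hor`); the rest is naturality of `d`. -/
theorem curvature_pullbackForm (hA : IsConnection A) (q : TotalSpace G (f *ᵖ E))
    (u v : TangentSpace ((𝓡 m).prod 𝓘(ℝ, F)) q) :
    curvature (pullbackForm (m := m) f A) q u v =
      curvature A (Pullback.lift f q)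
        (mfderiv ((𝓡 m).prod 𝓘(ℝ, F)) ((𝓡 n).prod 𝓘(ℝ, F)) (Pullback.lift f) q u)
        (mfderiv ((𝓡 m).prod 𝓘(ℝ, F)) ((𝓡 n).prod 𝓘(ℝ, F)) (Pullback.lift f) q v) := by
  have := SmoothPrincipalBundle.pullback (F := F) (G := G) (E := E) f hf
  have := isManifold_totalSpace n F G E
  have := isManifold_totalSpace m F G (f *ᵖ E)
  have hor : ∀ w : TangentSpace ((𝓡 m).prod 𝓘(ℝ, F)) q,
      mfderiv ((𝓡 m).prod 𝓘(ℝ, F)) ((𝓡 n).prod 𝓘(ℝ, F))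
        (Pullback.lift f : TotalSpace G (f *ᵖ E) → TotalSpace G E) q
        (horizontalPart (pullbackForm (m := m) f A) q w) =
      horizontalPart A (Pullback.lift f q)
        (mfderiv ((𝓡 m).prod 𝓘(ℝ, F)) ((𝓡 n).prod 𝓘(ℝ, F)) (Pullback.lift f) q w) := by
    intro w
    rw [horizontalPart, map_sub, mfderiv_pullbackLift_fundamentalVector hf]
    rfl
  rw [curvature, curvature, extDerivForm_pullback (A' := pullbackForm (m := m) f A)
    (contMDiff_pullbackLift f hf) (fun _ => rfl) hA.smooth, hor, hor]

theorem IsCurvatureAt.pullback (hA : IsConnection A) (q : TotalSpace G (f *ᵖ E))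
    {β : TangentSpace (𝓡 n) (f q.proj) [⋀^Fin 2]→ₗ[ℝ] GroupLieAlgebra 𝓘(ℝ, F) G}
    (h : IsCurvatureAt A (Pullback.lift f q) β) :
    IsCurvatureAt (pullbackForm (m := m) f A) q
      (β.compLinearMap (mfderiv (𝓡 m) (𝓡 n) f q.proj).toLinearMap) := by
  intro u v
  rw [curvature_pullbackForm hf hA, h, mfderiv_proj_pullbackLift hf, mfderiv_proj_pullbackLift hf]
  rw [AlternatingMap.compLinearMap_apply]
  congr 1
  funext i
  fin_cases i <;> rfl

end PullbackConnection

/-! ## Instantons on the four-sphere and their pullbacks -/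

section Instantons

theorem hopf_surjective : Function.Surjective hopf := by
  intro p
  have hp : (p : R5) 0 ^ 2 + (p : R5) 1 ^ 2 + (p : R5) 2 ^ 2 + (p : R5) 3 ^ 2 +
      (p : R5) 4 ^ 2 = 1 := by
    have h : ‖(p : R5)‖ ^ 2 = 1 := by rw [norm_eq_of_mem_sphere]; norm_num
    simpa only [EuclideanSpace.norm_sq_eq, Real.norm_eq_abs, sq_abs, Fin.sum_univ_five] using h
  suffices h : ∃ r : R8, ‖r‖ ^ 2 = 1 ∧ hopfAmbient r = p by
    obtain ⟨r, hr, hrp⟩ := h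
    refine ⟨⟨r, ?_⟩, Subtype.ext hrp⟩
    rw [mem_sphere_zero_iff_norm]
    nlinarith [norm_nonneg r]
  simp only [hopfAmbient_eq, EuclideanSpace.norm_sq_eq, Real.norm_eq_abs, sq_abs,
    Fin.sum_univ_eight]
  set a := (p : R5) 0 with ha
  by_cases h1 : a = -1
  -- The pole `a = -1`, where the formula used below would divide by zero, is the image of `(0, 1)`.
  · rw [h1] at hp
    have hz : ∀ i : Fin 4, (p : R5) i.succ = 0 := by
      intro i
      fin_cases i <;> refine pow_eq_zero_iff two_ne_zero |>.1 (le_antisymm ?_ (sq_nonneg _)) <;>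
        simp <;>
        nlinarith [sq_nonneg ((p : R5) 1), sq_nonneg ((p : R5) 2), sq_nonneg ((p : R5) 3),
          sq_nonneg ((p : R5) 4)]
    refine ⟨!₂[0, 0, 0, 0, 1, 0, 0, 0], by simp, ?_⟩
    ext i
    refine Fin.cases ?_ (fun i => ?_) i
    · simpa using (ha.symm.trans h1).symm
    · rw [hz i]
      fin_cases i <;> simp
  · have ha1 : -1 ≤ a := by
      nlinarith [sq_nonneg ((p : R5) 1), sq_nonneg ((p : R5) 2), sq_nonneg ((p : R5) 3),
        sq_nonneg ((p : R5) 4)]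
    have hpos : 0 < (1 + a) / 2 := by
      have := lt_of_le_of_ne ha1 (Ne.symm h1)
      linarith
    -- Each fibre away from the pole has a point with `x = s` real and positive: `|x|² - |y|² = a`
    -- on the unit sphere forces `s² = (1 + a) / 2`, and `2yx̄ = z` forces `y = z / (2s)`.
    obtain ⟨s, hs, hs2⟩ : ∃ s : ℝ, s ≠ 0 ∧ s ^ 2 = (1 + a) / 2 :=
      ⟨√((1 + a) / 2), (Real.sqrt_pos.2 hpos).ne', Real.sq_sqrt hpos.le⟩
    have hz : ((p : R5) 1 / (2 * s)) ^ 2 + ((p : R5) 2 / (2 * s)) ^ 2 +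
        ((p : R5) 3 / (2 * s)) ^ 2 + ((p : R5) 4 / (2 * s)) ^ 2 = (1 - a) / 2 := by
      have h4 : (2 * s) ^ 2 ≠ 0 := by positivity
      simp only [div_pow, ← add_div]
      rw [div_eq_iff h4, mul_pow, hs2]
      linear_combination hp
    refine ⟨!₂[s, 0, 0, 0, (p : R5) 1 / (2 * s), (p : R5) 2 / (2 * s), (p : R5) 3 / (2 * s),
      (p : R5) 4 / (2 * s)], ?_, ?_⟩
    · simp
      linear_combination hs2 + hz
    · ext i
      fin_cases i <;> simp
      · linear_combination hs2 - hz
      all_goals field_simp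

variable {F : Type*} [NormedAddCommGroup F] [NormedSpace ℝ F] [FiniteDimensional ℝ F]
  {G : Type*} [TopologicalSpace G] [ChartedSpace F G] [Group G] [LieGroup 𝓘(ℝ, F) ∞ G]
  {E : S4 → Type*} [TopologicalSpace (TotalSpace G E)] [∀ x, TopologicalSpace (E x)]
  [FiberBundle G E] [∀ x, MulAction Gᵐᵒᵖ (E x)] [∀ x, Nonempty (E x)]
  [SmoothPrincipalBundle 4 F G E]

theorem isASDInstanton_iff_isG2Instanton_pullback
    (φ : ∀ x : S7, TangentSpace (𝓡 7) x [⋀^Fin 3]→ₗ[ℝ] ℝ)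
    (hφ : ∀ (x : S7)
      (β : TangentSpace (𝓡 4) (hopf x) [⋀^Fin 2]→ₗ[ℝ] GroupLieAlgebra 𝓘(ℝ, F) G),
      IsAntiSelfDual (hopf x) β ↔ SatisfiesG2Equation (φ x) (hopfPullback x β))
    {A : LieValuedForm 4 F G E} (hA : IsConnection A) :
    IsASDInstanton A ↔ IsG2Instanton φ (pullbackForm (m := 7) hopf A) := by
  have : Fact (finrank ℝ R8 = 7 + 1) := ⟨by simp⟩
  have : Fact (finrank ℝ R5 = 4 + 1) := ⟨by simp⟩
  constructor
  · rintro ⟨-, h⟩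
    refine ⟨hA.pullback contMDiff_hopf, fun q => ?_⟩
    obtain ⟨β, hβ, hβ'⟩ := h (Pullback.lift hopf q)
    exact ⟨hopfPullback q.proj β, hβ.pullback contMDiff_hopf hA q, (hφ q.proj β).1 hβ'⟩
  · rintro ⟨-, h⟩
    refine ⟨hA, ?_⟩
    rintro ⟨x, y⟩
    -- Only this direction needs surjectivity: anti-self-duality must be tested at every point of
    -- the base.
    obtain ⟨x', rfl⟩ := hopf_surjective x
    obtain ⟨β, hβ⟩ := exists_isCurvatureAt hA ⟨hopf x', y⟩
    refine ⟨β, hβ, (hφ x' β).2 ?_⟩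
    let q : TotalSpace G (hopf *ᵖ E) := ⟨x', y⟩
    obtain ⟨β', hβ', hsol⟩ := h q
    have hβ'' : IsCurvatureAt (pullbackForm (m := 7) hopf A) q (hopfPullback x' β) :=
      IsCurvatureAt.pullback contMDiff_hopf hA q hβ
    -- The form supplied by the G₂-instanton condition need not be given as a pullback; uniqueness
    -- identifies it with the pullback of `β`.
    rwa [hβ'.unique hβ''] at hsol

end Instantons

end

theorem lemma3 {F : Type*} [NormedAddCommGroup F] [NormedSpace ℝ F] [FiniteDimensional ℝ F]
    {G : Type*} [TopologicalSpace G] [ChartedSpace F G] [Group G] [LieGroup 𝓘(ℝ, F) ∞ G]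
    {E : S4 → Type*} [TopologicalSpace (TotalSpace G E)] [∀ x, TopologicalSpace (E x)]
    [FiberBundle G E] [∀ x, MulAction Gᵐᵒᵖ (E x)] [∀ x, Nonempty (E x)]
    [SmoothPrincipalBundle 4 F G E]
    (A : LieValuedForm 4 F G E) (hA : IsConnection A) :
    (IsASDInstanton A ↔ IsG2Instanton phiStd (pullbackForm (m := 7) hopf A)) ∧
    (IsASDInstanton A ↔ IsG2Instanton phiSq (pullbackForm (m := 7) hopf A)) :=
  ⟨isASDInstanton_iff_isG2Instanton_pullback phiStd isAntiSelfDual_iff_std hA,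
    isASDInstanton_iff_isG2Instanton_pullback phiSq isAntiSelfDual_iff_sq hA⟩
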